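/- Let $m=n-1\in\mathbb N_0$, $d,\nu\in\mathbb R$, $\mathbb R_+=(0,\infty)$, $\overline{\mathbb R}_+=[0,\infty)$, $\langle\xi'\rangle=(1+|\xi'|^2)^{1/2}$, $\langle\xi',\mu\rangle=(1+|\xi'|^2+\mu^2)^{1/2}$, and write $D=-i\partial$. *Function spaces.* $H^s(\mathbb R_+)$, $s\in\mathbb R$, is the space of restrictions to $\mathbb R_+$ of elements of the $L^2$-Sobolev space $H^s(\mathbb R)$, with the quotient norm, and $H^{s,\delta}(\mathbb R_+)=\langle t\rangle^{-\delta}H^s(\mathbb R_+)$. With $(\theta u)(x)=u(e^{-x})$ for $u\in\mathcal D'(\mathbb R_+)$, let $\mathcal H^{s,\gamma}(\mathbb R_+)=t^{\gamma-1/2}\,\theta^{-1}H^s(\mathbb R)$ with the norm $\|u\|_{\mathcal H^{s,\gamma}(\mathbb R_+)}=\|\theta(t^{1/2-\gamma}u)\|_{H^s(\mathbb R)}$. For a cut-off function $\omega\in C^\infty_{\rm comp}(\overline{\mathbb R}_+)$, $\omega\equiv1$ near $0$, let $\mathcal K^{s,\gamma}(\mathbb R_+)$ be the space of all $u\in\mathcal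 D'(\mathbb R_+)$ with $\|u\|=\|\omega u\|_{\mathcal H^{s,\gamma}(\mathbb R_+)}+\|(1-\omega)u\|_{H^s(\mathbb R_+)}<\infty$, and let $\mathcal K^{s,\gamma}(\mathbb R_+)^\rho=\langle t\rangle^{-\rho}\mathcal K^{s,\gamma}(\mathbb R_+)$. Spaces with a weight carry the obvious norms. Let $(\kappa_\lambda u)(t)=\lambda^{1/2}u(\lambda t)$, $\lambda>0$, be the standard group action on $\mathcal D'(\mathbb R_+)$, and $\kappa^{-1}(\xi')=\kappa_{\langle\xi'\rangle}^{-1}$, $\kappa^{-1}(\xi',\mu)=\kappa_{\langle\xi',\mu\rangle}^{-1}$. *Symbol-kernels.* A weakly parameter-dependent Poisson symbol-kernel of order $d+\frac12$ and regularity $\nu$ is a smooth function $\widetilde k(x',x_n,\xi';\mu)$ of $x',\xi'\in\mathbb R^m$, $x_n\in\mathbb R_+$, $\mu\in\overline{\mathbb R}_+$ such that for all $\alpha,\beta\in\mathbb N_0^m$ and $j,\ell,\ell'\in\mathbb N_0$ there is a constant $C$ with $$\|D^\beta_{x'}D^\alpha_{\xi'}D^j_\mu x_n^\ell D_{x_n}^{\ell'}\widetilde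 k\|_{L^2(\mathbb R_+)}\le C\Big(\frac{\langle\xi'\rangle}{\langle\xi',\mu\rangle}\Big)^{\nu-[\ell-\ell']_+-|\alpha|}\langle\xi',\mu\rangle^{d-\ell+\ell'-|\alpha|-j}$$ for all $(x',\xi',\mu)$, where $[r]_+=\max\{r,0\}$. **Theorem.** Let $\widetilde k$ be a function of $(x',\xi',\mu)\in\mathbb R^m\times\mathbb R^m\times\overline{\mathbb R}_+$ that belongs to $C^\infty(\mathbb R^m\times\mathbb R^m\times\overline{\mathbb R}_+,\mathcal L(\mathbb C,H^{s,\delta}(\mathbb R_+)))$ for all $s,\delta\in\mathbb R$ and to $C^\infty(\mathbb R^m\times\mathbb R^m\times\overline{\mathbb R}_+,\mathcal L(\mathbb C,\mathcal K^{s,0}(\mathbb R_+)^\rho))$ for all $s,\rho\in\mathbb R$. Then $\widetilde k(x',\xi';\mu)$ is of the form $c\mapsto c\,\widetilde k(x',\cdot,\xi';\mu)$ for a weakly parameter-dependent Poisson symbol-kernel of order $d+\frac12$ and regularity $\nu$ if, and only if, for all $s,\rho\in\mathbb R$, all $\alpha,\beta\in\mathbb N_0^m$ and all $j\in\mathbb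 N_0$ there is a constant $C$ such that, for all $(x',\xi',\mu)$, $$\|\kappa^{-1}(\xi')D^\beta_{x'}D^\alpha_{\xi'}D^j_\mu\widetilde k(x',\xi';\mu)\|_{\mathcal L(\mathbb C,\mathcal K^{s,0}(\mathbb R_+)^\rho)}\le C\,\langle\xi'\rangle^{\nu-|\alpha|}\langle\xi',\mu\rangle^{d-\nu-j}$$ and $$\|\kappa^{-1}(\xi',\mu)D^\beta_{x'}D^\alpha_{\xi'}D^j_\mu\widetilde k(x',\xi';\mu)\|_{\mathcal L(\mathbb C,H^{s}(\mathbb R_+))}\le C\,\langle\xi'\rangle^{\nu-|\alpha|}\langle\xi',\mu\rangle^{d-\nu-j}.$$ -/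

import Mathlib

open Set TopologicalSpace MeasureTheory
open scoped Distributions SchwartzMap ContDiff ENNReal

noncomputable section

/-- Data of an operator `φ ↦ weight · (φ ∘ map)` from test functions on `Ω₁` to test functions on
`Ω₂`: `weight` and `map : Ω₂ → Ω₁` are smooth on `Ω₂`, and `map` has a continuous left inverse
`inv : Ω₁ → Ω₂`, so that compact supports stay compact. -/
structure WeightedMap (Ω₁ Ω₂ : Opens ℝ) where
  weight : ℝ → ℝ
  map : ℝ → ℝ
  inv : ℝ → ℝ
  contDiffOn_weight : ContDiffOn ℝ ∞ weight Ω₂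
  contDiffOn_map : ContDiffOn ℝ ∞ map Ω₂
  mapsTo : MapsTo map Ω₂ Ω₁
  continuousOn_inv : ContinuousOn inv Ω₁
  mapsTo_inv : MapsTo inv Ω₁ Ω₂
  leftInvOn : LeftInvOn inv map Ω₂

namespace WeightedMap

variable {Ω₁ Ω₂ : Opens ℝ} (W : WeightedMap Ω₁ Ω₂)

/-- The function `weight · (f ∘ map)` on `Ω₂`, extended by zero. -/
def pull (f : ℝ → ℝ) : ℝ → ℝ := (Ω₂ : Set ℝ).indicator fun x => W.weight x * f (W.map x)

/-- A compact set that contains the support of `pull f` if `f` is supported in `K`. -/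
def image (K : Compacts ℝ) (hK : (K : Set ℝ) ⊆ Ω₁) : Compacts ℝ :=
  ⟨W.inv '' K, K.isCompact.image_of_continuousOn (W.continuousOn_inv.mono hK)⟩

theorem image_subset (K : Compacts ℝ) (hK : (K : Set ℝ) ⊆ Ω₁) :
    (W.image K hK : Set ℝ) ⊆ Ω₂ := by
  rintro _ ⟨x, hx, rfl⟩
  exact W.mapsTo_inv (hK hx)

theorem pull_eq_zero (K : Compacts ℝ) (hK : (K : Set ℝ) ⊆ Ω₁) {f : ℝ → ℝ}
    (hf : EqOn f 0 (K : Set ℝ)ᶜ) : EqOn (W.pull f) 0 (W.image K hK : Set ℝ)ᶜ := by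
  intro x hx
  by_cases hxΩ : x ∈ (Ω₂ : Set ℝ)
  · have : W.map x ∉ (K : Set ℝ) := fun h => hx ⟨W.map x, h, W.leftInvOn hxΩ⟩
    simp [pull, indicator_of_mem hxΩ, hf this]
  · simp [pull, indicator_of_notMem hxΩ]

theorem contDiff_pull (K : Compacts ℝ) (hK : (K : Set ℝ) ⊆ Ω₁) {f : ℝ → ℝ}
    (hf : ContDiff ℝ ∞ f) (hf0 : EqOn f 0 (K : Set ℝ)ᶜ) : ContDiff ℝ ∞ (W.pull f) := by
  rw [contDiff_iff_contDiffAt]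
  intro x
  by_cases hx : x ∈ (Ω₂ : Set ℝ)
  · have h1 : ContDiffOn ℝ ∞ (fun x => W.weight x * f (W.map x)) Ω₂ :=
      W.contDiffOn_weight.mul (hf.comp_contDiffOn W.contDiffOn_map)
    refine (h1.contDiffAt (Ω₂.isOpen.mem_nhds hx)).congr_of_eventuallyEq ?_
    filter_upwards [Ω₂.isOpen.mem_nhds hx] with y hy
    exact indicator_of_mem hy _
  · have hx' : x ∈ (W.image K hK : Set ℝ)ᶜ := fun h => hx (W.image_subset K hK h)
    refine (contDiffAt_const (c := (0 : ℝ))).congr_of_eventuallyEq ?_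
    filter_upwards [(W.image K hK).isCompact.isClosed.isOpen_compl.mem_nhds hx'] with y hy
    exact W.pull_eq_zero K hK hf0 hy

theorem pull_bound (K : Compacts ℝ) (hK : (K : Set ℝ) ⊆ Ω₁) (i : ℕ) :
    ∃ (s : Finset ℕ) (C : ℝ), 0 ≤ C ∧ ∀ f : 𝓓^{⊤}_{K}(ℝ, ℝ), ∀ x ∈ W.image K hK,
      ‖iteratedFDeriv ℝ i (W.pull f) x‖ ≤
        C * (s.sup fun j => ContDiffMapSupportedIn.seminorm ℝ ℝ ℝ ⊤ K j) f := by
  have hO : UniqueDiffOn ℝ (Ω₂ : Set ℝ) := Ω₂.isOpen.uniqueDiffOn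
  have bdd : ∀ h : ℝ → ℝ, ContDiffOn ℝ ∞ h Ω₂ → ∃ C : ℝ, 1 ≤ C ∧ ∀ j ≤ i,
      ∀ x ∈ W.image K hK, ‖iteratedFDerivWithin ℝ j h Ω₂ x‖ ≤ C := by
    intro h hh
    have : ∀ j, ∃ C : ℝ, ∀ x ∈ W.image K hK, ‖iteratedFDerivWithin ℝ j h Ω₂ x‖ ≤ C := fun j =>
      (W.image K hK).isCompact.exists_bound_of_continuousOn
        ((hh.continuousOn_iteratedFDerivWithin (mod_cast le_top) hO).mono (W.image_subset K hK))
    choose C hC using this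
    refine ⟨1 + ∑ j ∈ Finset.range (i + 1), |C j|, ?_, fun j hj x hx => ?_⟩
    · have : 0 ≤ ∑ j ∈ Finset.range (i + 1), |C j| := Finset.sum_nonneg fun _ _ => abs_nonneg _
      linarith
    · have := Finset.single_le_sum (f := fun j => |C j|) (s := Finset.range (i + 1))
        (fun _ _ => abs_nonneg _) (Finset.mem_range_succ_iff.2 hj)
      have h2 := hC j x hx
      have h3 := le_abs_self (C j)
      linarith
  obtain ⟨A, hA1, hA⟩ := bdd _ W.contDiffOn_weight
  obtain ⟨D, hD1, hD⟩ := bdd _ W.contDiffOn_map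
  refine ⟨Finset.Iic i, ∑ j ∈ Finset.range (i + 1),
    (i.choose j : ℝ) * A * ((i - j).factorial * D ^ (i - j)), by positivity, fun f x hx => ?_⟩
  set N := ((Finset.Iic i).sup fun j => ContDiffMapSupportedIn.seminorm ℝ ℝ ℝ ⊤ K j) f with hN
  have hxΩ := W.image_subset K hK hx
  have hfs : ContDiff ℝ ∞ f := f.contDiff
  have e1 : iteratedFDeriv ℝ i (W.pull f) x =
      iteratedFDerivWithin ℝ i (fun y => W.weight y * f (W.map y)) Ω₂ x := by
    rw [← iteratedFDerivWithin_of_isOpen i Ω₂.isOpen hxΩ]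
    exact iteratedFDerivWithin_congr (fun y hy => indicator_of_mem hy _) hxΩ i
  rw [e1]
  refine (norm_iteratedFDerivWithin_mul_le W.contDiffOn_weight
    (hfs.comp_contDiffOn W.contDiffOn_map) hO hxΩ (n := i) (mod_cast le_top)).trans ?_
  rw [Finset.sum_mul]
  refine Finset.sum_le_sum fun j hj => ?_
  have hji : j ≤ i := Finset.mem_range_succ_iff.1 hj
  have h2 : ‖iteratedFDerivWithin ℝ (i - j) (fun y => f (W.map y)) Ω₂ x‖ ≤
      (i - j).factorial * N * D ^ (i - j) := by
    refine norm_iteratedFDerivWithin_comp_le (g := f) (t := univ) hfs.contDiffOn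
      W.contDiffOn_map (n := i - j) (WithTop.coe_le_coe.2 le_top) uniqueDiffOn_univ hO (mapsTo_univ _ _) hxΩ
      (fun k hk => ?_) (fun k hk1 hk => ?_)
    · rw [iteratedFDerivWithin_univ]
      exact (ContDiffMapSupportedIn.norm_iteratedFDeriv_apply_le_seminorm_top ℝ).trans
        (Seminorm.le_finset_sup_apply (Finset.mem_Iic.2 (hk.trans (Nat.sub_le _ _))))
    · exact (hD k (hk.trans (Nat.sub_le _ _)) x hx).trans (le_self_pow₀ hD1 (by omega))
  have hN0 : 0 ≤ N := apply_nonneg _ _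
  calc _ ≤ (i.choose j : ℝ) * A * ((i - j).factorial * N * D ^ (i - j)) := by
        gcongr
        · exact hA j hji x hx
        · exact h2
    _ = _ := by ring

/-- The continuous linear map `φ ↦ weight · (φ ∘ map)` on test functions. -/
def testMap : 𝓓(Ω₁, ℝ) →L[ℝ] 𝓓(Ω₂, ℝ) :=
  TestFunction.limitCLM ℝ
    (fun φ =>
      let K : Compacts ℝ := ⟨tsupport φ, φ.hasCompactSupport⟩
      have hK : (K : Set ℝ) ⊆ Ω₁ := φ.tsupport_subset
      have h0 : EqOn φ 0 (K : Set ℝ)ᶜ := fun _ hx => image_eq_zero_of_notMem_tsupport hx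
      have hz := W.pull_eq_zero K hK h0
      have hs : tsupport (W.pull φ) ⊆ W.image K hK :=
        closure_minimal (fun x hx => by_contra fun h => hx (hz h))
          (W.image K hK).isCompact.isClosed
      { toFun := W.pull φ
        contDiff' := W.contDiff_pull K hK φ.contDiff h0
        hasCompactSupport' := (W.image K hK).isCompact.of_isClosed_subset (isClosed_tsupport _) hs
        tsupport_subset' := hs.trans (W.image_subset K hK) })
    (fun K hK => (TestFunction.ofSupportedInCLM ℝ (W.image_subset K hK)).comp
      (ContDiffMapSupportedIn.mkCLM ℝ (fun f => W.pull f)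
        (fun f g x => by by_cases hx : x ∈ (Ω₂ : Set ℝ) <;> simp [pull, hx, mul_add])
        (fun c f x => by
          by_cases hx : x ∈ (Ω₂ : Set ℝ) <;> simp [pull, hx]
          ring)
        (fun f => W.contDiff_pull K hK f.contDiff f.zero_on_compl)
        (fun f => W.pull_eq_zero K hK f.zero_on_compl)
        (fun i _ => W.pull_bound K hK i)))
    (fun K hK f => rfl)

theorem testMap_apply (φ : 𝓓(Ω₁, ℝ)) (x : ℝ) :
    W.testMap φ x = (Ω₂ : Set ℝ).indicator (fun x => W.weight x * φ (W.map x)) x := rfl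

/-- The transposed operator on distributions, `⟨distMap T, φ⟩ = ⟨T, weight · (φ ∘ map)⟩`. -/
def distMap : 𝓓'(Ω₂, ℂ) →ₗ[ℂ] 𝓓'(Ω₁, ℂ) where
  toFun T := ContinuousLinearMap.precompCompactConvergenceCLM ℂ W.testMap T
  map_add' _ _ := rfl
  map_smul' _ _ := rfl

theorem distMap_apply (T : 𝓓'(Ω₂, ℂ)) (φ : 𝓓(Ω₁, ℝ)) : W.distMap T φ = T (W.testMap φ) := rfl

end WeightedMap

/-- A test function viewed as a complex-valued Schwartz function. -/
def testToSchwartz (Ω : Opens ℝ) : 𝓓(Ω, ℝ) →L[ℝ] 𝓢(ℝ, ℂ) :=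
  TestFunction.mkCLM ℝ
    (fun φ => HasCompactSupport.toSchwartzMap (f := fun x => (φ x : ℂ))
      (φ.hasCompactSupport.comp_left Complex.ofReal_zero)
      (Complex.ofRealCLM.contDiff.comp φ.contDiff))
    (fun f g => SchwartzMap.ext fun x => Complex.ofReal_add (f x) (g x))
    (fun c f => SchwartzMap.ext fun x => Complex.ofReal_mul c (f x))
    (fun K hK => by
      let L : 𝓓^{⊤}_{K}(ℝ, ℝ) →ₗ[ℝ] 𝓢(ℝ, ℂ) :=
        { toFun := fun φ => HasCompactSupport.toSchwartzMap (f := fun x => (φ x : ℂ))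
            (φ.hasCompactSupport.comp_left Complex.ofReal_zero)
            (Complex.ofRealCLM.contDiff.comp φ.contDiff)
          map_add' := fun f g => SchwartzMap.ext fun x => Complex.ofReal_add (f x) (g x)
          map_smul' := fun c f => SchwartzMap.ext fun x => Complex.ofReal_mul c (f x) }
      change Continuous L
      obtain ⟨R, hR⟩ := K.isCompact.isBounded.exists_norm_le
      refine WithSeminorms.continuous_of_isBounded
        (ContDiffMapSupportedIn.withSeminorms ℝ ℝ ℝ ⊤ K)
        (schwartz_withSeminorms ℝ ℝ ℂ) L (.of_real fun n => ⟨{n.2}, |R| ^ n.1, fun f => ?_⟩)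
      refine SchwartzMap.seminorm_le_bound ℝ n.1 n.2 _
        (mul_nonneg (by positivity) (apply_nonneg _ _)) fun x => ?_
      have h1 : ‖iteratedFDeriv ℝ n.2 (L f) x‖ = ‖iteratedFDeriv ℝ n.2 f x‖ :=
        Complex.ofRealLI.norm_iteratedFDeriv_comp_left (f := f)
          (n := (⊤ : ℕ∞)) f.contDiff.contDiffAt (WithTop.coe_le_coe.2 le_top)
      rw [h1]
      by_cases hx : x ∈ K
      · have h2 := hR x hx
        have h3 := le_abs_self R
        gcongr
        · linarith
        · simpa using ContDiffMapSupportedIn.norm_iteratedFDeriv_apply_le_seminorm_top ℝ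
            (f := f) (x := x) (i := n.2)
      · rw [f.iteratedFDeriv_zero_on_compl hx]
        simp only [Pi.zero_apply, norm_zero, mul_zero]
        exact mul_nonneg (by positivity) (apply_nonneg _ _))

theorem testToSchwartz_apply (Ω : Opens ℝ) (φ : 𝓓(Ω, ℝ)) (x : ℝ) :
    testToSchwartz Ω φ x = (φ x : ℂ) := rfl

/-- Restriction of tempered distributions on `ℝ` to an open set `Ω`. -/
def restrictTempered (Ω : Opens ℝ) : 𝓢'(ℝ, ℂ) →ₗ[ℂ] 𝓓'(Ω, ℂ) where
  toFun u := ((u : 𝓢(ℝ, ℂ) →L[ℂ] ℂ).restrictScalars ℝ).comp (testToSchwartz Ω)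
  map_add' _ _ := rfl
  map_smul' _ _ := rfl

theorem restrictTempered_apply (Ω : Opens ℝ) (u : 𝓢'(ℝ, ℂ)) (φ : 𝓓(Ω, ℝ)) :
    restrictTempered Ω u φ = u (testToSchwartz Ω φ) := rfl

/-- The open half-axis `ℝ₊ = (0, ∞)`. -/
def halfLine : Opens ℝ := ⟨Ioi 0, isOpen_Ioi⟩

/-- Multiplication of distributions on `ℝ₊` by a function that is smooth on `ℝ₊`. -/
def mulDist (g : ℝ → ℝ) (hg : ContDiffOn ℝ ∞ g (Ioi 0)) :
    𝓓'(halfLine, ℂ) →ₗ[ℂ] 𝓓'(halfLine, ℂ) :=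
  WeightedMap.distMap
    { weight := g
      map := id
      inv := id
      contDiffOn_weight := hg
      contDiffOn_map := contDiffOn_id
      mapsTo := fun _ h => h
      continuousOn_inv := continuousOn_id
      mapsTo_inv := fun _ h => h
      leftInvOn := fun _ _ => rfl }

/-- The standard group action `(κ_λ u)(t) = λ^{1/2} u(λ t)`, extended to distributions by
`⟨κ_λ T, φ⟩ = ⟨T, κ_λ⁻¹ φ⟩` with `(κ_λ⁻¹ φ)(t) = λ^{-1/2} φ(t / λ)`. -/
def kappa (lam : {x : ℝ // 0 < x}) : 𝓓'(halfLine, ℂ) →ₗ[ℂ] 𝓓'(halfLine, ℂ) :=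
  WeightedMap.distMap
    { weight := fun _ => (lam : ℝ) ^ (-(1 / 2) : ℝ)
      map := fun t => t / lam
      inv := fun t => lam * t
      contDiffOn_weight := contDiffOn_const
      contDiffOn_map := contDiffOn_id.div_const _
      mapsTo := fun _ h => div_pos h lam.2
      continuousOn_inv := by fun_prop
      mapsTo_inv := fun _ h => mul_pos lam.2 h
      leftInvOn := fun _ _ => mul_div_cancel₀ _ lam.2.ne' }

/-- The inverse of the change of variables `(θ u)(x) = u(e^{-x})`; it maps `v` to `v(-ln t)`,
i.e. `⟨θ⁻¹ v, ψ⟩ = ⟨v, ψ(e^{-x}) e^{-x}⟩`. -/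
def thetaInv : 𝓓'((⊤ : Opens ℝ), ℂ) →ₗ[ℂ] 𝓓'(halfLine, ℂ) :=
  WeightedMap.distMap
    { weight := fun x => Real.exp (-x)
      map := fun x => Real.exp (-x)
      inv := fun t => -Real.log t
      contDiffOn_weight := (Real.contDiff_exp.comp contDiff_neg).contDiffOn
      contDiffOn_map := (Real.contDiff_exp.comp contDiff_neg).contDiffOn
      mapsTo := fun _ _ => Real.exp_pos _
      continuousOn_inv := (Real.continuousOn_log.mono fun _ h => ne_of_gt h).neg
      mapsTo_inv := fun _ _ => trivial
      leftInvOn := fun x _ => by simp }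

/-- `L²(ℝ)` with complex values. -/
abbrev L2R : Type := Lp ℂ 2 (volume : Measure ℝ)

/-- The Sobolev space `H^s(ℝ)` of the tempered distributions `u` with
`f := 𝓕⁻¹ ⟨·⟩^s 𝓕 u ∈ L²(ℝ)`, normed by `‖u‖ = ‖f‖_{L²}`, is realised as `L²(ℝ)` through the bijection
`f ↦ u = 𝓕⁻¹ ⟨·⟩^{-s} 𝓕 f`; this is that map into the tempered distributions. (Mathlib's Fourier
transform has `2π` in the exponent, which gives an equivalent norm.) -/
def sobolevEmb (s : ℝ) : L2R →L[ℂ] 𝓢'(ℝ, ℂ) :=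
  (TemperedDistribution.besselPotential ℝ ℂ (-s)).comp
    (Lp.toTemperedDistributionCLM ℂ volume 2)

/-- The range of `sobolevEmb s` is `H^s(ℝ)`. -/
theorem mem_range_sobolevEmb (s : ℝ) (u : 𝓢'(ℝ, ℂ)) :
    u ∈ range (sobolevEmb s) ↔ TemperedDistribution.MemSobolev s 2 u := by
  constructor
  · rintro ⟨f, hf⟩
    exact ⟨f, (TemperedDistribution.besselPotential_neg_apply_eq_iff s _ _).1 hf⟩
  · rintro ⟨f, hf⟩
    exact ⟨f, (TemperedDistribution.besselPotential_neg_apply_eq_iff s _ _).2 hf⟩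

/-- The elements of `H^s(ℝ)` that vanish on `ℝ₊`. -/
def vanishing (s : ℝ) : Submodule ℂ L2R :=
  LinearMap.ker (restrictTempered halfLine ∘ₗ (sobolevEmb s).toLinearMap)

instance isClosed_vanishing (s : ℝ) : IsClosed (vanishing s : Set L2R) := by
  have : (vanishing s : Set L2R) =
      ⋂ φ : 𝓓(halfLine, ℝ), {f | sobolevEmb s f (testToSchwartz halfLine φ) = 0} := by
    ext f
    simp only [SetLike.mem_coe, vanishing, LinearMap.mem_ker, mem_iInter, mem_ofPred_eq]
    exact ⟨fun h φ => congrArg (fun T : 𝓓'(halfLine, ℂ) => T φ) h,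
      fun h => DFunLike.ext _ _ h⟩
  rw [this]
  refine isClosed_iInter fun φ => isClosed_eq ?_ continuous_const
  exact (continuous_eval_const (testToSchwartz halfLine φ)).comp (sobolevEmb s).continuous

/-- The space `H^s(ℝ₊)` of restrictions to `ℝ₊` of elements of `H^s(ℝ)`. The quotient norm is
`‖v‖ = inf {‖u‖_{H^s(ℝ)} : u|_{ℝ₊} = v}`. -/
abbrev HalfSobolev (s : ℝ) : Type := L2R ⧸ vanishing s

/-- The inclusion of `H^s(ℝ₊)` into the distributions on `ℝ₊`, `[u] ↦ u|_{ℝ₊}`. -/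
def halfSobolevEmb (s : ℝ) : HalfSobolev s →ₗ[ℂ] 𝓓'(halfLine, ℂ) :=
  (vanishing s).liftQ (restrictTempered halfLine ∘ₗ (sobolevEmb s).toLinearMap) le_rfl

/-- The function `t ↦ ⟨t⟩^r = (1 + t²)^{r/2}`. -/
def bracketPow (r t : ℝ) : ℝ := (1 + t ^ 2) ^ (r / 2)

theorem contDiffOn_bracketPow (r : ℝ) : ContDiffOn ℝ ∞ (bracketPow r) (Ioi 0) :=
  ContDiffOn.rpow_const_of_ne (by fun_prop) fun t _ => (by positivity : (0 : ℝ) < 1 + t ^ 2).ne'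

/-- The inclusion of `H^{s,δ}(ℝ₊) = ⟨t⟩^{-δ} H^s(ℝ₊)` into the distributions on `ℝ₊`. As a normed
space `H^{s,δ}(ℝ₊)` is `H^s(ℝ₊)`, with `v` standing for `⟨t⟩^{-δ} v`. -/
def weightedSobolevEmb (s δ : ℝ) : HalfSobolev s →ₗ[ℂ] 𝓓'(halfLine, ℂ) :=
  mulDist (bracketPow (-δ)) (contDiffOn_bracketPow (-δ)) ∘ₗ halfSobolevEmb s

theorem contDiffOn_rpow_halfLine (r : ℝ) : ContDiffOn ℝ ∞ (fun t : ℝ => t ^ r) (Ioi 0) :=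
  ContDiffOn.rpow_const_of_ne contDiffOn_id fun _ h => ne_of_gt h

/-- The inclusion of `𝓗^{s,γ}(ℝ₊) = t^{γ-1/2} θ⁻¹ H^s(ℝ)` into the distributions on `ℝ₊`. As a
normed space `𝓗^{s,γ}(ℝ₊)` is `H^s(ℝ)`, with `v` standing for `t^{γ-1/2} θ⁻¹ v`. -/
def mellinSobolevEmb (s γ : ℝ) : L2R →ₗ[ℂ] 𝓓'(halfLine, ℂ) :=
  mulDist (fun t => t ^ (γ - 1 / 2)) (contDiffOn_rpow_halfLine (γ - 1 / 2)) ∘ₗ thetaInv ∘ₗ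
    restrictTempered ⊤ ∘ₗ (sobolevEmb s).toLinearMap

/-- A cut-off function on `[0, ∞)`: smooth, compactly supported and equal to `1` near `t = 0`
(only its values on `ℝ₊` matter). -/
structure IsCutoff (χ : ℝ → ℝ) : Prop where
  smooth : ContDiffOn ℝ ∞ χ (Ioi 0)
  eq_one : ∃ ε > 0, ∀ t ∈ Ioo 0 ε, χ t = 1
  eq_zero : ∃ R, ∀ t > R, χ t = 0

/-- The pairs `(a, b) = (χ u, (1 - χ) u) ∈ 𝓗^{s,γ}(ℝ₊) × H^s(ℝ₊)` that come from a distribution `u`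
on `ℝ₊`, with the norm `‖a‖ + ‖b‖`. -/
def coneSubmodule {χ : ℝ → ℝ} (hχ : IsCutoff χ) (s γ : ℝ) :
    Submodule ℂ (WithLp 1 (L2R × HalfSobolev s)) where
  carrier := {x | ∃ u : 𝓓'(halfLine, ℂ),
    mulDist χ hχ.smooth u = mellinSobolevEmb s γ x.fst ∧
    mulDist (fun t => 1 - χ t) (contDiffOn_const.sub hχ.smooth) u = halfSobolevEmb s x.snd}
  add_mem' := by
    rintro x y ⟨u, hu1, hu2⟩ ⟨v, hv1, hv2⟩
    exact ⟨u + v, by simp [hu1, hv1], by simp [hu2, hv2]⟩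
  zero_mem' := ⟨0, by simp, by simp⟩
  smul_mem' := by
    rintro c x ⟨u, hu1, hu2⟩
    exact ⟨c • u, by simp [hu1], by simp [hu2]⟩

/-- The cone Sobolev space `𝓚^{s,γ}(ℝ₊)` of all distributions `u` on `ℝ₊` with
`χ u ∈ 𝓗^{s,γ}(ℝ₊)` and `(1 - χ) u ∈ H^s(ℝ₊)`, normed by
`‖χ u‖_{𝓗^{s,γ}(ℝ₊)} + ‖(1 - χ) u‖_{H^s(ℝ₊)}`; `u` is represented by the pair `(χ u, (1 - χ) u)`. -/
def ConeSobolev {χ : ℝ → ℝ} (hχ : IsCutoff χ) (s γ : ℝ) : Type := coneSubmodule hχ s γ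

instance {χ : ℝ → ℝ} (hχ : IsCutoff χ) (s γ : ℝ) : NormedAddCommGroup (ConeSobolev hχ s γ) :=
  inferInstanceAs (NormedAddCommGroup (coneSubmodule hχ s γ))

instance {χ : ℝ → ℝ} (hχ : IsCutoff χ) (s γ : ℝ) : NormedSpace ℂ (ConeSobolev hχ s γ) :=
  inferInstanceAs (NormedSpace ℂ (coneSubmodule hχ s γ))

/-- The inclusion of `𝓚^{s,γ}(ℝ₊)` into the distributions on `ℝ₊`,
`(χ u, (1 - χ) u) ↦ χ u + (1 - χ) u = u`. -/
def coneSobolevEmb {χ : ℝ → ℝ} (hχ : IsCutoff χ) (s γ : ℝ) :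
    ConeSobolev hχ s γ →ₗ[ℂ] 𝓓'(halfLine, ℂ) where
  toFun x := mellinSobolevEmb s γ x.1.fst + halfSobolevEmb s x.1.snd
  map_add' x y := by
    change mellinSobolevEmb s γ (x.1.fst + y.1.fst) + halfSobolevEmb s (x.1.snd + y.1.snd) = _
    rw [map_add, map_add]
    abel
  map_smul' c x := by
    change mellinSobolevEmb s γ (c • x.1.fst) + halfSobolevEmb s (c • x.1.snd) = _
    rw [map_smul, map_smul, RingHom.id_apply, smul_add]

/-- The inclusion of `𝓚^{s,γ}(ℝ₊)^ρ = ⟨t⟩^{-ρ} 𝓚^{s,γ}(ℝ₊)` into the distributions on `ℝ₊`. As a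
normed space `𝓚^{s,γ}(ℝ₊)^ρ` is `𝓚^{s,γ}(ℝ₊)`, with `v` standing for `⟨t⟩^{-ρ} v`. -/
def weightedConeEmb {χ : ℝ → ℝ} (hχ : IsCutoff χ) (s γ ρ : ℝ) :
    ConeSobolev hχ s γ →ₗ[ℂ] 𝓓'(halfLine, ℂ) :=
  mulDist (bracketPow (-ρ)) (contDiffOn_bracketPow (-ρ)) ∘ₗ coneSobolevEmb hχ s γ

/-- The points `(x', ξ', μ)`; here `m = n - 1` is the dimension of the boundary. -/
abbrev PhaseSpace (m : ℕ) : Type := EuclideanSpace ℝ (Fin m) × EuclideanSpace ℝ (Fin m) × ℝ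

/-- The parameter domain `ℝ^m × ℝ^m × [0, ∞)`. -/
def phaseDomain (m : ℕ) : Set (PhaseSpace m) := {p | 0 ≤ p.2.2}

/-- `⟨ξ'⟩ = (1 + |ξ'|²)^{1/2}`. -/
def japXi {m : ℕ} (p : PhaseSpace m) : {x : ℝ // 0 < x} :=
  ⟨√(1 + ‖p.2.1‖ ^ 2), by positivity⟩

/-- `⟨ξ', μ⟩ = (1 + |ξ'|² + μ²)^{1/2}`. -/
def japXiMu {m : ℕ} (p : PhaseSpace m) : {x : ℝ // 0 < x} :=
  ⟨√(1 + ‖p.2.1‖ ^ 2 + p.2.2 ^ 2), by positivity⟩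

section Derivatives

variable {V F : Type*} [NormedAddCommGroup V] [NormedSpace ℝ V]
  [NormedAddCommGroup F] [NormedSpace ℝ F]

/-- The derivative of `f` in direction `v`, for functions on `S`. -/
def dirDeriv (S : Set V) (v : V) (f : V → F) : V → F := fun p => fderivWithin ℝ f S p v

/-- The derivative `∂^α` with respect to the directions `e 0, …, e (m - 1)`. -/
def multiDeriv (S : Set V) {m : ℕ} (e : Fin m → V) (α : Fin m → ℕ) (f : V → F) : V → F :=
  (List.finRange m).foldr (fun i g => (dirDeriv S (e i))^[α i] g) f

/-- The derivative `∂_{x'}^β ∂_{ξ'}^α ∂_μ^j f` of a function on `S ⊆ V`, where `V` contains the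
variables `(x', ξ', μ)` through the linear map `incl`. It differs from `D_{x'}^β D_{ξ'}^α D_μ^j f`,
`D = -i∂`, by a constant factor of modulus one, which no norm sees. -/
def paramDeriv {m : ℕ} (incl : PhaseSpace m →ₗ[ℝ] V) (S : Set V) (β α : Fin m → ℕ) (j : ℕ)
    (f : V → F) : V → F :=
  multiDeriv S (fun i => incl (EuclideanSpace.single i 1, 0, 0)) β
    (multiDeriv S (fun i => incl (0, EuclideanSpace.single i 1, 0)) α
      ((dirDeriv S (incl (0, 0, 1)))^[j] f))

end Derivatives

/-- Length of a multi-index. -/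
def multiAbs {m : ℕ} (α : Fin m → ℕ) : ℕ := ∑ i, α i

/-- The domain `ℝ^m × ℝ^m × [0, ∞) × (0, ∞)` of symbol-kernels, whose points are
`((x', ξ', μ), x_n)`. -/
def kernelDomain (m : ℕ) : Set (PhaseSpace m × ℝ) := phaseDomain m ×ˢ Ioi 0

/-- `k` is a weakly parameter-dependent Poisson symbol-kernel of order `d + 1/2` and
regularity `ν`. -/
structure IsWeakPoissonKernel {m : ℕ} (d ν : ℝ) (k : PhaseSpace m × ℝ → ℂ) : Prop where
  smooth : ContDiffOn ℝ ∞ k (kernelDomain m)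
  estimate : ∀ (β α : Fin m → ℕ) (j l l' : ℕ), ∃ C : ℝ, ∀ p ∈ phaseDomain m,
    eLpNorm (fun t : ℝ => paramDeriv (LinearMap.inl ℝ (PhaseSpace m) ℝ) (kernelDomain m) β α j
        (fun q => (q.2 : ℂ) ^ l * (dirDeriv (kernelDomain m) (0, 1))^[l'] k q) (p, t))
      2 (volume.restrict (Ioi 0)) ≤
    ENNReal.ofReal (C *
      ((japXi p / japXiMu p : ℝ) ^ (ν - max ((l : ℝ) - l') 0 - multiAbs α) *
        (japXiMu p : ℝ) ^ (d - l + l' - multiAbs α - j)))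

section OperatorValued

variable {m : ℕ} {E : Type*} [NormedAddCommGroup E] [NormedSpace ℂ E]

/-- The operator `K p : ℂ → 𝓓'(ℝ₊)` is `c ↦ c · k(p, ·)` for all `p = (x', ξ', μ)`. -/
def IsKernelOf (k : PhaseSpace m × ℝ → ℂ) (K : PhaseSpace m → ℂ →ₗ[ℂ] 𝓓'(halfLine, ℂ)) : Prop :=
  ∀ p ∈ phaseDomain m, ∀ (c : ℂ) (φ : 𝓓(halfLine, ℝ)),
    K p c φ = ∫ t in Ioi (0 : ℝ), k (p, t) * c * φ t

/-- `A` is a smooth function with values in `𝓛(ℂ, E)` that coincides with `K` under the inclusion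
`emb` of `E` into the distributions on `ℝ₊`. -/
def IsSmoothLift (emb : E →ₗ[ℂ] 𝓓'(halfLine, ℂ)) (K : PhaseSpace m → ℂ →ₗ[ℂ] 𝓓'(halfLine, ℂ))
    (A : PhaseSpace m → ℂ →L[ℂ] E) : Prop :=
  ContDiffOn ℝ ∞ A (phaseDomain m) ∧ ∀ p ∈ phaseDomain m, ∀ c, emb (A p c) = K p c

/-- `K ∈ C^∞(ℝ^m × ℝ^m × [0, ∞), 𝓛(ℂ, E))`, where `E` is a normed space included in the
distributions on `ℝ₊` by `emb`. -/
def SmoothInto (emb : E →ₗ[ℂ] 𝓓'(halfLine, ℂ))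
    (K : PhaseSpace m → ℂ →ₗ[ℂ] 𝓓'(halfLine, ℂ)) : Prop :=
  ∃ A, IsSmoothLift emb K A

/-- `K` is a smooth function with values in `𝓛(ℂ, E)` and satisfies the estimates
`‖κ_{lam}⁻¹ ∂_{x'}^β ∂_{ξ'}^α ∂_μ^j K‖_{𝓛(ℂ, E)} ≤ C ⟨ξ'⟩^{ν-|α|} ⟨ξ', μ⟩^{d-ν-j}` for all orders of
derivatives; `e` is the element `κ_{lam}⁻¹ (∂_{x'}^β ∂_{ξ'}^α ∂_μ^j K) c` of `E`. -/
def IsWeakSymbol (emb : E →ₗ[ℂ] 𝓓'(halfLine, ℂ)) (lam : PhaseSpace m → {x : ℝ // 0 < x})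
    (d ν : ℝ) (K : PhaseSpace m → ℂ →ₗ[ℂ] 𝓓'(halfLine, ℂ)) : Prop :=
  ∃ A, IsSmoothLift emb K A ∧ ∀ (β α : Fin m → ℕ) (j : ℕ), ∃ C : ℝ, ∀ p ∈ phaseDomain m, ∀ c : ℂ,
    ∃ e : E, emb e = kappa (lam p)⁻¹
        (emb (paramDeriv LinearMap.id (phaseDomain m) β α j A p c)) ∧
      ‖e‖ ≤ C * ((japXi p : ℝ) ^ (ν - multiAbs α) * (japXiMu p : ℝ) ^ (d - ν - j)) * ‖c‖

end OperatorValued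

end

open FourierTransform Filter Topology
open scoped NNReal

noncomputable section

/-! ### Fourier description of the Sobolev spaces on the line -/

/-! For a function w on the half-line let N(l,l') be the L² norm of t^l ∂^{l'} w (`weightNorm`).
Dilations are unitary on L², so κ_λ⁻¹ multiplies N(l,l') by exactly λ^{l-l'} (`weightNorm_dilate`).
If l' ≤ l, rescaling with λ = ⟨ξ'⟩ turns the weight of the symbol-kernel estimate into ⟨ξ'⟩^{ν-|α|}
⟨ξ',μ⟩^{d-ν-j}; if l ≤ l', rescaling with λ = ⟨ξ',μ⟩ does so. The correction [l-l']₊ of the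
regularity is precisely what makes both computations end in the same weight.

It remains to compare norms on one fixed half-line. For smooth functions the system of all N(l,l')
with l' ≤ l controls, and is controlled by, the norms of all 𝓚^{s,0}(ℝ₊)^ρ
(`exists_weightedConeEmb_represents`, `exists_weightNorm_le_of_represents`): near t = 0 the variable
x = -ln t turns t^j ∂^j into ordinary derivatives, and away from 0 surplus powers of t absorb the
weights. In the same way the N(0,l') describe the spaces H^s(ℝ₊)
(`exists_halfSobolevEmb_represents`, `exists_weightNorm_zero_le_of_represents`). The remaining pairs
0 < l < l' follow from N(l,l') ≤ N(0,l') + N(l',l'), where N(l',l') is dilation invariant and so can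
be moved from the scale ⟨ξ'⟩ to the scale ⟨ξ',μ⟩ (`isWeakPoissonKernel_of_hasDilatedBound`).

Membership in H^s(ℝ₊) is shown by duality instead of an extension operator: (1+∂)^N is solved on
test functions without moving supports to the left, its transpose (1-∂)^N falls on w, and the zero
extension of (1-∂)^N w lies in L² (`exists_sobolevEmb_represents`).

Finally, the operator family has to be tied to a kernel. Point evaluation on H^s(ℝ) is as smooth in
the point as desired for large s, so smoothness into all H^s(ℝ₊) gives a smooth kernel
(`exists_smooth_kernel`), and parameter derivatives of a lift into any of the spaces are represented
by the same derivatives of the kernel (`represents_paramDeriv`). -/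

theorem toTemperedDistributionCLM_L2_apply (f : L2R) (ψ : 𝓢(ℝ, ℂ)) :
    Lp.toTemperedDistributionCLM ℂ volume 2 f ψ = ∫ x, ψ x * f x := by
  simp [Lp.toTemperedDistribution_apply]

/-- Parseval in bilinear form, read off from the compatibility of the Fourier transform on L² with
the one on tempered distributions. -/
theorem integral_schwartz_mul_eq (f : L2R) (ψ : 𝓢(ℝ, ℂ)) :
    ∫ x, ψ x * f x = ∫ ξ, (𝓕⁻ ψ) ξ * (𝓕 f : L2R) ξ := by
  have h := congrArg (fun T : 𝓢'(ℝ, ℂ) => T (𝓕⁻ ψ)) (Lp.fourier_toTemperedDistribution_eq f)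
  simpa [Lp.toTemperedDistribution_apply] using h

theorem sobolevEmb_apply (s : ℝ) (f : L2R) (ψ : 𝓢(ℝ, ℂ)) :
    sobolevEmb s f ψ =
      ∫ ξ, (((1 + ‖ξ‖ ^ 2) ^ (-s / 2) : ℝ) : ℂ) * (𝓕⁻ ψ) ξ * (𝓕 f : L2R) ξ := by
  have : sobolevEmb s f ψ = (Lp.toTemperedDistributionCLM ℂ volume 2 f)
      (𝓕 (SchwartzMap.smulLeftCLM ℂ
        (fun x : ℝ ↦ (((1 + ‖x‖ ^ 2) ^ (-s / 2) : ℝ) : ℂ)) (𝓕⁻ ψ))) := rfl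
  rw [this, toTemperedDistributionCLM_L2_apply, integral_schwartz_mul_eq, fourierInv_fourier_eq]
  congr 1; ext ξ
  rw [SchwartzMap.smulLeftCLM_apply_apply (by fun_prop)]
  simp

/-- Fourier multipliers with a bounded symbol act on `L²`. -/
theorem exists_L2_fourier_eq_mul {b : ℝ → ℂ} (hb : Continuous b) {C : ℝ≥0} (hC : ∀ ξ, ‖b ξ‖ ≤ C)
    (F : L2R) : ∃ f : L2R, ((𝓕 f : L2R) : ℝ → ℂ) =ᵐ[volume] (fun ξ => b ξ * (𝓕 F : L2R) ξ) ∧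
      ‖f‖ₑ ≤ C * ‖F‖ₑ := by
  have hm : MemLp (fun ξ => b ξ * (𝓕 F : L2R) ξ) 2 volume :=
    MemLp.of_le_mul (c := C) (Lp.memLp (𝓕 F : L2R))
      (hb.aestronglyMeasurable.mul (Lp.aestronglyMeasurable _))
      (ae_of_all _ fun ξ => by rw [norm_mul]; gcongr; exact hC ξ)
  refine ⟨𝓕⁻ (hm.toLp _), ?_, ?_⟩
  · rw [fourier_fourierInv_eq]
    exact hm.coeFn_toLp
  · have h1 : ‖(𝓕⁻ (hm.toLp _) : L2R)‖ₑ = ‖hm.toLp _‖ₑ := by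
      rw [← ofReal_norm, ← ofReal_norm, ← Lp.norm_fourier_eq, fourier_fourierInv_eq]
    have h2 : ‖F‖ₑ = ‖(𝓕 F : L2R)‖ₑ := by
      rw [← ofReal_norm, ← ofReal_norm, Lp.norm_fourier_eq]
    rw [h1, h2, Lp.enorm_def, Lp.enorm_def, eLpNorm_congr_ae hm.coeFn_toLp]
    have h3 : ∀ ξ, ‖b ξ * (𝓕 F : L2R) ξ‖₊ ≤ C * ‖(𝓕 F : L2R) ξ‖₊ := fun ξ => by
      rw [nnnorm_mul]; gcongr; exact hC ξ
    refine (eLpNorm_le_nnreal_smul_eLpNorm_of_ae_le_mul (ae_of_all _ h3) 2).trans ?_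
    · rw [ENNReal.smul_def, smul_eq_mul]

/-- The operator `1 + ∂` on Schwartz functions. -/
def oneAddDeriv : 𝓢(ℝ, ℂ) →L[ℂ] 𝓢(ℝ, ℂ) :=
  ContinuousLinearMap.id ℂ _ + SchwartzMap.derivCLM ℂ ℂ

theorem oneAddDeriv_apply (ψ : 𝓢(ℝ, ℂ)) (x : ℝ) : oneAddDeriv ψ x = ψ x + deriv ψ x := rfl

theorem fourierInv_derivCLM_apply (ψ : 𝓢(ℝ, ℂ)) (ξ : ℝ) :
    (𝓕⁻ (SchwartzMap.derivCLM ℂ ℂ ψ)) ξ = -(2 * Real.pi * Complex.I * ξ) * (𝓕⁻ ψ) ξ := by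
  have h : SchwartzMap.derivCLM ℂ ℂ ψ = LineDeriv.lineDerivOp (1 : ℝ) ψ := by
    ext x
    rw [SchwartzMap.derivCLM_apply, SchwartzMap.lineDerivOp_apply_eq_fderiv]
    simp
  rw [h, SchwartzMap.fourierInv_lineDerivOp_eq, smul_apply,
    SchwartzMap.smulLeftCLM_apply_apply (by fun_prop)]
  simp
  ring

theorem fourierInv_oneAddDeriv_apply (ψ : 𝓢(ℝ, ℂ)) (ξ : ℝ) :
    (𝓕⁻ (oneAddDeriv ψ)) ξ = (1 - 2 * Real.pi * Complex.I * ξ) * (𝓕⁻ ψ) ξ := by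
  have : oneAddDeriv ψ = ψ + SchwartzMap.derivCLM ℂ ℂ ψ := rfl
  rw [this, FourierTransform.fourierInv_add, add_apply, fourierInv_derivCLM_apply]
  ring

theorem one_sub_two_pi_I_mul_ne_zero (ξ : ℝ) : (1 - 2 * Real.pi * Complex.I * ξ : ℂ) ≠ 0 := by
  intro h
  simpa using congrArg Complex.re h

/-- The reciprocal is the conjugate 1 + 2πiξ divided by 1 + (2πξ)², and both factors have temperate
growth. This makes division by 1 - 2πiξ an operation on Schwartz functions. -/
theorem hasTemperateGrowth_inv_one_sub :
    (fun ξ : ℝ => (1 - 2 * Real.pi * Complex.I * ξ : ℂ)⁻¹).HasTemperateGrowth := by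
  have h1 : (fun ξ : ℝ => (((1 + ‖(2 * Real.pi) * ξ‖ ^ 2) ^ (-1 : ℝ) : ℝ) : ℂ)).HasTemperateGrowth :=
    (show (fun x : ℝ => (((1 + ‖x‖ ^ 2) ^ (-1 : ℝ) : ℝ) : ℂ)).HasTemperateGrowth by fun_prop).comp
      (show (fun x : ℝ => (2 * Real.pi) * x).HasTemperateGrowth by fun_prop)
  have h2 : (fun ξ : ℝ => (1 + 2 * Real.pi * Complex.I * ξ : ℂ)).HasTemperateGrowth := by fun_prop
  have h3 : (fun ξ : ℝ => (1 - 2 * Real.pi * Complex.I * ξ : ℂ)⁻¹) =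
      fun ξ : ℝ => (((1 + ‖(2 * Real.pi) * ξ‖ ^ 2) ^ (-1 : ℝ) : ℝ) : ℂ) *
        (1 + 2 * Real.pi * Complex.I * ξ : ℂ) := by
    ext ξ
    have h4 : (1 + (2 * Real.pi * ξ) ^ 2 : ℂ) ≠ 0 := by
      have : (0 : ℝ) < 1 + (2 * Real.pi * ξ) ^ 2 := by positivity
      exact_mod_cast this.ne'
    rw [Real.rpow_neg_one, Real.norm_eq_abs, sq_abs]
    push_cast
    rw [inv_eq_iff_eq_inv, mul_inv, inv_inv, eq_mul_inv_iff_mul_eq₀]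
    · ring_nf
      rw [Complex.I_sq]
      ring
    · intro h
      simpa using congrArg Complex.re h
  rw [h3]
  exact h1.mul h2

/-- On the inverse Fourier side 1 + ∂ is multiplication by 1 - 2πiξ, which has no real zero. -/
theorem oneAddDeriv_surjective (φ : 𝓢(ℝ, ℂ)) : ∃ ψ, oneAddDeriv ψ = φ := by
  refine ⟨𝓕 (SchwartzMap.smulLeftCLM ℂ
    (fun ξ : ℝ => (1 - 2 * Real.pi * Complex.I * ξ : ℂ)⁻¹) (𝓕⁻ φ)), ?_⟩
  have h : 𝓕⁻ (oneAddDeriv (𝓕 (SchwartzMap.smulLeftCLM ℂ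
    (fun ξ : ℝ => (1 - 2 * Real.pi * Complex.I * ξ : ℂ)⁻¹) (𝓕⁻ φ)))) = 𝓕⁻ φ := by
    ext ξ
    rw [fourierInv_oneAddDeriv_apply, fourierInv_fourier_eq,
      SchwartzMap.smulLeftCLM_apply_apply hasTemperateGrowth_inv_one_sub, smul_eq_mul,
      mul_inv_cancel_left₀ (one_sub_two_pi_I_mul_ne_zero ξ)]
  have h' := congrArg (fun f : 𝓢(ℝ, ℂ) => (𝓕 f : 𝓢(ℝ, ℂ))) h
  simpa only [fourier_fourierInv_eq] using h'

/-- Since (e^x ψ)' = e^x (ψ + ψ'), the function e^x ψ is constant on (-∞, a), and it tends to 0 at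
-∞ because ψ is bounded. Hence solving (1 + ∂)ψ = φ never enlarges the support to the left, which
keeps ψ inside an upper set; this is the reason for the sign in 1 + ∂. -/
theorem eq_zero_of_oneAddDeriv_eq_zero (ψ : 𝓢(ℝ, ℂ)) (a : ℝ)
    (h : ∀ x < a, oneAddDeriv ψ x = 0) : ∀ x < a, ψ x = 0 := by
  have hd : ∀ x < a, HasDerivAt (fun x : ℝ => (Real.exp x : ℂ) * ψ x) 0 x := by
    intro x hx
    have h1 : HasDerivAt (fun x : ℝ => (Real.exp x : ℂ)) (Real.exp x : ℂ) x :=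
      (Real.hasDerivAt_exp x).ofReal_comp
    refine (h1.mul ψ.differentiableAt.hasDerivAt).congr_deriv ?_
    rw [← mul_add, ← oneAddDeriv_apply, h x hx, mul_zero]
  have hc : ∀ x < a, ∀ y < a, (Real.exp x : ℂ) * ψ x = (Real.exp y : ℂ) * ψ y := by
    intro x hx y hy
    refine (convex_Iio a).is_const_of_fderivWithin_eq_zero (𝕜 := ℝ)
      (fun z hz => (hd z hz).differentiableAt.differentiableWithinAt) (fun z hz => ?_) hx hy
    have := (hd z hz).hasFDerivAt.hasFDerivWithinAt (s := Iio a)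
    rw [this.fderivWithin (isOpen_Iio.uniqueDiffWithinAt hz)]
    ext; simp
  obtain ⟨C, hC⟩ := ψ.decay 0 0
  have hC' : ∀ x, ‖ψ x‖ ≤ C := fun x => by simpa using hC.2 x
  have hl : Tendsto (fun x : ℝ => (Real.exp x : ℂ) * ψ x) atBot (𝓝 0) := by
    refine squeeze_zero_norm (a := fun x => Real.exp x * C) (fun x => ?_) ?_
    · rw [norm_mul, Complex.norm_real, Real.norm_eq_abs, Real.abs_exp]
      gcongr
      exact hC' x
    · simpa using Real.tendsto_exp_atBot.mul_const C
  intro x hx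
  have : Tendsto (fun x : ℝ => (Real.exp x : ℂ) * ψ x) atBot (𝓝 ((Real.exp x : ℂ) * ψ x)) := by
    refine tendsto_const_nhds.congr' ?_
    filter_upwards [Iio_mem_atBot a] with y hy using hc x hx y hy
  have h0 := tendsto_nhds_unique this hl
  have : (Real.exp x : ℂ) ≠ 0 := by exact_mod_cast (Real.exp_pos x).ne'
  simpa [this] using h0

/-- For `φ` supported in `[a, ∞)`, the equation `(1 + ∂)^N ψ = φ` has a Schwartz solution
supported in `[a, ∞)`. -/
theorem exists_iterate_oneAddDeriv_eq (N : ℕ) (φ : 𝓢(ℝ, ℂ)) (a : ℝ) (h : ∀ x < a, φ x = 0) :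
    ∃ ψ : 𝓢(ℝ, ℂ), oneAddDeriv^[N] ψ = φ ∧ ∀ x < a, ψ x = 0 := by
  induction N generalizing φ with
  | zero => exact ⟨φ, rfl, h⟩
  | succ N ih =>
    obtain ⟨ψ₁, h1⟩ := oneAddDeriv_surjective φ
    obtain ⟨ψ, h2, h3⟩ := ih ψ₁ (eq_zero_of_oneAddDeriv_eq_zero ψ₁ a (by rw [h1]; exact h))
    exact ⟨ψ, by rw [Function.iterate_succ_apply', h2, h1], h3⟩

theorem fourierInv_iterate_oneAddDeriv_apply (N : ℕ) (ψ : 𝓢(ℝ, ℂ)) (ξ : ℝ) :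
    (𝓕⁻ (oneAddDeriv^[N] ψ)) ξ = (1 - 2 * Real.pi * Complex.I * ξ) ^ N * (𝓕⁻ ψ) ξ := by
  induction N with
  | zero => simp
  | succ N ih => rw [Function.iterate_succ_apply', fourierInv_oneAddDeriv_apply, ih]; ring

theorem tsupport_oneAddDeriv_subset (ψ : 𝓢(ℝ, ℂ)) : tsupport (oneAddDeriv ψ) ⊆ tsupport ψ := by
  refine closure_minimal (fun x hx => ?_) (isClosed_tsupport _)
  by_contra h
  refine hx ?_
  rw [oneAddDeriv_apply, image_eq_zero_of_notMem_tsupport h,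
    image_eq_zero_of_notMem_tsupport (fun h' => h (tsupport_deriv_subset h')), add_zero]

theorem tsupport_iterate_oneAddDeriv_subset (N : ℕ) (ψ : 𝓢(ℝ, ℂ)) :
    tsupport (oneAddDeriv^[N] ψ) ⊆ tsupport ψ := by
  induction N with
  | zero => rfl
  | succ N ih =>
    rw [Function.iterate_succ_apply']
    exact (tsupport_oneAddDeriv_subset _).trans ih

/-! ### Integration by parts on open subsets of the line -/

/-- The extension of w ψ by zero is differentiable on the whole line because the closed support of ψ
stays inside Ω, so no boundary terms arise whatever w does at the boundary. Integrability replaces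
compactness of the support: the solutions ψ of (1 + ∂)^N ψ = φ are only Schwartz functions. -/
theorem setIntegral_deriv_mul_eq_neg {Ω : Set ℝ} (hΩ : IsOpen Ω) {w ψ : ℝ → ℂ}
    (hw : DifferentiableOn ℝ w Ω) (hψ : Differentiable ℝ ψ) (hs : tsupport ψ ⊆ Ω)
    (h0 : IntegrableOn (fun x => w x * ψ x) Ω) (h1 : IntegrableOn (fun x => deriv w x * ψ x) Ω)
    (h2 : IntegrableOn (fun x => w x * deriv ψ x) Ω) :
    ∫ x in Ω, deriv w x * ψ x = -∫ x in Ω, w x * deriv ψ x := by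
  have hd : ∀ x, HasDerivAt (Ω.indicator fun x => w x * ψ x)
      (Ω.indicator (fun x => deriv w x * ψ x + w x * deriv ψ x) x) x := by
    intro x
    by_cases hx : x ∈ Ω
    · rw [indicator_of_mem hx]
      refine (((hw.differentiableAt (hΩ.mem_nhds hx)).hasDerivAt).mul
        (hψ x).hasDerivAt).congr_of_eventuallyEq ?_
      filter_upwards [hΩ.mem_nhds hx] with y hy using indicator_of_mem hy _
    · rw [indicator_of_notMem hx]
      refine (hasDerivAt_const x (0 : ℂ)).congr_of_eventuallyEq ?_
      have hx' : x ∈ (tsupport ψ)ᶜ := fun h => hx (hs h)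
      filter_upwards [(isClosed_tsupport ψ).isOpen_compl.mem_nhds hx'] with y hy
      by_cases hy' : y ∈ Ω
      · rw [indicator_of_mem hy', image_eq_zero_of_notMem_tsupport hy, mul_zero]
      · rw [indicator_of_notMem hy']
  have := integral_eq_zero_of_hasDerivAt_of_integrable hd
    ((h1.add h2).integrable_indicator hΩ.measurableSet) (h0.integrable_indicator hΩ.measurableSet)
  rw [integral_indicator hΩ.measurableSet, integral_add h1 h2] at this
  exact eq_neg_of_add_eq_zero_left this

theorem schwartz_memLp_restrict (ψ : 𝓢(ℝ, ℂ)) (Ω : Set ℝ) :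
    MemLp ψ 2 (volume.restrict Ω) := (ψ.memLp 2).restrict Ω

theorem contDiffAt_of_contDiffOn_opens {Ω : Opens ℝ} {w : ℝ → ℂ} (hw : ContDiffOn ℝ ∞ w Ω) {x : ℝ}
    (hx : x ∈ Ω) : ContDiffAt ℝ ∞ w x := hw.contDiffAt (Ω.isOpen.mem_nhds hx)

theorem contDiffOn_deriv_opens {Ω : Opens ℝ} {w : ℝ → ℂ} (hw : ContDiffOn ℝ ∞ w Ω) :
    ContDiffOn ℝ ∞ (deriv w) Ω :=
  ((contDiffOn_infty_iff_deriv_of_isOpen Ω.isOpen).1 hw).2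

theorem contDiffOn_iteratedDeriv_opens {Ω : Opens ℝ} {w : ℝ → ℂ} (hw : ContDiffOn ℝ ∞ w Ω) (i : ℕ) :
    ContDiffOn ℝ ∞ (iteratedDeriv i w) Ω := by
  induction i with
  | zero => simpa using hw
  | succ i ih => rw [iteratedDeriv_succ]; exact contDiffOn_deriv_opens ih

theorem aestronglyMeasurable_iteratedDeriv_opens {Ω : Opens ℝ} {w : ℝ → ℂ}
    (hw : ContDiffOn ℝ ∞ w Ω) (i : ℕ) :
    AEStronglyMeasurable (iteratedDeriv i w) (volume.restrict Ω) :=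
  (contDiffOn_iteratedDeriv_opens hw i).continuousOn.aestronglyMeasurable Ω.isOpen.measurableSet

theorem iteratedDeriv_sub_deriv {Ω : Opens ℝ} {w : ℝ → ℂ} (hw : ContDiffOn ℝ ∞ w Ω) (i : ℕ)
    {x : ℝ} (hx : x ∈ Ω) : iteratedDeriv i (fun y => w y - deriv w y) x =
      iteratedDeriv i w x - iteratedDeriv (i + 1) w x := by
  have h : (fun y => w y - deriv w y) = w - deriv w := rfl
  rw [h, iteratedDeriv_sub ((contDiffAt_of_contDiffOn_opens hw hx).of_le (mod_cast le_top))
    ((contDiffAt_of_contDiffOn_opens (contDiffOn_deriv_opens hw) hx).of_le (mod_cast le_top)),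
    iteratedDeriv_succ']

/-- The transpose of 1 + ∂ is 1 - ∂, so `F` is the zero extension of (1 - ∂)^N w; each induction
step replaces w by w - w'. -/
theorem exists_L2_integral_iterate_oneAddDeriv (Ω : Opens ℝ) (N : ℕ) :
    ∃ C : ℝ≥0, ∀ w : ℝ → ℂ, ContDiffOn ℝ ∞ w Ω →
      (∀ i, MemLp (iteratedDeriv i w) 2 (volume.restrict Ω)) →
      ∃ F : L2R, ‖F‖ₑ ≤ C * ∑ i ∈ Finset.range (N + 1),
          eLpNorm (iteratedDeriv i w) 2 (volume.restrict Ω) ∧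
        ∀ ψ : 𝓢(ℝ, ℂ), tsupport ψ ⊆ Ω →
          ∫ x in Ω, w x * (oneAddDeriv^[N] ψ) x = ∫ x, ψ x * F x := by
  induction N with
  | zero =>
    refine ⟨1, fun w hw hL => ?_⟩
    have h0 : MemLp w 2 (volume.restrict Ω) := by simpa using hL 0
    have hi : MemLp ((Ω : Set ℝ).indicator w) 2 volume :=
      (memLp_indicator_iff_restrict Ω.isOpen.measurableSet).2 h0
    refine ⟨hi.toLp _, ?_, fun ψ _ => ?_⟩
    · rw [Lp.enorm_def, eLpNorm_congr_ae hi.coeFn_toLp,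
        eLpNorm_indicator_eq_eLpNorm_restrict Ω.isOpen.measurableSet]
      simp
    · rw [← integral_indicator Ω.isOpen.measurableSet]
      refine integral_congr_ae ?_
      filter_upwards [hi.coeFn_toLp] with x hx
      rw [hx]
      by_cases hxΩ : x ∈ (Ω : Set ℝ) <;> simp [hxΩ, mul_comm]
  | succ N ih =>
    obtain ⟨C, hC⟩ := ih
    -- The i-th derivative of w - w' costs two consecutive derivatives of w, and each of the two
    -- resulting sums is part of the sum up to N + 1.
    refine ⟨2 * C, fun w hw hL => ?_⟩
    have hae : ∀ i, iteratedDeriv i (fun y => w y - deriv w y) =ᵐ[volume.restrict Ω]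
        iteratedDeriv i w - iteratedDeriv (i + 1) w := fun i => by
      filter_upwards [ae_restrict_mem Ω.isOpen.measurableSet] with x hx
      exact iteratedDeriv_sub_deriv hw i hx
    obtain ⟨F, hF1, hF2⟩ := hC (fun y => w y - deriv w y) (hw.sub (contDiffOn_deriv_opens hw))
      fun i => ((hL i).sub (hL (i + 1))).ae_eq (hae i).symm
    refine ⟨F, hF1.trans ?_, fun ψ hψ => ?_⟩
    · have h1 : ∀ i ∈ Finset.range (N + 1),
          eLpNorm (iteratedDeriv i (fun y => w y - deriv w y)) 2 (volume.restrict Ω) ≤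
          eLpNorm (iteratedDeriv i w) 2 (volume.restrict Ω) +
            eLpNorm (iteratedDeriv (i + 1) w) 2 (volume.restrict Ω) := fun i _ => by
        rw [eLpNorm_congr_ae (hae i)]
        exact eLpNorm_sub_le (hL i).1 (hL (i + 1)).1 (by norm_num)
      have h2 := Finset.sum_le_sum h1
      rw [Finset.sum_add_distrib] at h2
      calc _ ≤ (C : ℝ≥0∞) * (∑ i ∈ Finset.range (N + 1 + 1),
              eLpNorm (iteratedDeriv i w) 2 (volume.restrict Ω) +
            ∑ i ∈ Finset.range (N + 1 + 1),
              eLpNorm (iteratedDeriv i w) 2 (volume.restrict Ω)) := by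
            gcongr
            refine h2.trans (add_le_add ?_ ?_)
            · rw [Finset.sum_range_succ _ (N + 1)]; exact le_self_add
            · rw [Finset.sum_range_succ' _ (N + 1)]; exact le_self_add
        _ = _ := by rw [← two_mul]; push_cast; ring
    · rw [← hF2 ψ hψ, Function.iterate_succ_apply']
      set η := oneAddDeriv^[N] ψ
      have hη : tsupport η ⊆ Ω := (tsupport_iterate_oneAddDeriv_subset N ψ).trans hψ
      have m0 : MemLp w 2 (volume.restrict Ω) := by simpa using hL 0
      have m1 : MemLp (deriv w) 2 (volume.restrict Ω) := by simpa using hL 1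
      have n0 := schwartz_memLp_restrict η Ω
      have n1 : MemLp (deriv η) 2 (volume.restrict Ω) :=
        schwartz_memLp_restrict (SchwartzMap.derivCLM ℂ ℂ η) Ω
      have i0 : IntegrableOn (fun x => w x * η x) Ω := m0.integrable_mul n0
      have i1 : IntegrableOn (fun x => deriv w x * η x) Ω := m1.integrable_mul n0
      have i2 : IntegrableOn (fun x => w x * deriv η x) Ω := m0.integrable_mul n1
      have := setIntegral_deriv_mul_eq_neg Ω.isOpen (hw.differentiableOn (by simp))
        η.differentiable hη i0 i1 i2
      simp only [oneAddDeriv_apply, mul_add, sub_mul]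
      rw [integral_add i0 i2, integral_sub i0 i1, this, sub_neg_eq_add]

/-! ### Distributions represented by functions -/

/-- The distribution `T` on `Ω` is given by integration against `w`. -/
def Represents {Ω : Opens ℝ} (T : 𝓓'(Ω, ℂ)) (w : ℝ → ℂ) : Prop :=
  ∀ φ : 𝓓(Ω, ℝ), T φ = ∫ t in (Ω : Set ℝ), w t * φ t

theorem Represents.ext {Ω : Opens ℝ} {T S : 𝓓'(Ω, ℂ)} {w : ℝ → ℂ} (hT : Represents T w)
    (hS : Represents S w) : T = S := DFunLike.ext _ _ fun φ => (hT φ).trans (hS φ).symm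

theorem Represents.congr {Ω : Opens ℝ} {T : 𝓓'(Ω, ℂ)} {w v : ℝ → ℂ} (hT : Represents T w)
    (h : EqOn w v Ω) : Represents T v := fun φ =>
  (hT φ).trans (setIntegral_congr_fun Ω.isOpen.measurableSet fun t ht => by simp only [h ht])

theorem integrableOn_mul_of_tsupport_subset {Ω : Opens ℝ} {w φ : ℝ → ℂ} (hw : ContinuousOn w Ω)
    (hφ : Continuous φ) (hc : HasCompactSupport φ) (hs : tsupport φ ⊆ Ω) :
    IntegrableOn (fun t => w t * φ t) Ω := by
  have h1 : IntegrableOn (fun t => w t * φ t) (tsupport φ) :=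
    ((hw.mono hs).mul hφ.continuousOn).integrableOn_compact hc
  refine h1.of_forall_sdiff_eq_zero Ω.isOpen.measurableSet fun t ht => ?_
  rw [image_eq_zero_of_notMem_tsupport ht.2, mul_zero]

theorem continuous_ofReal_test {Ω : Opens ℝ} (φ : 𝓓(Ω, ℝ)) : Continuous fun t => (φ t : ℂ) :=
  Complex.continuous_ofReal.comp φ.continuous

theorem tsupport_ofReal_test {Ω : Opens ℝ} (φ : 𝓓(Ω, ℝ)) :
    tsupport (fun t => (φ t : ℂ)) = tsupport φ := by
  simp only [tsupport]
  congr 1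
  ext t
  simp

theorem hasCompactSupport_ofReal_test {Ω : Opens ℝ} (φ : 𝓓(Ω, ℝ)) :
    HasCompactSupport fun t => (φ t : ℂ) := by
  rw [HasCompactSupport, tsupport_ofReal_test]
  exact φ.hasCompactSupport

theorem integrableOn_mul_test {Ω : Opens ℝ} {w : ℝ → ℂ} (hw : ContinuousOn w Ω) (φ : 𝓓(Ω, ℝ)) :
    IntegrableOn (fun t => w t * φ t) Ω :=
  integrableOn_mul_of_tsupport_subset hw (continuous_ofReal_test φ)
    (hasCompactSupport_ofReal_test φ) (by rw [tsupport_ofReal_test]; exact φ.tsupport_subset)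

/-- Locally integrable functions are determined by their integrals against test functions. -/
theorem ae_eq_of_integral_test_eq {Ω : Opens ℝ} {w v : ℝ → ℂ} (hw : LocallyIntegrableOn w Ω)
    (hv : LocallyIntegrableOn v Ω)
    (h : ∀ φ : 𝓓(Ω, ℝ), ∫ t in (Ω : Set ℝ), w t * φ t = ∫ t in (Ω : Set ℝ), v t * φ t) :
    w =ᵐ[volume.restrict Ω] v := by
  have key := Ω.isOpen.ae_eq_zero_of_integral_contDiff_smul_eq_zero (μ := volume) (hw.sub hv)
    fun g hg hc hs => by
      have h1 := h ⟨g, hg, hc, hs⟩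
      have hz : ∀ u : ℝ → ℂ, ∀ t ∉ (Ω : Set ℝ), u t * (g t : ℂ) = 0 := fun u t ht => by
        rw [image_eq_zero_of_notMem_tsupport fun h' => ht (hs h'), Complex.ofReal_zero, mul_zero]
      have hi : ∀ u : ℝ → ℂ, LocallyIntegrableOn u Ω → Integrable fun t => u t * (g t : ℂ) := by
        intro u hu
        have h3 : IntegrableOn (fun t => u t * (g t : ℂ)) (tsupport g) :=
          (hu.integrableOn_compact_subset hs hc).mul_continuousOn
            (Complex.continuous_ofReal.comp hg.continuous).continuousOn hc
        refine integrableOn_univ.1 (h3.of_forall_sdiff_eq_zero MeasurableSet.univ fun t ht => ?_)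
        rw [image_eq_zero_of_notMem_tsupport ht.2, Complex.ofReal_zero, mul_zero]
      change ∫ t in (Ω : Set ℝ), w t * (g t : ℂ) = ∫ t in (Ω : Set ℝ), v t * (g t : ℂ) at h1
      rw [setIntegral_eq_integral_of_forall_compl_eq_zero (hz w),
        setIntegral_eq_integral_of_forall_compl_eq_zero (hz v)] at h1
      have h2 : ∀ t, g t • (w - v) t = w t * (g t : ℂ) - v t * (g t : ℂ) := fun t => by
        simp; ring
      simp_rw [h2]
      rw [integral_sub (hi w hw) (hi v hv), h1, sub_self]
  refine (ae_restrict_iff' Ω.isOpen.measurableSet).2 ?_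
  filter_upwards [key] with t ht hm
  exact sub_eq_zero.1 (ht hm)

theorem Represents.eqOn {Ω : Opens ℝ} {T : 𝓓'(Ω, ℂ)} {w v : ℝ → ℂ} (hw : Represents T w)
    (hv : Represents T v) (hwc : ContinuousOn w Ω) (hvc : ContinuousOn v Ω) : EqOn w v Ω := by
  have h := ae_eq_of_integral_test_eq (hwc.locallyIntegrableOn Ω.isOpen.measurableSet)
    (hvc.locallyIntegrableOn Ω.isOpen.measurableSet) fun φ => (hw φ).symm.trans (hv φ)
  exact Measure.eqOn_open_of_ae_eq h Ω.isOpen hwc hvc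

/-- The derivative of a test function. -/
def testDeriv {Ω : Opens ℝ} (φ : 𝓓(Ω, ℝ)) : 𝓓(Ω, ℝ) where
  toFun := deriv φ
  contDiff' := (contDiff_infty_iff_deriv.1 φ.contDiff).2
  hasCompactSupport' := φ.hasCompactSupport.deriv
  tsupport_subset' := (tsupport_deriv_subset).trans φ.tsupport_subset

theorem deriv_ofReal_test {Ω : Opens ℝ} (φ : 𝓓(Ω, ℝ)) (t : ℝ) :
    deriv (fun t => (φ t : ℂ)) t = (testDeriv φ t : ℂ) := by
  have h : DifferentiableAt ℝ φ t := (φ.contDiff.differentiable (by simp)).differentiableAt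
  exact h.hasDerivAt.ofReal_comp.deriv

theorem testToSchwartz_testDeriv {Ω : Opens ℝ} (φ : 𝓓(Ω, ℝ)) :
    testToSchwartz Ω (testDeriv φ) = SchwartzMap.derivCLM ℂ ℂ (testToSchwartz Ω φ) := by
  ext t
  exact (deriv_ofReal_test φ t).symm

theorem setIntegral_iteratedDeriv_mul_test {Ω : Opens ℝ} {w : ℝ → ℂ} (hw : ContDiffOn ℝ ∞ w Ω)
    (i : ℕ) (φ : 𝓓(Ω, ℝ)) : ∫ t in (Ω : Set ℝ), iteratedDeriv i w t * φ t =
      (-1) ^ i * ∫ t in (Ω : Set ℝ), w t * (testDeriv^[i] φ) t := by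
  induction i generalizing φ with
  | zero => simp
  | succ i ih =>
    have hc := contDiffOn_iteratedDeriv_opens hw i
    have h1 := setIntegral_deriv_mul_eq_neg Ω.isOpen (w := iteratedDeriv i w)
      (ψ := fun t => (φ t : ℂ)) (hc.differentiableOn (by simp))
      (fun t => ((φ.contDiff.differentiable (by simp)) t).hasDerivAt.ofReal_comp.differentiableAt)
      (by rw [tsupport_ofReal_test]; exact φ.tsupport_subset)
      (integrableOn_mul_test hc.continuousOn φ)
      (integrableOn_mul_test (contDiffOn_deriv_opens hc).continuousOn φ)
      (by simp_rw [deriv_ofReal_test]; exact integrableOn_mul_test hc.continuousOn _)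
    simp_rw [deriv_ofReal_test] at h1
    rw [iteratedDeriv_succ, h1, ih, Function.iterate_succ_apply]
    ring

theorem fourierInv_iterate_testDeriv {Ω : Opens ℝ} (i : ℕ) (φ : 𝓓(Ω, ℝ)) (ξ : ℝ) :
    (𝓕⁻ (testToSchwartz Ω (testDeriv^[i] φ))) ξ =
      (-(2 * Real.pi * Complex.I * ξ)) ^ i * (𝓕⁻ (testToSchwartz Ω φ)) ξ := by
  induction i with
  | zero => simp
  | succ i ih =>
    rw [Function.iterate_succ_apply', testToSchwartz_testDeriv, fourierInv_derivCLM_apply, ih]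
    ring

/-! ### Sobolev norms and derivatives -/

/-- Ellipticity of 1 + ∂: division by (1 - 2πiξ)^N compensates the growth of ⟨ξ⟩^s when s ≤ N. -/
theorem norm_one_sub_two_pi_I_mul_ge (ξ : ℝ) :
    √(1 + ξ ^ 2) ≤ ‖(1 - 2 * Real.pi * Complex.I * ξ : ℂ)‖ := by
  rw [Complex.norm_def]
  refine Real.sqrt_le_sqrt ?_
  simp [Complex.normSq_apply]
  have : 3 < Real.pi := Real.pi_gt_three
  have h : 1 ≤ (2 * Real.pi) ^ 2 := by nlinarith
  nlinarith [mul_le_mul_of_nonneg_right h (sq_nonneg ξ)]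

theorem rpow_half_natCast (x : ℝ) (hx : 0 ≤ x) (n : ℕ) : x ^ ((n : ℝ) / 2) = √x ^ n := by
  rw [Real.sqrt_eq_rpow, ← Real.rpow_mul_natCast hx]
  ring_nf

/-- A function on an upper set with square integrable derivatives is the restriction of an
element of `H^s(ℝ)`, with control of the norm. -/
theorem exists_sobolevEmb_represents (Ω : Opens ℝ) (hne : (Ω : Set ℝ).Nonempty)
    (hup : IsUpperSet (Ω : Set ℝ)) (s : ℝ) :
    ∃ (N : ℕ) (C : ℝ≥0), ∀ w : ℝ → ℂ, ContDiffOn ℝ ∞ w Ω →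
      (∀ i, MemLp (iteratedDeriv i w) 2 (volume.restrict Ω)) →
      ∃ f : L2R, Represents (restrictTempered Ω (sobolevEmb s f)) w ∧
        ‖f‖ₑ ≤ C * ∑ i ∈ Finset.range (N + 1),
          eLpNorm (iteratedDeriv i w) 2 (volume.restrict Ω) := by
  set N := ⌈s⌉₊
  have hN : s ≤ N := Nat.le_ceil s
  obtain ⟨C, hC⟩ := exists_L2_integral_iterate_oneAddDeriv Ω N
  refine ⟨N, C, fun w hw hL => ?_⟩
  obtain ⟨F, hF1, hF2⟩ := hC w hw hL
  -- The symbol through which `f` is obtained from `F`: ⟨ξ⟩^s is undone by the embedding of H^s, and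
  -- the inverse power cancels the factor that (1 + ∂)^N produces on the Fourier side.
  let b : ℝ → ℂ := fun ξ => (((1 + ‖ξ‖ ^ 2) ^ (s / 2) : ℝ) : ℂ) *
    ((1 - 2 * Real.pi * Complex.I * ξ) ^ N)⁻¹
  have hne0 : ∀ ξ : ℝ, (1 - 2 * Real.pi * Complex.I * ξ : ℂ) ^ N ≠ 0 := fun ξ =>
    pow_ne_zero _ (one_sub_two_pi_I_mul_ne_zero ξ)
  have hb : Continuous b := by
    refine Continuous.mul (Complex.continuous_ofReal.comp ?_) (Continuous.inv₀ (by fun_prop) hne0)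
    exact Continuous.rpow_const (by fun_prop) fun ξ => Or.inl (by positivity)
  have hb1 : ∀ ξ, ‖b ξ‖ ≤ (1 : ℝ≥0) := fun ξ => by
    simp only [b, norm_mul, norm_inv, norm_pow, Complex.norm_real, Real.norm_eq_abs, sq_abs]
    have h1 : 0 < ‖(1 - 2 * Real.pi * Complex.I * ξ : ℂ)‖ ^ N :=
      pow_pos (norm_pos_iff.2 (one_sub_two_pi_I_mul_ne_zero ξ)) _
    rw [mul_inv_le_iff₀ h1, abs_of_nonneg (by positivity)]
    calc (1 + ξ ^ 2) ^ (s / 2) ≤ (1 + ξ ^ 2) ^ ((N : ℝ) / 2) :=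
          Real.rpow_le_rpow_of_exponent_le (by nlinarith [sq_nonneg ξ]) (by linarith)
      _ = √(1 + ξ ^ 2) ^ N := rpow_half_natCast _ (by positivity) N
      _ ≤ _ := by
        have := norm_one_sub_two_pi_I_mul_ge ξ
        simp only [NNReal.coe_one, one_mul]
        gcongr
  obtain ⟨f, hf1, hf2⟩ := exists_L2_fourier_eq_mul hb hb1 F
  refine ⟨f, fun φ => ?_, hf2.trans ?_⟩
  -- The leftmost point of the support of φ lies in Ω, and an upper set contains the whole ray to
  -- the right of it. The solution ψ is supported in that ray, hence is admissible in the
  -- integration by parts.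
  · obtain ⟨a, haΩ, ha⟩ : ∃ a ∈ Ω, ∀ x < a, φ x = 0 := by
      rcases (tsupport φ).eq_empty_or_nonempty with h | h
      · obtain ⟨a, ha⟩ := hne
        exact ⟨a, ha, fun x _ => image_eq_zero_of_notMem_tsupport (by simp [h])⟩
      · obtain ⟨a, ha1, ha2⟩ := φ.hasCompactSupport.exists_isLeast h
        exact ⟨a, φ.tsupport_subset ha1,
          fun x hx => image_eq_zero_of_notMem_tsupport fun h' => (ha2 h').not_gt hx⟩
    obtain ⟨ψ, hψ1, hψ2⟩ := exists_iterate_oneAddDeriv_eq N (testToSchwartz Ω φ) a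
      fun x hx => by rw [testToSchwartz_apply, ha x hx, Complex.ofReal_zero]
    have hψs : tsupport ψ ⊆ Ω := by
      have h1 : tsupport ψ ⊆ Ici a := closure_minimal
        (fun x hx => le_of_not_gt fun h => hx (hψ2 x h)) isClosed_Ici
      exact h1.trans fun x hx => hup hx haΩ
    have h3 : ∫ x in (Ω : Set ℝ), w x * φ x = ∫ x, ψ x * F x := by
      rw [← hF2 ψ hψs, hψ1]; rfl
    rw [h3, integral_schwartz_mul_eq, restrictTempered_apply, sobolevEmb_apply]
    refine integral_congr_ae ?_
    filter_upwards [hf1] with ξ hξ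
    rw [hξ, ← hψ1, fourierInv_iterate_oneAddDeriv_apply]
    have h4 : (((1 + ‖ξ‖ ^ 2) ^ (-s / 2) : ℝ) : ℂ) * (((1 + ‖ξ‖ ^ 2) ^ (s / 2) : ℝ) : ℂ) = 1 := by
      rw [← Complex.ofReal_mul, ← Real.rpow_add (by positivity)]
      ring_nf
      simp
    have h5 := mul_inv_cancel₀ (hne0 ξ)
    simp only [b]
    linear_combination (𝓕⁻ ψ) ξ * (𝓕 F : L2R) ξ * h4 + (((1 + ‖ξ‖ ^ 2) ^ (-s / 2) : ℝ) : ℂ) *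
      (((1 + ‖ξ‖ ^ 2) ^ (s / 2) : ℝ) : ℂ) * (𝓕⁻ ψ) ξ * (𝓕 F : L2R) ξ * h5
  · simpa using hF1

/-- Conversely, the derivatives of order `i ≤ s` of an element of `H^s(ℝ)` that is smooth on `Ω`
are square integrable over `Ω`. -/
theorem eLpNorm_iteratedDeriv_le_of_represents (Ω : Opens ℝ) {i : ℕ} {s : ℝ} (hi : i ≤ s) :
    ∃ C : ℝ≥0, ∀ (f : L2R) (w : ℝ → ℂ), ContDiffOn ℝ ∞ w Ω →
      Represents (restrictTempered Ω (sobolevEmb s f)) w →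
      eLpNorm (iteratedDeriv i w) 2 (volume.restrict Ω) ≤ C * ‖f‖ₑ := by
  -- The symbol of ∂^i ⟨D⟩^{-s}, bounded by (2π)^i because i ≤ s.
  let b : ℝ → ℂ := fun ξ => (((1 + ‖ξ‖ ^ 2) ^ (-s / 2) : ℝ) : ℂ) *
    (2 * Real.pi * Complex.I * ξ) ^ i
  have hb : Continuous b := by
    refine Continuous.mul (Complex.continuous_ofReal.comp ?_) (by fun_prop)
    exact Continuous.rpow_const (by fun_prop) fun ξ => Or.inl (by positivity)
  let C : ℝ≥0 := ⟨(2 * Real.pi) ^ i, by positivity⟩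
  have hb1 : ∀ ξ, ‖b ξ‖ ≤ C := fun ξ => by
    have h0 : |2 * Real.pi| = 2 * Real.pi := abs_of_pos (by positivity)
    have h1 : ‖b ξ‖ = (1 + ξ ^ 2) ^ (-s / 2) * ((2 * Real.pi) ^ i * |ξ| ^ i) := by
      simp only [b, norm_mul, norm_pow, Complex.norm_real, Real.norm_eq_abs, sq_abs,
        Complex.norm_I]
      rw [abs_of_nonneg (by positivity)]
      simp [mul_pow, abs_of_pos Real.pi_pos]
    have h2 : |ξ| ^ i ≤ (1 + ξ ^ 2) ^ (s / 2) :=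
      calc |ξ| ^ i ≤ √(1 + ξ ^ 2) ^ i := by
            gcongr
            exact Real.abs_le_sqrt (by linarith)
        _ = (1 + ξ ^ 2) ^ ((i : ℝ) / 2) := (rpow_half_natCast _ (by positivity) i).symm
        _ ≤ _ := Real.rpow_le_rpow_of_exponent_le (by nlinarith [sq_nonneg ξ]) (by linarith)
    have h3 : (1 + ξ ^ 2) ^ (-s / 2) * (1 + ξ ^ 2) ^ (s / 2) = 1 := by
      rw [← Real.rpow_add (by positivity)]
      ring_nf
      simp
    rw [h1]
    calc _ ≤ (1 + ξ ^ 2) ^ (-s / 2) * ((2 * Real.pi) ^ i * (1 + ξ ^ 2) ^ (s / 2)) := by gcongr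
      _ = (2 * Real.pi) ^ i * ((1 + ξ ^ 2) ^ (-s / 2) * (1 + ξ ^ 2) ^ (s / 2)) := by ring
      _ = C := by rw [h3, mul_one]; rfl
  refine ⟨C, fun f w hw hr => ?_⟩
  obtain ⟨g, hg1, hg2⟩ := exists_L2_fourier_eq_mul hb hb1 f
  -- The classical derivative of w and the L² function with Fourier transform b 𝓕f have the same
  -- integrals against test functions on Ω.
  have hae : iteratedDeriv i w =ᵐ[volume.restrict Ω] g := by
    refine ae_eq_of_integral_test_eq ((contDiffOn_iteratedDeriv_opens hw i).continuousOn
      |>.locallyIntegrableOn Ω.isOpen.measurableSet)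
      (((Lp.memLp g).locallyIntegrable (by norm_num)).locallyIntegrableOn _) fun φ => ?_
    have h1 : ∫ t in (Ω : Set ℝ), g t * φ t = ∫ t, testToSchwartz Ω φ t * g t := by
      rw [setIntegral_eq_integral_of_forall_compl_eq_zero]
      · simp_rw [testToSchwartz_apply, mul_comm]
      · intro t ht
        rw [image_eq_zero_of_notMem_tsupport fun h => ht (φ.tsupport_subset h),
          Complex.ofReal_zero, mul_zero]
    rw [setIntegral_iteratedDeriv_mul_test hw, ← hr, restrictTempered_apply, sobolevEmb_apply, h1,
      integral_schwartz_mul_eq, ← integral_const_mul]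
    refine integral_congr_ae ?_
    filter_upwards [hg1] with ξ hξ
    rw [hξ, fourierInv_iterate_testDeriv]
    have : (-1 : ℂ) ^ i * (-(2 * Real.pi * Complex.I * ξ)) ^ i = (2 * Real.pi * Complex.I * ξ) ^ i := by
      rw [← mul_pow]; ring
    simp only [b]
    linear_combination (((1 + ‖ξ‖ ^ 2) ^ (-s / 2) : ℝ) : ℂ) * (𝓕⁻ (testToSchwartz Ω φ)) ξ *
      (𝓕 f : L2R) ξ * this
  rw [eLpNorm_congr_ae hae]
  refine (eLpNorm_mono_measure _ Measure.restrict_le_self).trans ?_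
  rw [← Lp.enorm_def]
  exact hg2

/-! ### Point evaluation on Sobolev spaces -/

section WeakDerivative

variable {E : Type*} [NormedAddCommGroup E] [NormedSpace ℂ E]

theorem norm_sub_le_of_hasDerivAt_apply {G₀ G₁ : ℝ → E →L[ℂ] ℂ}
    (h : ∀ t e, HasDerivAt (fun τ => G₀ τ e) (G₁ t e) t) {C : ℝ} (hC : ∀ t, ‖G₁ t‖ ≤ C) (a b : ℝ) :
    ‖G₀ b - G₀ a‖ ≤ C * |b - a| := by
  have hC0 : 0 ≤ C := (norm_nonneg _).trans (hC 0)
  refine ContinuousLinearMap.opNorm_le_bound _ (by positivity) fun e => ?_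
  have := convex_univ.norm_image_sub_le_of_norm_hasDerivWithin_le (𝕜 := ℝ)
    (f := fun τ => G₀ τ e) (f' := fun τ => G₁ τ e) (C := C * ‖e‖) (s := univ)
    (fun x _ => (h x e).hasDerivWithinAt)
    (fun x _ => (G₁ x).le_of_opNorm_le (hC x) e) (mem_univ a) (mem_univ b)
  calc _ ≤ C * ‖e‖ * ‖b - a‖ := this
    _ = _ := by rw [Real.norm_eq_abs]; ring

/-- A map into the dual space whose values at vectors have a first and a bounded second derivative
is differentiable in norm. -/
theorem hasDerivAt_of_hasDerivAt_apply {G₀ G₁ G₂ : ℝ → E →L[ℂ] ℂ}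
    (h₀ : ∀ t e, HasDerivAt (fun τ => G₀ τ e) (G₁ t e) t)
    (h₁ : ∀ t e, HasDerivAt (fun τ => G₁ τ e) (G₂ t e) t) {C : ℝ} (hC : ∀ t, ‖G₂ t‖ ≤ C) (t : ℝ) :
    HasDerivAt G₀ (G₁ t) t := by
  have hC0 : 0 ≤ C := (norm_nonneg _).trans (hC 0)
  -- The first-order Taylor remainder is quadratic with a constant proportional to ‖e‖, so the
  -- estimate is uniform on the unit ball and passes to the operator norm.
  have hb : ∀ τ, ‖G₀ τ - G₀ t - (τ - t) • G₁ t‖ ≤ C * |τ - t| ^ 2 := by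
    intro τ
    refine ContinuousLinearMap.opNorm_le_bound _ (by positivity) fun e => ?_
    have hd : ∀ x, HasDerivAt (fun x => G₀ x e - (x - t) • G₁ t e) (G₁ x e - G₁ t e) x := fun x => by
      have := (h₀ x e).sub (((hasDerivAt_id x).sub_const t).smul_const (G₁ t e))
      refine this.congr_deriv ?_
      simp
    have := (convex_uIcc t τ).norm_image_sub_le_of_norm_hasDerivWithin_le (𝕜 := ℝ)
      (C := C * |τ - t| * ‖e‖)
      (fun x _ => (hd x).hasDerivWithinAt)
      (fun x hx => by
        have h2 := norm_sub_le_of_hasDerivAt_apply h₁ hC t x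
        have h3 : |x - t| ≤ |τ - t| := abs_sub_left_of_mem_uIcc hx
        calc ‖G₁ x e - G₁ t e‖ = ‖(G₁ x - G₁ t) e‖ := rfl
          _ ≤ C * |x - t| * ‖e‖ := (G₁ x - G₁ t).le_of_opNorm_le h2 e
          _ ≤ _ := by gcongr)
      left_mem_uIcc right_mem_uIcc
    calc ‖(G₀ τ - G₀ t - (τ - t) • G₁ t) e‖
        = ‖G₀ τ e - (τ - t) • G₁ t e - (G₀ t e - (t - t) • G₁ t e)‖ := by
          congr 1
          simp
          ring
      _ ≤ C * |τ - t| * ‖e‖ * ‖τ - t‖ := this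
      _ = _ := by rw [Real.norm_eq_abs]; ring
  rw [hasDerivAt_iff_isLittleO]
  have h1 : (fun τ => G₀ τ - G₀ t - (τ - t) • G₁ t) =O[𝓝 t] fun τ => |τ - t| ^ 2 :=
    Asymptotics.IsBigO.of_bound C (Eventually.of_forall fun τ => by
      rw [norm_pow, Real.norm_eq_abs, abs_abs]; exact hb τ)
  refine h1.trans_isLittleO ?_
  have h2 : (fun τ : ℝ => |τ - t| ^ 2) = fun τ => (τ - t) * (τ - t) := by
    ext τ; rw [sq_abs, sq]
  rw [h2]
  have h3 : Tendsto (fun τ : ℝ => τ - t) (𝓝 t) (𝓝 0) := by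
    have : ContinuousAt (fun τ : ℝ => τ - t) t := by fun_prop
    simpa [ContinuousAt] using this
  simpa using ((Asymptotics.isLittleO_one_iff ℝ).2 h3).mul_isBigO
    (Asymptotics.isBigO_refl (fun τ : ℝ => τ - t) (𝓝 t))

end WeakDerivative

/-! ### Evaluation functionals with L² symbols. -/

theorem eLpNorm_mul_fourier_le {m : ℝ → ℂ} (hm : MemLp m 2) (f : L2R) :
    eLpNorm (fun ξ => m ξ * (𝓕 f : L2R) ξ) 1 volume ≤ eLpNorm m 2 volume * ‖f‖ₑ := by
  have h2 : ‖f‖ₑ = ‖(𝓕 f : L2R)‖ₑ := by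
    rw [← ofReal_norm, ← ofReal_norm, Lp.norm_fourier_eq]
  rw [h2, Lp.enorm_def]
  have h3 := eLpNorm_smul_le_mul_eLpNorm (p := 2) (q := 2) (r := 1) (φ := m)
    (Lp.aestronglyMeasurable (𝓕 f : L2R)) hm.1
  exact h3

theorem integrable_mul_fourier {m : ℝ → ℂ} (hm : MemLp m 2) (f : L2R) :
    Integrable (fun ξ => m ξ * (𝓕 f : L2R) ξ) :=
  hm.integrable_mul (Lp.memLp (𝓕 f : L2R))

theorem integrable_fourierChar_smul {h : ℝ → ℂ} (hh : Integrable h) (t : ℝ) :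
    Integrable fun v : ℝ => Real.fourierChar (inner ℝ v t) • h v := by
  have := (Real.fourierIntegral_convergent_iff (μ := volume) (f := h) (-t)).2 hh
  simpa only [inner_neg_right, neg_neg] using this

theorem norm_fourierInv_mul_fourier_le {m : ℝ → ℂ} (hm : MemLp m 2) (f : L2R) (t : ℝ) :
    ‖𝓕⁻ (fun ξ => m ξ * (𝓕 f : L2R) ξ) t‖ ≤ (eLpNorm m 2 volume).toReal * ‖f‖ := by
  rw [Real.fourierInv_eq]
  refine (norm_integral_le_integral_norm _).trans ?_
  simp only [Circle.norm_smul]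
  rw [integral_norm_eq_lintegral_enorm (integrable_mul_fourier hm f).1, ← eLpNorm_one_eq_lintegral_enorm]
  refine (ENNReal.toReal_mono (ENNReal.mul_ne_top hm.2.ne enorm_ne_top)
    (eLpNorm_mul_fourier_le hm f)).trans ?_
  rw [ENNReal.toReal_mul, toReal_enorm]

open Classical in
/-- The functional `f ↦ 𝓕⁻¹(m · 𝓕 f)(t)` on `L²`, for `m ∈ L²`. -/
def fourierEval (m : ℝ → ℂ) (t : ℝ) : L2R →L[ℂ] ℂ :=
  if hm : MemLp m 2 then
    LinearMap.mkContinuous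
      { toFun := fun f => 𝓕⁻ (fun ξ => m ξ * (𝓕 f : L2R) ξ) t
        map_add' := fun f g => by
          simp only [Real.fourierInv_eq]
          rw [← integral_add (integrable_fourierChar_smul (integrable_mul_fourier hm f) t)
            (integrable_fourierChar_smul (integrable_mul_fourier hm g) t)]
          refine integral_congr_ae ?_
          rw [FourierTransform.fourier_add]
          filter_upwards [Lp.coeFn_add (𝓕 f : L2R) (𝓕 g)] with ξ hξ
          rw [hξ, Pi.add_apply, mul_add, smul_add]
        map_smul' := fun c f => by
          simp only [Real.fourierInv_eq, RingHom.id_apply]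
          rw [← integral_smul, FourierTransform.fourier_smul]
          refine integral_congr_ae ?_
          filter_upwards [Lp.coeFn_smul c (𝓕 f : L2R)] with ξ hξ
          rw [hξ, Pi.smul_apply, smul_comm c, smul_eq_mul, smul_eq_mul, mul_left_comm] }
      (eLpNorm m 2 volume).toReal (fun f => norm_fourierInv_mul_fourier_le hm f t)
  else 0

theorem fourierEval_apply {m : ℝ → ℂ} (hm : MemLp m 2) (t : ℝ) (f : L2R) :
    fourierEval m t f = 𝓕⁻ (fun ξ => m ξ * (𝓕 f : L2R) ξ) t := by
  rw [fourierEval, dif_pos hm]; rfl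

theorem norm_fourierEval_le {m : ℝ → ℂ} (hm : MemLp m 2) (t : ℝ) :
    ‖fourierEval m t‖ ≤ (eLpNorm m 2 volume).toReal := by
  rw [fourierEval, dif_pos hm]
  exact LinearMap.mkContinuous_norm_le _ ENNReal.toReal_nonneg _

/-- Differentiation under the Fourier integral; the two L² hypotheses make the integrand and its
multiple by ξ integrable by Hölder's inequality. -/
theorem hasDerivAt_fourierEval_apply {m : ℝ → ℂ} (hm : MemLp m 2)
    (hm' : MemLp (fun ξ => (2 * Real.pi * Complex.I * ξ) * m ξ) 2) (f : L2R) (t : ℝ) :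
    HasDerivAt (fun τ => fourierEval m τ f)
      (fourierEval (fun ξ => (2 * Real.pi * Complex.I * ξ) * m ξ) t f) t := by
  simp_rw [fourierEval_apply hm, fourierEval_apply hm', Real.fourierInv_eq_fourier_neg]
  have hi := integrable_mul_fourier hm f
  have hi' : Integrable (fun ξ : ℝ => ξ • (m ξ * (𝓕 f : L2R) ξ)) := by
    have h1 := (integrable_mul_fourier hm' f).const_mul (2 * Real.pi * Complex.I)⁻¹
    refine h1.congr (ae_of_all _ fun ξ => ?_)
    have : (2 * Real.pi * Complex.I : ℂ) ≠ 0 := by simp [Real.pi_ne_zero]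
    simp only [Complex.real_smul]
    field_simp
  have h := (Real.hasDerivAt_fourier hi hi' (-t)).scomp t (hasDerivAt_neg t)
  refine h.congr_deriv ?_
  rw [neg_one_smul, Real.fourier_eq, Real.fourier_eq, ← integral_neg]
  congr 1; ext ξ
  rw [← smul_neg]
  congr 1
  simp only [smul_eq_mul]
  ring

/-- The symbol `(2πiξ)^b ⟨ξ⟩^{-s}`. -/
def evalSymbol (s : ℝ) (b : ℕ) (ξ : ℝ) : ℂ :=
  (2 * Real.pi * Complex.I * ξ) ^ b * (((1 + ‖ξ‖ ^ 2) ^ (-s / 2) : ℝ) : ℂ)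

theorem evalSymbol_succ (s : ℝ) (b : ℕ) :
    (fun ξ : ℝ => (2 * Real.pi * Complex.I * ξ) * evalSymbol s b ξ) = evalSymbol s (b + 1) := by
  ext ξ; simp only [evalSymbol]; ring

/-- The symbol is bounded by (2π)^b ⟨ξ⟩^{b-s} ≤ (2π)^b ⟨ξ⟩^{-1}, and ⟨ξ⟩^{-1} is square integrable
on the line. -/
theorem memLp_evalSymbol {s : ℝ} {b : ℕ} (h : b + 1 ≤ s) : MemLp (evalSymbol s b) 2 := by
  have hc : Continuous (evalSymbol s b) := by
    refine Continuous.mul (by fun_prop) (Complex.continuous_ofReal.comp ?_)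
    exact Continuous.rpow_const (by fun_prop) fun ξ => Or.inl (by positivity)
  have h1 : MemLp (fun ξ : ℝ => (√(1 + ξ ^ 2))⁻¹) 2 := by
    rw [memLp_two_iff_integrable_sq]
    · refine integrable_inv_one_add_sq.congr (ae_of_all _ fun ξ => ?_)
      simp only
      rw [inv_pow, Real.sq_sqrt (by positivity)]
    · refine Continuous.aestronglyMeasurable (Continuous.inv₀ (by fun_prop) fun ξ => ?_)
      positivity
  refine h1.of_le_mul (c := (2 * Real.pi) ^ b) hc.aestronglyMeasurable (ae_of_all _ fun ξ => ?_)
  have e1 : ‖evalSymbol s b ξ‖ = (2 * Real.pi) ^ b * |ξ| ^ b * (1 + ξ ^ 2) ^ (-s / 2) := by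
    simp only [evalSymbol, norm_mul, norm_pow, Complex.norm_real, Real.norm_eq_abs, sq_abs,
      Complex.norm_I]
    rw [abs_of_nonneg (by positivity : (0 : ℝ) ≤ (1 + ξ ^ 2) ^ (-s / 2))]
    simp [mul_pow, abs_of_pos Real.pi_pos]
  have e2 : (1 + ξ ^ 2) ^ (-s / 2) ≤ (√(1 + ξ ^ 2) ^ (b + 1))⁻¹ := by
    rw [← rpow_half_natCast _ (by positivity), ← Real.rpow_neg (by positivity)]
    exact Real.rpow_le_rpow_of_exponent_le (by nlinarith [sq_nonneg ξ]) (by push_cast; linarith)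
  have e3 : |ξ| ^ b ≤ √(1 + ξ ^ 2) ^ b := by
    gcongr
    exact Real.abs_le_sqrt (by linarith)
  have e4 : 0 < √(1 + ξ ^ 2) := by positivity
  rw [e1, Real.norm_eq_abs, abs_of_pos (inv_pos.2 e4), mul_assoc]
  gcongr
  calc _ ≤ √(1 + ξ ^ 2) ^ b * (√(1 + ξ ^ 2) ^ (b + 1))⁻¹ := by gcongr
    _ = _ := by rw [pow_succ _ b, mul_inv, mul_inv_cancel_left₀ (pow_ne_zero _ e4.ne')]

/-- Differentiability in norm uses a bounded second derivative, so the symbols of orders b, b + 1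
and b + 2 must all lie in L²; this accounts for b + 3 ≤ s. -/
theorem hasDerivAt_fourierEval {s : ℝ} {b : ℕ} (h : b + 3 ≤ s) (t : ℝ) :
    HasDerivAt (fourierEval (evalSymbol s b)) (fourierEval (evalSymbol s (b + 1)) t) t := by
  have h0 : MemLp (evalSymbol s b) 2 := memLp_evalSymbol (by linarith)
  have h1 : MemLp (evalSymbol s (b + 1)) 2 := memLp_evalSymbol (by push_cast; linarith)
  have h2 : MemLp (evalSymbol s (b + 2)) 2 := memLp_evalSymbol (by push_cast; linarith)
  refine hasDerivAt_of_hasDerivAt_apply (G₂ := fourierEval (evalSymbol s (b + 2)))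
    (fun t e => ?_) (fun t e => ?_) (norm_fourierEval_le h2) t
  · have := hasDerivAt_fourierEval_apply h0 (by rw [evalSymbol_succ]; exact h1) e t
    rwa [evalSymbol_succ] at this
  · have := hasDerivAt_fourierEval_apply h1 (by rw [evalSymbol_succ]; exact h2) e t
    rwa [evalSymbol_succ] at this

theorem contDiff_fourierEval (n : ℕ) {s : ℝ} {b : ℕ} (h : b + n + 3 ≤ s) :
    ContDiff ℝ n (fourierEval (evalSymbol s b)) := by
  induction n generalizing b with
  | zero =>
    have : Differentiable ℝ (fourierEval (evalSymbol s b)) := fun t =>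
      (hasDerivAt_fourierEval (by push_cast at h; linarith) t).differentiableAt
    exact contDiff_zero.2 this.continuous
  | succ n ih =>
    have hd : ∀ t, HasDerivAt (fourierEval (evalSymbol s b)) (fourierEval (evalSymbol s (b + 1)) t) t :=
      hasDerivAt_fourierEval (by
        push_cast at h; have : (0 : ℝ) ≤ n := n.cast_nonneg
        linarith)
    have : ContDiff ℝ (n + 1) (fourierEval (evalSymbol s b)) := by
      rw [contDiff_succ_iff_deriv]
      refine ⟨fun t => (hd t).differentiableAt, by simp, ?_⟩
      have h1 : deriv (fourierEval (evalSymbol s b)) = fourierEval (evalSymbol s (b + 1)) :=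
        funext fun t => (hd t).deriv
      rw [h1]
      exact ih (by push_cast at h ⊢; linarith)
    exact_mod_cast this

/-- Elements of `H^s(ℝ)`, `s ≥ 1`, are represented by their point evaluations. -/
theorem represents_fourierEval (Ω : Opens ℝ) {s : ℝ} (hs : 1 ≤ s) (f : L2R) :
    Represents (restrictTempered Ω (sobolevEmb s f)) fun t => fourierEval (evalSymbol s 0) t f := by
  intro φ
  have hm : MemLp (evalSymbol s 0) 2 := memLp_evalSymbol (by simpa using hs)
  set h : ℝ → ℂ := fun ξ => evalSymbol s 0 ξ * (𝓕 f : L2R) ξ with hh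
  have hi : Integrable h := integrable_mul_fourier hm f
  have e1 : ∫ t in (Ω : Set ℝ), fourierEval (evalSymbol s 0) t f * φ t =
      ∫ t, fourierEval (evalSymbol s 0) t f * φ t := by
    rw [setIntegral_eq_integral_of_forall_compl_eq_zero]
    intro t ht
    rw [image_eq_zero_of_notMem_tsupport fun h => ht (φ.tsupport_subset h),
      Complex.ofReal_zero, mul_zero]
  rw [e1, restrictTempered_apply, sobolevEmb_apply]
  simp_rw [fourierEval_apply hm, ← hh]
  set ψ := testToSchwartz Ω φ with hψ
  -- The Fourier integral is symmetric for the bilinear pairing. Since the inverse transform occurs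
  -- here, the test function enters reflected.
  have hflip := VectorFourier.integral_fourierIntegral_smul_eq_flip (L := innerₗ ℝ)
    Real.continuous_fourierChar continuous_inner hi (ψ.integrable.comp_neg (μ := volume))
  have e2 : ∫ t, 𝓕⁻ h t * φ t = ∫ t, 𝓕 h t • ψ (-t) := by
    rw [← integral_neg_eq_self]
    congr 1; ext t
    rw [Real.fourierInv_eq_fourier_neg, neg_neg, smul_eq_mul, hψ, testToSchwartz_apply]
  have e3 : (fun ξ => 𝓕 (fun t => ψ (-t)) ξ) = 𝓕⁻ ψ := by
    rw [SchwartzMap.fourierInv_coe, Real.fourierInv_eq_fourier_comp_neg]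
  rw [e2]
  refine Eq.trans ?_ hflip.symm
  congr 1; ext ξ
  have e4 : (𝓕⁻ ψ) ξ = 𝓕 (fun t => ψ (-t)) ξ := (congrFun e3 ξ).symm
  rw [e4, hh]
  simp only [evalSymbol, pow_zero, one_mul, smul_eq_mul]
  have e5 : VectorFourier.fourierIntegral Real.fourierChar volume (innerₗ ℝ).flip
      (fun t => ψ (-t)) ξ = 𝓕 (fun t => ψ (-t)) ξ := by
    rw [flip_innerₗ]; rfl
  rw [e5]
  ring

/-! ### A linear section of the quotient map onto `H^s(ℝ₊)` -/

/-- The lift of an element of `H^s(ℝ₊)` to the orthogonal complement of `vanishing s`. -/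
def halfSection (s : ℝ) : HalfSobolev s →L[ℂ] L2R :=
  LinearMap.mkContinuous
    ((vanishing s).liftQ ((vanishing s)ᗮ.starProjection : L2R →L[ℂ] L2R).toLinearMap
      fun f hf => by
        rw [LinearMap.mem_ker]
        exact (Submodule.starProjection_apply_eq_zero_iff _).2
          ((vanishing s).le_orthogonal_orthogonal hf)) 1
    (fun e => by
      rw [one_mul]
      -- The quotient norm is an infimum over representatives: one is chosen within ε of it, and the
      -- projection does not increase its norm.
      refine le_of_forall_pos_le_add fun ε hε => ?_
      obtain ⟨f, rfl, hf⟩ := Submodule.Quotient.norm_mk_lt e hε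
      exact ((vanishing s)ᗮ.norm_starProjection_apply_le f).trans hf.le)

/-- Projecting onto the orthogonal complement changes a representative only by an element of the
closed space `vanishing s`, which restricts to zero. As the choice is linear and continuous, smooth
families in the quotient have smooth families of representatives, to which point evaluation applies.
-/
theorem halfSobolevEmb_eq (s : ℝ) (e : HalfSobolev s) :
    halfSobolevEmb s e = restrictTempered halfLine (sobolevEmb s (halfSection s e)) := by
  have : CompleteSpace (vanishing s) := (isClosed_vanishing s).completeSpace_coe
  obtain ⟨f, rfl⟩ := Submodule.Quotient.mk_surjective _ e
  have h1 : halfSection s (Submodule.Quotient.mk f) = (vanishing s)ᗮ.starProjection f := rfl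
  have h2 : f - (vanishing s)ᗮ.starProjection f ∈ vanishing s := by
    rw [Submodule.starProjection_orthogonal_val, sub_sub_cancel]
    exact Submodule.starProjection_apply_mem _ _
  have h3 : restrictTempered halfLine (sobolevEmb s (f - (vanishing s)ᗮ.starProjection f)) = 0 := h2
  rw [map_sub, map_sub, sub_eq_zero] at h3
  rw [h1, ← h3]
  rfl

/-! ### Iterated directional derivatives -/

section DirectionalDerivatives

variable {V F G : Type*} [NormedAddCommGroup V] [NormedSpace ℝ V]
  [NormedAddCommGroup F] [NormedSpace ℝ F] [NormedAddCommGroup G] [NormedSpace ℝ G]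

/-- The iterated derivative in the directions of a list. -/
def dirDerivs (S : Set V) (L : List V) (f : V → F) : V → F := L.foldr (dirDeriv S) f

theorem dirDerivs_cons (S : Set V) (v : V) (L : List V) (f : V → F) :
    dirDerivs S (v :: L) f = dirDeriv S v (dirDerivs S L f) := rfl

theorem dirDerivs_append (S : Set V) (L M : List V) (f : V → F) :
    dirDerivs S (L ++ M) f = dirDerivs S L (dirDerivs S M f) := List.foldr_append ..

theorem dirDerivs_replicate (S : Set V) (n : ℕ) (v : V) (f : V → F) :
    dirDerivs S (List.replicate n v) f = (dirDeriv S v)^[n] f := by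
  induction n with
  | zero => rfl
  | succ n ih => rw [List.replicate_succ, dirDerivs_cons, ih, Function.iterate_succ_apply']

theorem dirDerivs_flatMap_replicate (S : Set V) {m : ℕ} (e : Fin m → V) (α : Fin m → ℕ)
    (I : List (Fin m)) (f : V → F) :
    dirDerivs S (I.flatMap fun i => List.replicate (α i) (e i)) f =
      I.foldr (fun i g => (dirDeriv S (e i))^[α i] g) f := by
  induction I with
  | nil => rfl
  | cons i I ih => rw [List.flatMap_cons, dirDerivs_append, ih, dirDerivs_replicate]; rfl

/-- The directions in which `paramDeriv` differentiates. -/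
def paramDirs {m : ℕ} (β α : Fin m → ℕ) (j : ℕ) : List (PhaseSpace m) :=
  ((List.finRange m).flatMap fun i =>
      List.replicate (β i) ((EuclideanSpace.single i 1, 0, 0) : PhaseSpace m)) ++
    (((List.finRange m).flatMap fun i =>
      List.replicate (α i) ((0, EuclideanSpace.single i 1, 0) : PhaseSpace m)) ++
    List.replicate j ((0, 0, 1) : PhaseSpace m))

/-- Written as a single list of directions, mixed derivatives obey chain and commutation rules by
induction on the list. -/
theorem paramDeriv_eq_dirDerivs {m : ℕ} (incl : PhaseSpace m →ₗ[ℝ] V) (S : Set V)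
    (β α : Fin m → ℕ) (j : ℕ) (f : V → F) :
    paramDeriv incl S β α j f = dirDerivs S ((paramDirs β α j).map incl) f := by
  simp only [paramDirs, List.map_append, List.map_flatMap, List.map_replicate]
  rw [dirDerivs_append, dirDerivs_append, dirDerivs_replicate, dirDerivs_flatMap_replicate,
    dirDerivs_flatMap_replicate]
  rfl

theorem dirDeriv_congr {S : Set V} {f g : V → F} (h : EqOn f g S) (v : V) :
    EqOn (dirDeriv S v f) (dirDeriv S v g) S := fun p hp => by
  simp only [dirDeriv]
  rw [fderivWithin_congr h (h hp)]

theorem dirDerivs_congr {S : Set V} {f g : V → F} (h : EqOn f g S) (L : List V) :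
    EqOn (dirDerivs S L f) (dirDerivs S L g) S := by
  induction L with
  | nil => exact h
  | cons v L ih => exact dirDeriv_congr ih v

theorem contDiffOn_dirDeriv {S : Set V} (hS : UniqueDiffOn ℝ S) {f : V → F}
    (hf : ContDiffOn ℝ ∞ f S) (v : V) : ContDiffOn ℝ ∞ (dirDeriv S v f) S :=
  (hf.fderivWithin hS (m := ∞) (by simp)).clm_apply contDiffOn_const

theorem contDiffOn_dirDerivs {S : Set V} (hS : UniqueDiffOn ℝ S) {f : V → F}
    (hf : ContDiffOn ℝ ∞ f S) (L : List V) : ContDiffOn ℝ ∞ (dirDerivs S L f) S := by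
  induction L with
  | nil => exact hf
  | cons v L ih => exact contDiffOn_dirDeriv hS ih v

theorem dirDeriv_clm_comp {S : Set V} (hS : UniqueDiffOn ℝ S) {f : V → F}
    (hf : DifferentiableOn ℝ f S) (ℓ : F →L[ℝ] G) (v : V) :
    EqOn (dirDeriv S v fun p => ℓ (f p)) (fun p => ℓ (dirDeriv S v f p)) S := fun p hp => by
  have := ℓ.hasFDerivAt.comp_hasFDerivWithinAt p (hf p hp).hasFDerivWithinAt
  have h2 : fderivWithin ℝ (fun p => ℓ (f p)) S p = ℓ.comp (fderivWithin ℝ f S p) :=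
    this.fderivWithin (hS p hp)
  simp only [dirDeriv, h2, ContinuousLinearMap.comp_apply]

theorem dirDerivs_clm_comp {S : Set V} (hS : UniqueDiffOn ℝ S) {f : V → F}
    (hf : ContDiffOn ℝ ∞ f S) (ℓ : F →L[ℝ] G) (L : List V) :
    EqOn (dirDerivs S L fun p => ℓ (f p)) (fun p => ℓ (dirDerivs S L f p)) S := by
  induction L with
  | nil => exact fun p _ => rfl
  | cons v L ih =>
    exact (dirDeriv_congr ih v).trans (dirDeriv_clm_comp hS
      ((contDiffOn_dirDerivs hS hf L).differentiableOn (by simp)) ℓ v)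

/-- The domain has the boundary μ = 0, so symmetry of the second derivative within S is obtained
from its being a limit of interior points. -/
theorem dirDeriv_comm {S : Set V} (hS : UniqueDiffOn ℝ S) (hS' : S ⊆ closure (interior S))
    {f : V → F} (hf : ContDiffOn ℝ ∞ f S) (v w : V) :
    EqOn (dirDeriv S v (dirDeriv S w f)) (dirDeriv S w (dirDeriv S v f)) S := fun p hp => by
  have hd : DifferentiableWithinAt ℝ (fderivWithin ℝ f S) S p :=
    (hf.fderivWithin hS (m := ∞) (by simp)).differentiableOn (by simp) p hp
  have key : ∀ u u' : V, dirDeriv S u (dirDeriv S u' f) p =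
      fderivWithin ℝ (fderivWithin ℝ f S) S p u u' := fun u u' => by
    have h1 : HasFDerivWithinAt (fun q => fderivWithin ℝ f S q u')
        ((ContinuousLinearMap.apply ℝ F u').comp (fderivWithin ℝ (fderivWithin ℝ f S) S p)) S p :=
      (ContinuousLinearMap.apply ℝ F u').hasFDerivAt.comp_hasFDerivWithinAt p hd.hasFDerivWithinAt
    have h2 : fderivWithin ℝ (dirDeriv S u' f) S p = _ := h1.fderivWithin (hS p hp)
    simp only [dirDeriv] at h2 ⊢
    rw [h2]
    rfl
  rw [key, key]
  exact (hf p hp).isSymmSndFDerivWithinAt (by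
    rw [minSmoothness_of_isRCLikeNormedField]; exact WithTop.coe_le_coe.2 le_top) hS (hS' hp) hp v w

theorem dirDerivs_dirDeriv_comm {S : Set V} (hS : UniqueDiffOn ℝ S)
    (hS' : S ⊆ closure (interior S)) {f : V → F} (hf : ContDiffOn ℝ ∞ f S) (L : List V) (w : V) :
    EqOn (dirDerivs S L (dirDeriv S w f)) (dirDeriv S w (dirDerivs S L f)) S := by
  induction L with
  | nil => exact fun p _ => rfl
  | cons v L ih =>
    exact (dirDeriv_congr ih v).trans (dirDeriv_comm hS hS' (contDiffOn_dirDerivs hS hf L) v w)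

theorem contDiffOn_iterate_dirDeriv {S : Set V} (hS : UniqueDiffOn ℝ S) {f : V → F}
    (hf : ContDiffOn ℝ ∞ f S) (w : V) (n : ℕ) : ContDiffOn ℝ ∞ ((dirDeriv S w)^[n] f) S := by
  rw [← dirDerivs_replicate]
  exact contDiffOn_dirDerivs hS hf _

theorem dirDerivs_iterate_dirDeriv_comm {S : Set V} (hS : UniqueDiffOn ℝ S)
    (hS' : S ⊆ closure (interior S)) {f : V → F} (hf : ContDiffOn ℝ ∞ f S) (L : List V) (w : V)
    (n : ℕ) :
    EqOn (dirDerivs S L ((dirDeriv S w)^[n] f)) ((dirDeriv S w)^[n] (dirDerivs S L f)) S := by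
  induction n with
  | zero => exact fun p _ => rfl
  | succ n ih =>
    simp only [Function.iterate_succ_apply']
    exact (dirDerivs_dirDeriv_comm hS hS' (contDiffOn_iterate_dirDeriv hS hf w n) L w).trans
      (dirDeriv_congr ih w)

theorem dirDeriv_inl_slice {S : Set V} (hS : UniqueDiffOn ℝ S) {T : Set ℝ} {k : V × ℝ → F}
    (hk : DifferentiableOn ℝ k (S ×ˢ T)) (v : V) {t : ℝ} (ht : t ∈ T) :
    EqOn (fun p => dirDeriv (S ×ˢ T) (v, 0) k (p, t)) (dirDeriv S v fun p => k (p, t)) S := by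
  intro p hp
  have h0 : HasFDerivWithinAt (fun q : V => (q, t)) (ContinuousLinearMap.inl ℝ V ℝ) S p :=
    (hasFDerivAt_prodMk_left p t).hasFDerivWithinAt
  have hm : MapsTo (fun q : V => (q, t)) S (S ×ˢ T) := fun q hq => ⟨hq, ht⟩
  have h1 := (hk (p, t) ⟨hp, ht⟩).hasFDerivWithinAt.comp p h0 hm
  have h2 : fderivWithin ℝ (fun p => k (p, t)) S p = _ := h1.fderivWithin (hS p hp)
  simp only [dirDeriv, h2]
  rfl

theorem dirDerivs_inl_slice {S : Set V} (hS : UniqueDiffOn ℝ S) {T : Set ℝ} (hT : IsOpen T)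
    {k : V × ℝ → F} (hk : ContDiffOn ℝ ∞ k (S ×ˢ T)) (L : List V) {t : ℝ} (ht : t ∈ T) :
    EqOn (fun p => dirDerivs (S ×ˢ T) (L.map (LinearMap.inl ℝ V ℝ)) k (p, t))
      (dirDerivs S L fun p => k (p, t)) S := by
  induction L with
  | nil => exact fun p _ => rfl
  | cons v L ih =>
    have hST := hS.prod hT.uniqueDiffOn
    exact (dirDeriv_inl_slice hS ((contDiffOn_dirDerivs hST hk _).differentiableOn (by simp))
      v ht).trans (dirDeriv_congr ih v)

theorem dirDeriv_inr_slice {S : Set V} {T : Set ℝ} (hT : IsOpen T)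
    {k : V × ℝ → F} (hk : DifferentiableOn ℝ k (S ×ˢ T)) {p : V} (hp : p ∈ S) :
    EqOn (fun t => dirDeriv (S ×ˢ T) (0, 1) k (p, t)) (deriv fun t => k (p, t)) T := by
  intro t ht
  have h0 : HasFDerivWithinAt (fun τ : ℝ => (p, τ)) (ContinuousLinearMap.inr ℝ V ℝ) T t :=
    (hasFDerivAt_prodMk_right p t).hasFDerivWithinAt
  have hm : MapsTo (fun τ : ℝ => (p, τ)) T (S ×ˢ T) := fun τ hτ => ⟨hp, hτ⟩
  have h1 := ((hk (p, t) ⟨hp, ht⟩).hasFDerivWithinAt.comp t h0 hm).hasFDerivAt (hT.mem_nhds ht)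
  have h2 : HasDerivAt (fun t => k (p, t)) _ t := h1.hasDerivAt
  rw [h2.deriv]
  rfl

theorem iterate_dirDeriv_inr_slice {S : Set V} (hS : UniqueDiffOn ℝ S) {T : Set ℝ} (hT : IsOpen T)
    {k : V × ℝ → F} (hk : ContDiffOn ℝ ∞ k (S ×ˢ T)) {p : V} (hp : p ∈ S) (n : ℕ) :
    EqOn (fun t => (dirDeriv (S ×ˢ T) (0, 1))^[n] k (p, t)) (iteratedDeriv n fun t => k (p, t)) T := by
  induction n with
  | zero => exact fun t _ => by simp
  | succ n ih =>
    have hST := hS.prod hT.uniqueDiffOn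
    intro t ht
    simp only [Function.iterate_succ_apply', iteratedDeriv_succ]
    refine (dirDeriv_inr_slice hT
      ((contDiffOn_iterate_dirDeriv hST hk (0, 1) n).differentiableOn (by simp)) hp ht).trans ?_
    exact (ih.eventuallyEq_of_mem (hT.mem_nhds ht)).deriv_eq

end DirectionalDerivatives

/-! ### The parameter domain and the kernel domain. -/

theorem phaseDomain_eq (m : ℕ) : phaseDomain m = univ ×ˢ univ ×ˢ Ici 0 := by
  ext p; simp [phaseDomain]

theorem uniqueDiffOn_phaseDomain (m : ℕ) : UniqueDiffOn ℝ (phaseDomain m) := by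
  rw [phaseDomain_eq]
  exact uniqueDiffOn_univ.prod (uniqueDiffOn_univ.prod (uniqueDiffOn_Ici 0))

theorem uniqueDiffOn_kernelDomain (m : ℕ) : UniqueDiffOn ℝ (kernelDomain m) :=
  (uniqueDiffOn_phaseDomain m).prod isOpen_Ioi.uniqueDiffOn

theorem kernelDomain_subset_closure_interior (m : ℕ) :
    kernelDomain m ⊆ closure (interior (kernelDomain m)) := by
  rw [kernelDomain, phaseDomain_eq]
  simp only [interior_prod_eq, closure_prod_eq, interior_univ, closure_univ, interior_Ici,
    interior_Ioi, closure_Ioi]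
  exact prod_mono subset_rfl Ioi_subset_Ici_self

/-! ### Kernels and their lifts to function spaces -/

section Kernels

variable {m : ℕ}

/-- `∂_{x'}^β ∂_{ξ'}^α ∂_μ^j k (p, t)`, as a function of `t`. -/
def kernelDeriv (β α : Fin m → ℕ) (j : ℕ) (k : PhaseSpace m × ℝ → ℂ) (p : PhaseSpace m) (t : ℝ) :
    ℂ :=
  paramDeriv (LinearMap.inl ℝ (PhaseSpace m) ℝ) (kernelDomain m) β α j k (p, t)

theorem contDiffOn_kernelDeriv {k : PhaseSpace m × ℝ → ℂ} (hk : ContDiffOn ℝ ∞ k (kernelDomain m))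
    (β α : Fin m → ℕ) (j : ℕ) {p : PhaseSpace m} (hp : p ∈ phaseDomain m) :
    ContDiffOn ℝ ∞ (kernelDeriv β α j k p) (Ioi 0) := by
  have h1 := contDiffOn_dirDerivs (uniqueDiffOn_kernelDomain m) hk
    ((paramDirs β α j).map (LinearMap.inl ℝ (PhaseSpace m) ℝ))
  rw [← paramDeriv_eq_dirDerivs] at h1
  exact h1.comp (contDiffOn_const.prodMk contDiffOn_id) fun t ht => ⟨hp, ht⟩

/-- For frozen t the factor t^l is constant for the parameter derivatives, and these commute with
∂_t. Thus the kernel estimates concern one function of t for each parameter and each choice of β, α,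
j. -/
theorem paramDeriv_pow_mul_iterate {k : PhaseSpace m × ℝ → ℂ}
    (hk : ContDiffOn ℝ ∞ k (kernelDomain m)) (β α : Fin m → ℕ) (j l l' : ℕ) {p : PhaseSpace m}
    (hp : p ∈ phaseDomain m) {t : ℝ} (ht : 0 < t) :
    paramDeriv (LinearMap.inl ℝ (PhaseSpace m) ℝ) (kernelDomain m) β α j
        (fun q => (q.2 : ℂ) ^ l * (dirDeriv (kernelDomain m) (0, 1))^[l'] k q) (p, t) =
      (t : ℂ) ^ l * iteratedDeriv l' (kernelDeriv β α j k p) t := by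
  have hS := uniqueDiffOn_phaseDomain m
  have hU := uniqueDiffOn_kernelDomain m
  have h1 := contDiffOn_iterate_dirDeriv hU hk (0, 1) l'
  have h2 : ContDiffOn ℝ ∞ (fun q : PhaseSpace m × ℝ =>
      (q.2 : ℂ) ^ l * (dirDeriv (kernelDomain m) (0, 1))^[l'] k q) (kernelDomain m) :=
    ((Complex.ofRealCLM.contDiff.comp contDiff_snd).pow l).contDiffOn.mul h1
  have h3 : ContDiffOn ℝ ∞ (fun p => (dirDeriv (kernelDomain m) (0, 1))^[l'] k (p, t))
      (phaseDomain m) :=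
    h1.comp (contDiffOn_id.prodMk contDiffOn_const) fun q hq => ⟨hq, ht⟩
  have e4 := dirDerivs_clm_comp hS h3
    (ContinuousLinearMap.mul ℝ ℂ ((t : ℂ) ^ l)) (paramDirs β α j) hp
  have e1 := dirDerivs_inl_slice hS isOpen_Ioi h2 (paramDirs β α j) ht hp
  have e2 := dirDerivs_inl_slice hS isOpen_Ioi h1 (paramDirs β α j) ht hp
  have e3 := dirDerivs_iterate_dirDeriv_comm hU (kernelDomain_subset_closure_interior m) hk
    ((paramDirs β α j).map (LinearMap.inl ℝ (PhaseSpace m) ℝ)) (0, 1) l'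
    (show (p, t) ∈ kernelDomain m from ⟨hp, ht⟩)
  have e5 := iterate_dirDeriv_inr_slice hS isOpen_Ioi (contDiffOn_dirDerivs hU hk
    ((paramDirs β α j).map (LinearMap.inl ℝ (PhaseSpace m) ℝ))) hp l' ht
  rw [paramDeriv_eq_dirDerivs]
  refine e1.trans (e4.trans ?_)
  refine congrArg (fun z => (t : ℂ) ^ l * z) (e2.symm.trans (e3.trans (e5.trans ?_)))
  have e6 : kernelDeriv β α j k p = fun τ => dirDerivs (kernelDomain m)
      ((paramDirs β α j).map (LinearMap.inl ℝ (PhaseSpace m) ℝ)) k (p, τ) := by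
    ext τ
    rw [kernelDeriv, paramDeriv_eq_dirDerivs]
  rw [e6]

/-- For frozen t the kernel is a fixed continuous functional applied to `B`, so parameter
derivatives pass to `B`. -/
theorem kernelDeriv_fourierEval {k : PhaseSpace m × ℝ → ℂ} (hk : ContDiffOn ℝ ∞ k (kernelDomain m))
    {s : ℝ} {B : PhaseSpace m → L2R} (hB : ContDiffOn ℝ ∞ B (phaseDomain m))
    (h : ∀ p ∈ phaseDomain m, ∀ t > 0, k (p, t) = fourierEval (evalSymbol s 0) t (B p))
    (β α : Fin m → ℕ) (j : ℕ) {p : PhaseSpace m} (hp : p ∈ phaseDomain m) {t : ℝ} (ht : 0 < t) :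
    kernelDeriv β α j k p t = fourierEval (evalSymbol s 0) t
      (paramDeriv LinearMap.id (phaseDomain m) β α j B p) := by
  have hS := uniqueDiffOn_phaseDomain m
  have e1 := dirDerivs_inl_slice hS isOpen_Ioi hk (paramDirs β α j) ht hp
  have e2 := dirDerivs_congr (fun p hp => h p hp t ht : EqOn (fun p => k (p, t)) _ _)
    (paramDirs β α j) hp
  have e3 := dirDerivs_clm_comp hS hB
    ((fourierEval (evalSymbol s 0) t).restrictScalars ℝ) (paramDirs β α j) hp
  simp only [kernelDeriv, paramDeriv_eq_dirDerivs]
  rw [LinearMap.id_coe, List.map_id]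
  exact e1.trans (e2.trans e3)

variable {E : Type*} [NormedAddCommGroup E] [NormedSpace ℂ E]

/-- The right-hand side involves neither `E` nor `A`: derivatives of lifts into different spaces are
the same distribution. Continuity of the embedding after pairing with each test function is all that
differentiation requires. -/
theorem emb_paramDeriv_apply {emb : E →ₗ[ℂ] 𝓓'(halfLine, ℂ)}
    (hemb : ∀ φ : 𝓓(halfLine, ℝ), Continuous fun e => emb e φ)
    {K : PhaseSpace m → ℂ →ₗ[ℂ] 𝓓'(halfLine, ℂ)} {A : PhaseSpace m → ℂ →L[ℂ] E}
    (hA : IsSmoothLift emb K A) (β α : Fin m → ℕ) (j : ℕ) {p : PhaseSpace m}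
    (hp : p ∈ phaseDomain m) (c : ℂ) (φ : 𝓓(halfLine, ℝ)) :
    emb (paramDeriv LinearMap.id (phaseDomain m) β α j A p c) φ =
      paramDeriv LinearMap.id (phaseDomain m) β α j (fun q => K q c φ) p := by
  let ℓ : E →L[ℂ] ℂ :=
    { toFun := fun e => emb e φ
      map_add' := fun e e' => by rw [map_add]; rfl
      map_smul' := fun a e => by rw [map_smul]; rfl
      cont := hemb φ }
  let ℓ' : (ℂ →L[ℂ] E) →L[ℝ] ℂ :=
    (ℓ.comp (ContinuousLinearMap.apply ℂ E c)).restrictScalars ℝ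
  have e1 := dirDerivs_clm_comp (uniqueDiffOn_phaseDomain m) hA.1 ℓ' (paramDirs β α j) hp
  have e2 := dirDerivs_congr (fun q hq => by
    change emb (A q c) φ = K q c φ
    rw [hA.2 q hq] : EqOn (fun q => ℓ' (A q)) (fun q => K q c φ) (phaseDomain m))
    (paramDirs β α j) hp
  rw [paramDeriv_eq_dirDerivs, paramDeriv_eq_dirDerivs, LinearMap.id_coe, List.map_id]
  exact e1.symm.trans e2

theorem continuous_halfSobolevEmb_apply (s : ℝ) (φ : 𝓓(halfLine, ℝ)) :
    Continuous fun e => halfSobolevEmb s e φ := by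
  simp_rw [halfSobolevEmb_eq, restrictTempered_apply]
  exact (continuous_eval_const (testToSchwartz halfLine φ)).comp
    ((sobolevEmb s).continuous.comp (halfSection s).continuous)

theorem paramDeriv_clm_comp_apply {G : Type*} [NormedAddCommGroup G] [NormedSpace ℂ G]
    {A : PhaseSpace m → ℂ →L[ℂ] E} (hA : ContDiffOn ℝ ∞ A (phaseDomain m)) (ℓ : E →L[ℂ] G)
    (β α : Fin m → ℕ) (j : ℕ) {p : PhaseSpace m} (hp : p ∈ phaseDomain m) (c : ℂ) :
    paramDeriv LinearMap.id (phaseDomain m) β α j (fun q => ℓ (A q c)) p =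
      ℓ (paramDeriv LinearMap.id (phaseDomain m) β α j A p c) := by
  rw [paramDeriv_eq_dirDerivs, paramDeriv_eq_dirDerivs, LinearMap.id_coe, List.map_id]
  exact dirDerivs_clm_comp (uniqueDiffOn_phaseDomain m) hA
    ((ℓ.comp (ContinuousLinearMap.apply ℂ _ c)).restrictScalars ℝ) (paramDirs β α j) hp

theorem contDiffOn_clm_comp_apply {G : Type*} [NormedAddCommGroup G] [NormedSpace ℂ G]
    {A : PhaseSpace m → ℂ →L[ℂ] E} (hA : ContDiffOn ℝ ∞ A (phaseDomain m)) (ℓ : E →L[ℂ] G)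
    (c : ℂ) : ContDiffOn ℝ ∞ (fun q => ℓ (A q c)) (phaseDomain m) :=
  ((ℓ.comp (ContinuousLinearMap.apply ℂ E c)).restrictScalars ℝ).contDiff.comp_contDiffOn hA

theorem clm_apply_eq_smul (T : ℂ →L[ℂ] E) (c : ℂ) : T c = c • T 1 := by
  rw [← map_smul, smul_eq_mul, mul_one]

theorem kernel_eq_fourierEval {k : PhaseSpace m × ℝ → ℂ} (hk : ContDiffOn ℝ ∞ k (kernelDomain m))
    {K : PhaseSpace m → ℂ →ₗ[ℂ] 𝓓'(halfLine, ℂ)} (hkK : IsKernelOf k K) {s : ℝ} (hs : 3 ≤ s)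
    {A : PhaseSpace m → ℂ →L[ℂ] HalfSobolev s} (hA : IsSmoothLift (halfSobolevEmb s) K A)
    {p : PhaseSpace m} (hp : p ∈ phaseDomain m) {t : ℝ} (ht : 0 < t) :
    k (p, t) = fourierEval (evalSymbol s 0) t (halfSection s (A p 1)) := by
  have h1 : Represents (K p 1) fun t => k (p, t) := fun φ => by
    rw [hkK p hp]; simp only [mul_one]; rfl
  have h2 : Represents (K p 1) fun t => fourierEval (evalSymbol s 0) t (halfSection s (A p 1)) := by
    rw [← hA.2 p hp, halfSobolevEmb_eq]
    exact represents_fourierEval halfLine (by linarith) _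
  refine h1.eqOn h2 ?_ ?_ ht
  · exact (hk.comp (contDiffOn_const.prodMk contDiffOn_id) fun t ht => ⟨hp, ht⟩).continuousOn
  · have : Continuous (fourierEval (evalSymbol s 0)) :=
      (contDiff_fourierEval 0 (by simpa using hs)).continuous
    exact (this.clm_apply continuous_const).continuousOn

/-- Derivatives of a lift of `K` are represented by the derivatives of its kernel. -/
theorem represents_paramDeriv {k : PhaseSpace m × ℝ → ℂ} (hk : ContDiffOn ℝ ∞ k (kernelDomain m))
    {K : PhaseSpace m → ℂ →ₗ[ℂ] 𝓓'(halfLine, ℂ)} (hkK : IsKernelOf k K)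
    (hH : SmoothInto (halfSobolevEmb 3) K) {emb : E →ₗ[ℂ] 𝓓'(halfLine, ℂ)}
    (hemb : ∀ φ : 𝓓(halfLine, ℝ), Continuous fun e => emb e φ)
    {A : PhaseSpace m → ℂ →L[ℂ] E} (hA : IsSmoothLift emb K A) (β α : Fin m → ℕ) (j : ℕ)
    {p : PhaseSpace m} (hp : p ∈ phaseDomain m) (c : ℂ) :
    Represents (emb (paramDeriv LinearMap.id (phaseDomain m) β α j A p c))
      fun t => c * kernelDeriv β α j k p t := by
  obtain ⟨A', hA'⟩ := hH
  intro φ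
  -- Passage from the lift `A` to the lift into H^3(ℝ₊), where point evaluation depends continuously
  -- in norm on the point.
  rw [emb_paramDeriv_apply hemb hA β α j hp c φ,
    ← emb_paramDeriv_apply (continuous_halfSobolevEmb_apply 3) hA' β α j hp c φ, halfSobolevEmb_eq,
    represents_fourierEval halfLine (by norm_num : (1 : ℝ) ≤ 3) _ φ]
  refine setIntegral_congr_fun halfLine.isOpen.measurableSet fun t ht => ?_
  have h1 := kernelDeriv_fourierEval hk (contDiffOn_clm_comp_apply hA'.1 (halfSection 3) 1)
    (fun p hp t ht => kernel_eq_fourierEval hk hkK le_rfl hA' hp ht) β α j hp ht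
  have h2 := h1.trans (congrArg (fourierEval (evalSymbol 3 0) t)
    (paramDeriv_clm_comp_apply hA'.1 (halfSection 3) β α j hp 1))
  simp only [h2]
  rw [clm_apply_eq_smul _ c, map_smul, map_smul, smul_eq_mul]

/-- An operator family that is smooth with values in all spaces `H^s(ℝ₊)` has a smooth kernel. -/
theorem exists_smooth_kernel {K : PhaseSpace m → ℂ →ₗ[ℂ] 𝓓'(halfLine, ℂ)}
    (hH : ∀ s : ℝ, SmoothInto (halfSobolevEmb s) K) :
    ∃ k : PhaseSpace m × ℝ → ℂ, ContDiffOn ℝ ∞ k (kernelDomain m) ∧ IsKernelOf k K := by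
  choose A hA using hH
  let k : ℝ → PhaseSpace m × ℝ → ℂ := fun s q =>
    fourierEval (evalSymbol s 0) q.2 (halfSection s (A s q.1 1))
  have hr : ∀ s ≥ (3 : ℝ), ∀ p ∈ phaseDomain m, Represents (K p 1) fun t => k s (p, t) := by
    intro s hs p hp
    rw [← (hA s).2 p hp, halfSobolevEmb_eq]
    exact represents_fourierEval halfLine (by linarith) _
  have hc : ∀ s ≥ (3 : ℝ), ∀ p, Continuous fun t => k s (p, t) := fun s hs p => by
    have h0 : Continuous (fourierEval (evalSymbol s 0)) :=
      (contDiff_fourierEval 0 (by simpa using hs)).continuous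
    exact h0.clm_apply (continuous_const (y := halfSection s (A s p 1)))
  -- The kernels built from different orders s are continuous densities of the same distribution,
  -- hence equal pointwise; one kernel therefore inherits the regularity available for every s.
  have heq : ∀ s ≥ (3 : ℝ), EqOn (k 3) (k s) (kernelDomain m) := fun s hs q hq =>
    (hr 3 le_rfl q.1 hq.1).eqOn (hr s hs q.1 hq.1) (hc 3 le_rfl _).continuousOn
      (hc s hs _).continuousOn hq.2
  refine ⟨k 3, contDiffOn_infty.2 fun n => ?_, fun p hp c φ => ?_⟩
  · have hs : (3 : ℝ) ≤ n + 3 := by have : (0 : ℝ) ≤ n := n.cast_nonneg; linarith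
    -- In H^{n+3} point evaluation is n times continuously differentiable in the point.
    refine ContDiffOn.congr ?_ (heq (n + 3) hs)
    have h1 : ContDiff ℝ n (fourierEval (evalSymbol (n + 3) 0)) :=
      contDiff_fourierEval n (by simp)
    have h2 : ContDiffOn ℝ n (fun q : PhaseSpace m × ℝ => halfSection (n + 3) (A (n + 3) q.1 1))
        (kernelDomain m) :=
      ((contDiffOn_clm_comp_apply (hA (n + 3)).1 (halfSection (n + 3)) 1).of_le (mod_cast le_top)).comp contDiffOn_fst
        fun q hq => hq.1
    exact ((ContinuousLinearMap.restrictScalarsL ℂ L2R ℂ ℝ ℝ).contDiff.comp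
      (h1.comp contDiff_snd)).contDiffOn.clm_apply h2
  · have h1 : K p c = c • K p 1 := by rw [← map_smul, smul_eq_mul, mul_one]
    rw [h1]
    change c * K p 1 φ = _
    rw [hr 3 le_rfl p hp φ, ← integral_const_mul]
    refine setIntegral_congr_fun halfLine.isOpen.measurableSet fun t ht => ?_
    simp only
    ring

end Kernels

/-! ### Operations on represented distributions -/

theorem Represents.add {Ω : Opens ℝ} {T S : 𝓓'(Ω, ℂ)} {w v : ℝ → ℂ} (hT : Represents T w)
    (hS : Represents S v) (hw : ContinuousOn w Ω) (hv : ContinuousOn v Ω) :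
    Represents (T + S) fun t => w t + v t := fun φ => by
  change T φ + S φ = _
  rw [hT φ, hS φ, ← integral_add (integrableOn_mul_test hw φ) (integrableOn_mul_test hv φ)]
  simp only [add_mul]

theorem Represents.mulDist {T : 𝓓'(halfLine, ℂ)} {w : ℝ → ℂ} (hT : Represents T w) {g : ℝ → ℝ}
    (hg : ContDiffOn ℝ ∞ g (Ioi 0)) : Represents (mulDist g hg T) fun t => (g t : ℂ) * w t := by
  intro φ
  rw [_root_.mulDist, WeightedMap.distMap_apply, hT]
  refine setIntegral_congr_fun halfLine.isOpen.measurableSet fun t ht => ?_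
  simp only [WeightedMap.testMap_apply, indicator_of_mem ht, id]
  push_cast
  ring

theorem test_eq_zero_of_notMem {Ω : Opens ℝ} (φ : 𝓓(Ω, ℝ)) {t : ℝ} (ht : t ∉ (Ω : Set ℝ)) :
    φ t = 0 := image_eq_zero_of_notMem_tsupport fun h => ht (φ.tsupport_subset h)

theorem mulDist_mulDist_of_mul_eq_one {g h : ℝ → ℝ} (hg : ContDiffOn ℝ ∞ g (Ioi 0))
    (hh : ContDiffOn ℝ ∞ h (Ioi 0)) (hgh : ∀ t > 0, g t * h t = 1) (T : 𝓓'(halfLine, ℂ)) :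
    mulDist h hh (mulDist g hg T) = T := by
  refine DFunLike.ext _ _ fun φ => ?_
  rw [mulDist, mulDist, WeightedMap.distMap_apply, WeightedMap.distMap_apply]
  refine congrArg T (TestFunction.ext fun t => ?_)
  simp only [WeightedMap.testMap_apply]
  by_cases ht : t ∈ (halfLine : Set ℝ)
  · simp only [indicator_of_mem ht, id]
    rw [← mul_assoc, hgh t ht, one_mul]
  · rw [indicator_of_notMem ht, test_eq_zero_of_notMem φ ht]

/-- A distribution is recovered from its two cut-off pieces, so the pair that represents an element
of the cone space determines its underlying distribution. -/
theorem mulDist_add_mulDist_one_sub {g : ℝ → ℝ} (hg : ContDiffOn ℝ ∞ g (Ioi 0))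
    (hg' : ContDiffOn ℝ ∞ (fun t => 1 - g t) (Ioi 0)) (T : 𝓓'(halfLine, ℂ)) :
    mulDist g hg T + mulDist (fun t => 1 - g t) hg' T = T := by
  refine DFunLike.ext _ _ fun φ => ?_
  change mulDist g hg T φ + mulDist (fun t => 1 - g t) hg' T φ = T φ
  rw [mulDist, mulDist, WeightedMap.distMap_apply, WeightedMap.distMap_apply, ← map_add]
  refine congrArg T (TestFunction.ext fun t => ?_)
  change (WeightedMap.testMap _ φ t : ℝ) + (WeightedMap.testMap _ φ t : ℝ) = φ t
  simp only [WeightedMap.testMap_apply]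
  by_cases ht : t ∈ (halfLine : Set ℝ)
  · simp only [indicator_of_mem ht, id]
    ring
  · rw [indicator_of_notMem ht, indicator_of_notMem ht, test_eq_zero_of_notMem φ ht, add_zero]

theorem continuous_mulDist_apply {E : Type*} [TopologicalSpace E] {F : E → 𝓓'(halfLine, ℂ)}
    (hF : ∀ φ : 𝓓(halfLine, ℝ), Continuous fun e => F e φ) {g : ℝ → ℝ}
    (hg : ContDiffOn ℝ ∞ g (Ioi 0)) (φ : 𝓓(halfLine, ℝ)) :
    Continuous fun e => mulDist g hg (F e) φ := hF _

theorem continuous_mellinSobolevEmb_apply (s γ : ℝ) (φ : 𝓓(halfLine, ℝ)) :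
    Continuous fun f => mellinSobolevEmb s γ f φ :=
  (continuous_eval_const (testToSchwartz ⊤ _)).comp (sobolevEmb s).continuous

theorem continuous_weightedConeEmb_apply {χ : ℝ → ℝ} (hχ : IsCutoff χ) (s γ ρ : ℝ)
    (φ : 𝓓(halfLine, ℝ)) : Continuous fun e => weightedConeEmb hχ s γ ρ e φ := by
  refine continuous_mulDist_apply (fun φ => ?_) _ φ
  change Continuous fun e : coneSubmodule hχ s γ =>
    mellinSobolevEmb s γ e.1.fst φ + halfSobolevEmb s e.1.snd φ
  refine ((continuous_mellinSobolevEmb_apply s γ φ).comp ?_).add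
    ((continuous_halfSobolevEmb_apply s φ).comp ?_)
  · exact (WithLp.prod_continuous_ofLp 1 _ _).fst.comp continuous_subtype_val
  · exact (WithLp.prod_continuous_ofLp 1 _ _).snd.comp continuous_subtype_val

theorem smoothInto_halfSobolevEmb {m : ℕ} {K : PhaseSpace m → ℂ →ₗ[ℂ] 𝓓'(halfLine, ℂ)} {s : ℝ}
    (h : SmoothInto (weightedSobolevEmb s 0) K) : SmoothInto (halfSobolevEmb s) K := by
  obtain ⟨A, hA1, hA2⟩ := h
  refine ⟨A, hA1, fun p hp c => ?_⟩
  rw [← hA2 p hp c, weightedSobolevEmb]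
  have hb : ∀ t : ℝ, bracketPow (-0) t = 1 := fun t => by simp [bracketPow]
  refine DFunLike.ext _ _ fun φ => ?_
  change _ = mulDist (bracketPow (-0)) (contDiffOn_bracketPow (-0)) (halfSobolevEmb s (A p c)) φ
  rw [mulDist, WeightedMap.distMap_apply]
  refine congrArg _ (TestFunction.ext fun t => ?_)
  simp only [WeightedMap.testMap_apply]
  by_cases ht : t ∈ (halfLine : Set ℝ)
  · simp only [indicator_of_mem ht, id, hb, one_mul]
  · rw [indicator_of_notMem ht, test_eq_zero_of_notMem φ ht]

/-! ### Changes of variables -/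

/-- The dilation `c^{1/2} w(c t)`. -/
def dilate (c : ℝ) (w : ℝ → ℂ) (t : ℝ) : ℂ := (c ^ (1 / 2 : ℝ) : ℝ) * w (c * t)

theorem Represents.kappa {T : 𝓓'(halfLine, ℂ)} {w : ℝ → ℂ} (hT : Represents T w)
    (c : {x : ℝ // 0 < x}) : Represents (kappa c T) (dilate c w) := by
  intro φ
  have hc := c.2
  rw [_root_.kappa, WeightedMap.distMap_apply, hT]
  let G : ℝ → ℂ := fun t => w t * (((c : ℝ) ^ (-(1 / 2) : ℝ) : ℝ) * (φ (t / c) : ℂ))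
  -- The Jacobian c of t ↦ c t turns the factor c^{-1/2} on test functions into c^{1/2} on
  -- densities.
  have h1 : ∀ t : ℝ, dilate c w t * φ t = ((c : ℝ) : ℂ) * G (c * t) := by
    intro t
    have h2 : ((c : ℝ) ^ (1 / 2 : ℝ)) = c * (c : ℝ) ^ (-(1 / 2) : ℝ) := by
      nth_rewrite 2 [← Real.rpow_one (c : ℝ)]
      rw [← Real.rpow_add hc]
      norm_num
    simp only [dilate, G]
    rw [mul_div_cancel_left₀ t hc.ne', h2]
    push_cast
    ring
  simp_rw [h1]
  rw [integral_const_mul]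
  change _ = _ * ∫ t in Ioi 0, G (c * t)
  rw [integral_comp_mul_left_Ioi G 0 hc, mul_zero, Complex.real_smul, ← mul_assoc,
    ← Complex.ofReal_mul, mul_inv_cancel₀ hc.ne', Complex.ofReal_one, one_mul]
  refine setIntegral_congr_fun halfLine.isOpen.measurableSet fun t ht => ?_
  simp only [WeightedMap.testMap_apply, indicator_of_mem ht, G]
  push_cast
  ring

/-- The square root of the Jacobian makes an injective substitution an L² isometry; it is applied to
dilations and to t = e^{-x}. -/
theorem eLpNorm_two_comp_eq {s : Set ℝ} (hs : MeasurableSet s) {f f' : ℝ → ℝ}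
    (hf : ∀ x ∈ s, HasDerivWithinAt f (f' x) s x) (hinj : InjOn f s) (h : ℝ → ℂ) :
    eLpNorm (fun x => (√|f' x| : ℂ) * h (f x)) 2 (volume.restrict s) =
      eLpNorm h 2 (volume.restrict (f '' s)) := by
  rw [eLpNorm_eq_lintegral_rpow_enorm_toReal (by norm_num) (by norm_num),
    eLpNorm_eq_lintegral_rpow_enorm_toReal (by norm_num) (by norm_num),
    lintegral_image_eq_lintegral_abs_deriv_mul hs hf hinj]
  congr 1
  refine lintegral_congr fun x => ?_
  rw [enorm_mul, ENNReal.mul_rpow_of_nonneg _ _ (by norm_num)]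
  congr 1
  rw [← ofReal_norm, Complex.norm_real, Real.norm_eq_abs, abs_of_nonneg (Real.sqrt_nonneg _),
    ENNReal.ofReal_rpow_of_nonneg (Real.sqrt_nonneg _) (by norm_num)]
  congr 1
  simp [Real.sq_sqrt]

theorem iteratedDeriv_comp_mul_left (n : ℕ) (c : ℝ) (f : ℝ → ℂ) :
    iteratedDeriv n (fun x => f (c * x)) = fun x => (c : ℂ) ^ n * iteratedDeriv n f (c * x) := by
  induction n with
  | zero => simp
  | succ n ih =>
    rw [iteratedDeriv_succ, ih]
    ext x
    rw [deriv_const_mul_field, deriv_comp_mul_left, iteratedDeriv_succ, Complex.real_smul]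
    ring

theorem iteratedDeriv_dilate (n : ℕ) (c : ℝ) (w : ℝ → ℂ) (t : ℝ) :
    iteratedDeriv n (dilate c w) t =
      (c ^ (1 / 2 : ℝ) : ℝ) * ((c : ℂ) ^ n * iteratedDeriv n w (c * t)) := by
  have : dilate c w = fun t => ((c ^ (1 / 2 : ℝ) : ℝ) : ℂ) * (fun x => w (c * x)) t := rfl
  rw [this, iteratedDeriv_const_mul_field, iteratedDeriv_comp_mul_left]

theorem contDiffOn_dilate {c : ℝ} (hc : 0 < c) {w : ℝ → ℂ} (hw : ContDiffOn ℝ ∞ w (Ioi 0)) :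
    ContDiffOn ℝ ∞ (dilate c w) (Ioi 0) :=
  contDiffOn_const.mul (hw.comp (contDiffOn_const.mul contDiffOn_id) fun _ ht => mul_pos hc ht)

/-- The norm `‖t^l ∂_t^{l'} w‖` in `L²(ℝ₊)`. -/
def weightNorm (l l' : ℕ) (w : ℝ → ℂ) : ℝ≥0∞ :=
  eLpNorm (fun t : ℝ => (t : ℂ) ^ l * iteratedDeriv l' w t) 2 (volume.restrict (Ioi 0))

/-- With L² unitarity removed, ∂^{l'} contributes c^{l'} and t^l = c^{-l} (c t)^l contributes
c^{-l}. For l = l' the norm is dilation invariant. -/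
theorem weightNorm_dilate {c : ℝ} (hc : 0 < c) (l l' : ℕ) (w : ℝ → ℂ) :
    weightNorm l l' (dilate c w) = ENNReal.ofReal (c ^ ((l' : ℝ) - l)) * weightNorm l l' w := by
  have himg : (fun x => c * x) '' Ioi 0 = Ioi 0 := by
    rw [image_const_mul_Ioi_zero hc]
  have h1 := eLpNorm_two_comp_eq (s := Ioi 0) measurableSet_Ioi (f := fun x => c * x)
    (f' := fun _ => c) (fun x _ => by simpa using ((hasDerivAt_id x).const_mul c).hasDerivWithinAt)
    (fun x _ y _ h => mul_left_cancel₀ hc.ne' h)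
    (fun t => (t : ℂ) ^ l * iteratedDeriv l' w t)
  rw [himg] at h1
  simp only [weightNorm]
  rw [← h1]
  have h2 : (fun t : ℝ => (t : ℂ) ^ l * iteratedDeriv l' (dilate c w) t) =
      ((c ^ ((l' : ℝ) - l) : ℝ) : ℂ) •
      fun t : ℝ => (√|c| : ℂ) * (((c * t : ℝ) : ℂ) ^ l * iteratedDeriv l' w (c * t)) := by
    ext t
    rw [iteratedDeriv_dilate, Pi.smul_apply, smul_eq_mul, abs_of_pos hc, Real.sqrt_eq_rpow,
      Real.rpow_sub hc, Real.rpow_natCast, Real.rpow_natCast]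
    have : (c : ℂ) ≠ 0 := by exact_mod_cast hc.ne'
    push_cast
    field_simp
    rw [mul_pow]
    ring
  rw [h2, eLpNorm_const_smul]
  congr 1
  rw [← ofReal_norm, Complex.norm_real, Real.norm_eq_abs, abs_of_nonneg (by positivity)]

/-! ### The substitution t = e^{-x}. -/

theorem exp_neg_image_univ : (fun x => Real.exp (-x)) '' univ = Ioi 0 := by
  ext t
  constructor
  · rintro ⟨x, -, rfl⟩
    exact Real.exp_pos _
  · intro ht
    exact ⟨-Real.log t, mem_univ _, by simp [Real.exp_log ht]⟩

theorem hasDerivAt_exp_neg (x : ℝ) :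
    HasDerivAt (fun x => Real.exp (-x)) (-Real.exp (-x)) x := by
  simpa using (hasDerivAt_neg x).exp

theorem integral_Ioi_eq_integral_exp_neg (g : ℝ → ℂ) :
    ∫ t in Ioi 0, g t = ∫ x, (Real.exp (-x) : ℂ) * g (Real.exp (-x)) := by
  have h := integral_image_eq_integral_abs_deriv_smul MeasurableSet.univ
    (fun x _ => (hasDerivAt_exp_neg x).hasDerivWithinAt)
    (fun x _ y _ h => neg_injective (Real.exp_injective h)) g
  rw [exp_neg_image_univ, setIntegral_univ] at h
  rw [h]
  congr 1; ext x
  rw [abs_neg, Real.abs_exp, Complex.real_smul]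

theorem sqrt_exp_neg (x : ℝ) : √(Real.exp (-x)) = Real.exp (-x / 2) := by
  rw [Real.sqrt_eq_iff_mul_self_eq (Real.exp_pos _).le (Real.exp_pos _).le, ← Real.exp_add]
  ring_nf

theorem eLpNorm_exp_neg_eq (h : ℝ → ℂ) :
    eLpNorm (fun x => (Real.exp (-x / 2) : ℂ) * h (Real.exp (-x))) 2 volume =
      eLpNorm h 2 (volume.restrict (Ioi 0)) := by
  have h1 := eLpNorm_two_comp_eq MeasurableSet.univ
    (fun x _ => (hasDerivAt_exp_neg x).hasDerivWithinAt)
    (fun x _ y _ h => neg_injective (Real.exp_injective h)) h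
  rw [exp_neg_image_univ, Measure.restrict_univ] at h1
  rw [← h1]
  congr 1; ext x
  rw [abs_neg, Real.abs_exp, sqrt_exp_neg]

/-- The function `e^{-x/2} g(e^{-x})` on the line. -/
def logPull (g : ℝ → ℂ) (x : ℝ) : ℂ := (Real.exp (-x / 2) : ℂ) * g (Real.exp (-x))

/-- For γ = 0 an element has the form t^{-1/2} v(-ln t), and v = e^{-x/2} g(e^{-x}) returns g. -/
theorem represents_mellinSobolevEmb {s : ℝ} {f : L2R} {g : ℝ → ℂ}
    (h : Represents (restrictTempered ⊤ (sobolevEmb s f)) (logPull g)) :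
    Represents (mellinSobolevEmb s 0 f) g := by
  have h1 : Represents (thetaInv (restrictTempered ⊤ (sobolevEmb s f)))
      fun t => ((t ^ (1 / 2 : ℝ) : ℝ) : ℂ) * g t := by
    intro φ
    rw [thetaInv, WeightedMap.distMap_apply, h]
    change _ = ∫ t in Ioi 0, _
    rw [integral_Ioi_eq_integral_exp_neg]
    change ∫ x in univ, _ = _
    rw [setIntegral_univ]
    congr 1; ext x
    have hx : x ∈ ((⊤ : Opens ℝ) : Set ℝ) := trivial
    rw [WeightedMap.testMap_apply, indicator_of_mem hx]
    simp only [logPull]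
    rw [← Real.exp_mul]
    push_cast
    ring_nf
  refine (h1.mulDist (contDiffOn_rpow_halfLine (0 - 1 / 2))).congr fun t ht => ?_
  have ht' : (0 : ℝ) < t := ht
  simp only
  rw [← mul_assoc, ← Complex.ofReal_mul, ← Real.rpow_add ht']
  norm_num

/-- The operator `φ ↦ t^{-1/2} φ(-ln t)` on test functions. -/
def logTest : WeightedMap (⊤ : Opens ℝ) halfLine where
  weight := fun t => t ^ (-(1 / 2) : ℝ)
  map := fun t => -Real.log t
  inv := fun x => Real.exp (-x)
  contDiffOn_weight := contDiffOn_rpow_halfLine _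
  contDiffOn_map := (Real.contDiffOn_log.mono fun _ h => ne_of_gt h).neg
  mapsTo := fun _ _ => trivial
  continuousOn_inv := by fun_prop
  mapsTo_inv := fun _ _ => Real.exp_pos _
  leftInvOn := fun t ht => by
    have : (0 : ℝ) < t := ht
    simp [Real.exp_log this]

theorem represents_logPull {s : ℝ} {f : L2R} {g : ℝ → ℂ}
    (h : Represents (mellinSobolevEmb s 0 f) g) :
    Represents (restrictTempered ⊤ (sobolevEmb s f)) (logPull g) := by
  intro φ
  -- On test functions the three weights multiply to e^{-x} e^{x/2} e^{x/2} = 1, so `logTest`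
  -- inverts the transposed embedding.
  have h1 : mellinSobolevEmb s 0 f (logTest.testMap φ) = restrictTempered ⊤ (sobolevEmb s f) φ := by
    simp only [mellinSobolevEmb, LinearMap.comp_apply]
    rw [mulDist, WeightedMap.distMap_apply, thetaInv, WeightedMap.distMap_apply]
    refine congrArg (restrictTempered ⊤ (sobolevEmb s f)) (TestFunction.ext fun x => ?_)
    have hx : Real.exp (-x) ∈ (halfLine : Set ℝ) := Real.exp_pos _
    have hx' : x ∈ ((⊤ : Opens ℝ) : Set ℝ) := trivial
    simp only [WeightedMap.testMap_apply]
    rw [indicator_of_mem hx', indicator_of_mem hx]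
    simp only [id]
    rw [indicator_of_mem hx]
    simp only [ logTest, Real.log_exp, neg_neg]
    rw [← mul_assoc, ← mul_assoc, ← Real.exp_mul, ← Real.exp_mul, ← Real.exp_add, ← Real.exp_add]
    ring_nf
    simp
  rw [← h1, h]
  change ∫ t in Ioi 0, _ = ∫ t in univ, _
  rw [integral_Ioi_eq_integral_exp_neg, setIntegral_univ]
  congr 1; ext x
  have hx : Real.exp (-x) ∈ (halfLine : Set ℝ) := Real.exp_pos _
  have he : Real.exp (-x) * Real.exp (-x) ^ (-(1 / 2) : ℝ) = Real.exp (-x / 2) := by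
    rw [← Real.exp_mul, ← Real.exp_add]
    ring_nf
  rw [WeightedMap.testMap_apply, indicator_of_mem hx]
  simp only [logTest, Real.log_exp, neg_neg, logPull]
  rw [← he]
  push_cast
  ring

/-! ### Pointwise estimates of derivatives -/

theorem eLpNorm_two_le_mul_sum {ι : Type*} (I : Finset ι) {f : ℝ → ℂ} {g : ι → ℝ → ℂ}
    {μ : Measure ℝ} (hg : ∀ i ∈ I, AEStronglyMeasurable (g i) μ) (C : ℝ≥0)
    (h : ∀ᵐ t ∂μ, ‖f t‖ ≤ C * ∑ i ∈ I, ‖g i t‖) :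
    eLpNorm f 2 μ ≤ C * ∑ i ∈ I, eLpNorm (g i) 2 μ := by
  have h1 : eLpNorm f 2 μ ≤ eLpNorm ((C : ℝ) • ∑ i ∈ I, fun t => ‖g i t‖) 2 μ := by
    refine eLpNorm_mono_ae_real ?_
    filter_upwards [h] with t ht
    simpa [Finset.sum_apply] using ht
  refine h1.trans ?_
  rw [eLpNorm_const_smul]
  have h2 : ‖(C : ℝ)‖ₑ = C := by simp [enorm]
  rw [h2]
  gcongr
  refine (eLpNorm_sum_le (fun i hi => (hg i hi).norm) (by norm_num)).trans ?_
  exact Finset.sum_le_sum fun i _ => (eLpNorm_norm _).le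

theorem norm_iteratedDeriv_smul_le {F : Type*} [NormedAddCommGroup F] [NormedSpace ℝ F]
    {h : ℝ → ℝ} {w : ℝ → F} (hh : ContDiffOn ℝ ∞ h (Ioi 0)) (hw : ContDiffOn ℝ ∞ w (Ioi 0))
    {t : ℝ} (ht : 0 < t) (n : ℕ) {B : ℝ} (hB : ∀ i ≤ n, |iteratedDeriv i h t| ≤ B) :
    ‖iteratedDeriv n (fun t => h t • w t) t‖ ≤
      2 ^ n * B * ∑ j ∈ Finset.range (n + 1), ‖iteratedDeriv j w t‖ := by
  have h1 := norm_iteratedFDerivWithin_smul_le hh hw isOpen_Ioi.uniqueDiffOn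
    (show t ∈ Ioi (0 : ℝ) from ht) (n := n) (mod_cast le_top)
  simp only [norm_iteratedFDerivWithin_eq_norm_iteratedDerivWithin] at h1
  simp only [iteratedDerivWithin_of_isOpen isOpen_Ioi (show t ∈ Ioi (0 : ℝ) from ht)] at h1
  refine h1.trans ?_
  rw [← Finset.sum_range_reflect (fun j => ‖iteratedDeriv j w t‖), Finset.mul_sum]
  refine Finset.sum_le_sum fun i hi => ?_
  have hi' : i ≤ n := Finset.mem_range_succ_iff.1 hi
  have h2 : (n.choose i : ℝ) ≤ 2 ^ n := by exact_mod_cast Nat.choose_le_two_pow n i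
  have h3 := hB i hi'
  have h4 : n + 1 - 1 - i = n - i := by omega
  rw [h4, Real.norm_eq_abs]
  have h5 : 0 ≤ B := (abs_nonneg _).trans h3
  gcongr

theorem exists_uniform_bound {a : ℕ → ℝ → ℝ} {b : ℝ → ℝ} (hb : ∀ t > 0, 0 ≤ b t)
    (h : ∀ i, ∃ C : ℝ, ∀ t > 0, |a i t| ≤ C * b t) (n : ℕ) :
    ∃ C : ℝ≥0, ∀ i ≤ n, ∀ t > 0, |a i t| ≤ C * b t := by
  choose C hC using h
  refine ⟨∑ i ∈ Finset.range (n + 1), ‖C i‖₊, fun i hi t ht => (hC i t ht).trans ?_⟩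
  refine mul_le_mul_of_nonneg_right ?_ (hb t ht)
  have h1 := Finset.single_le_sum (f := fun i => ‖C i‖₊) (fun _ _ => zero_le)
    (Finset.mem_range_succ_iff.2 hi)
  calc C i ≤ ‖C i‖ := Real.le_norm_self _
    _ ≤ _ := by exact_mod_cast h1

theorem bracketPow_pos (r t : ℝ) : 0 < bracketPow r t := by
  unfold bracketPow; positivity

theorem hasDerivAt_bracketPow (r t : ℝ) :
    HasDerivAt (bracketPow r) (r * (t * bracketPow (r - 2) t)) t := by
  have h1 : HasDerivAt (fun t : ℝ => 1 + t ^ 2) (2 * t) t := by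
    simpa using (hasDerivAt_pow 2 t).const_add 1
  have h2 := h1.rpow_const (p := r / 2) (Or.inl (by positivity))
  refine h2.congr_deriv ?_
  simp only [bracketPow]
  rw [show (r - 2) / 2 = r / 2 - 1 by ring]
  ring

theorem abs_iteratedDeriv_id_le (i : ℕ) {t : ℝ} (ht : 0 < t) :
    |iteratedDeriv i (fun x : ℝ => x) t| ≤ 1 + t := by
  rcases i with _ | i
  · rw [iteratedDeriv_zero, abs_of_pos ht]; linarith
  · rw [iteratedDeriv_succ', deriv_id'', iteratedDeriv_const]
    split_ifs <;> simp <;> linarith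

/-- Induction through ∂⟨t⟩^r = r t ⟨t⟩^{r-2}: all derivatives of the factor t are at most 1 + t, and
(1 + t) ⟨t⟩^{r-2} ≤ 2 ⟨t⟩^r. The exponent drops by two, hence r is general in the induction. -/
theorem exists_bound_iteratedDeriv_bracketPow (i : ℕ) (r : ℝ) :
    ∃ C : ℝ, ∀ t > 0, |iteratedDeriv i (bracketPow r) t| ≤ C * bracketPow r t := by
  induction i using Nat.strong_induction_on generalizing r with
  | _ i ih =>
    rcases i with _ | i
    · exact ⟨1, fun t _ => by rw [iteratedDeriv_zero, one_mul, abs_of_pos (bracketPow_pos r t)]⟩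
    -- The restriction j ≤ i is placed inside the existential so that constants can be chosen for
    -- all j, with 0 outside the range.
    · have hih : ∀ j, ∃ C : ℝ, j ≤ i → ∀ t > 0,
          |iteratedDeriv j (bracketPow (r - 2)) t| ≤ C * bracketPow (r - 2) t := fun j => by
        by_cases hj : j ≤ i
        · obtain ⟨C, hC⟩ := ih j (by omega) (r - 2)
          exact ⟨C, fun _ => hC⟩
        · exact ⟨0, fun h => absurd h hj⟩
      choose C hC using hih
      have hd : deriv (bracketPow r) = fun t => r * (t • bracketPow (r - 2) t) :=
        funext fun t => (hasDerivAt_bracketPow r t).deriv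
      refine ⟨|r| * (2 ^ i * 2 * ∑ j ∈ Finset.range (i + 1), |C j|), fun t ht => ?_⟩
      rw [iteratedDeriv_succ', hd, iteratedDeriv_const_mul_field, abs_mul, mul_assoc]
      refine mul_le_mul_of_nonneg_left ?_ (abs_nonneg r)
      have h1 := norm_iteratedDeriv_smul_le (h := fun x => x) (w := bracketPow (r - 2)) contDiffOn_id
        (contDiffOn_bracketPow (r - 2)) ht i (fun j _ => abs_iteratedDeriv_id_le j ht)
      refine h1.trans ?_
      have h2 : ∑ j ∈ Finset.range (i + 1), ‖iteratedDeriv j (bracketPow (r - 2)) t‖ ≤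
          (∑ j ∈ Finset.range (i + 1), |C j|) * bracketPow (r - 2) t := by
        rw [Finset.sum_mul]
        refine Finset.sum_le_sum fun j hj => ?_
        refine (hC j (Finset.mem_range_succ_iff.1 hj) t ht).trans ?_
        exact mul_le_mul_of_nonneg_right (le_abs_self _) (bracketPow_pos _ _).le
      have h3 : (1 + t) * bracketPow (r - 2) t ≤ 2 * bracketPow r t := by
        have h4 : bracketPow r t = (1 + t ^ 2) * bracketPow (r - 2) t := by
          simp only [bracketPow]
          rw [show r / 2 = 1 + (r - 2) / 2 by ring, Real.rpow_add (by positivity), Real.rpow_one]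
        rw [h4, ← mul_assoc]
        refine mul_le_mul_of_nonneg_right ?_ (bracketPow_pos _ _).le
        nlinarith [sq_nonneg (t - 1)]
      have h5 : 0 ≤ ∑ j ∈ Finset.range (i + 1), |C j| := Finset.sum_nonneg fun _ _ => abs_nonneg _
      calc _ ≤ 2 ^ i * (1 + t) * ((∑ j ∈ Finset.range (i + 1), |C j|) * bracketPow (r - 2) t) := by
            gcongr
        _ = 2 ^ i * (∑ j ∈ Finset.range (i + 1), |C j|) * ((1 + t) * bracketPow (r - 2) t) := by ring
        _ ≤ 2 ^ i * (∑ j ∈ Finset.range (i + 1), |C j|) * (2 * bracketPow r t) := by gcongr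
        _ = _ := by ring

/-- Only the compact interval [ε, R] carries nontrivial derivatives. The general end values a and b
cover both χ and 1 - χ. -/
theorem exists_bound_iteratedDeriv_of_const {η : ℝ → ℝ} (hη : ContDiffOn ℝ ∞ η (Ioi 0)) {ε R a b : ℝ}
    (hε : 0 < ε) (h0 : ∀ t ∈ Ioo 0 ε, η t = a) (h1 : ∀ t > R, η t = b) (i : ℕ) :
    ∃ C : ℝ, ∀ t > 0, |iteratedDeriv i η t| ≤ C * 1 := by
  have hc : ContinuousOn (iteratedDeriv i η) (Ioi 0) :=
    (hη.continuousOn_iteratedDerivWithin (mod_cast le_top) isOpen_Ioi.uniqueDiffOn).congr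
      fun t ht => (iteratedDerivWithin_of_isOpen isOpen_Ioi ht).symm
  obtain ⟨C, hC⟩ := isCompact_Icc.exists_bound_of_continuousOn
    (hc.mono fun t (ht : t ∈ Icc ε R) => hε.trans_le ht.1)
  have hconst : ∀ c t : ℝ, |iteratedDeriv i (fun _ : ℝ => c) t| ≤ |c| := fun c t => by
    rw [iteratedDeriv_const]
    split_ifs <;> simp
  refine ⟨|C| + |a| + |b|, fun t ht => ?_⟩
  rw [mul_one]
  have ha := abs_nonneg a
  have hb := abs_nonneg b
  have hC0 := abs_nonneg C
  rcases lt_or_ge t ε with h | h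
  · have he : η =ᶠ[𝓝 t] fun _ => a := by
      filter_upwards [Ioo_mem_nhds ht h] with y hy using h0 y hy
    rw [he.iteratedDeriv_eq]
    linarith [hconst a t]
  · rcases lt_or_ge R t with h' | h'
    · have he : η =ᶠ[𝓝 t] fun _ => b := by
        filter_upwards [Ioi_mem_nhds h'] with y hy using h1 y hy
      rw [he.iteratedDeriv_eq]
      linarith [hconst b t]
    · have := hC t ⟨h, h'⟩
      rw [Real.norm_eq_abs] at this
      linarith [le_abs_self C]

theorem exists_bound_iteratedDeriv_mul_bracketPow {η : ℝ → ℝ} (hη : ContDiffOn ℝ ∞ η (Ioi 0))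
    (hb : ∀ i, ∃ C : ℝ, ∀ t > 0, |iteratedDeriv i η t| ≤ C * 1) (r : ℝ) (i : ℕ) :
    ∃ C : ℝ, ∀ t > 0, |iteratedDeriv i (fun t => η t * bracketPow r t) t| ≤ C * bracketPow r t := by
  obtain ⟨C, hC⟩ := exists_uniform_bound (b := fun _ => 1) (fun _ _ => zero_le_one) hb i
  obtain ⟨D, hD⟩ := exists_uniform_bound (fun t _ => (bracketPow_pos r t).le)
    (fun j => exists_bound_iteratedDeriv_bracketPow j r) i
  refine ⟨2 ^ i * C * ((i + 1 : ℕ) * D), fun t ht => ?_⟩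
  have h1 := norm_iteratedDeriv_smul_le hη (contDiffOn_bracketPow r) ht i
    (fun j hj => (hC j hj t ht).trans (mul_one _).le)
  refine h1.trans ?_
  have h2 : ∑ j ∈ Finset.range (i + 1), ‖iteratedDeriv j (bracketPow r) t‖ ≤
      (i + 1 : ℕ) * (D * bracketPow r t) := by
    have := Finset.sum_le_card_nsmul (Finset.range (i + 1))
      (fun j => ‖iteratedDeriv j (bracketPow r) t‖) (D * bracketPow r t)
      fun j hj => hD j (Finset.mem_range_succ_iff.1 hj) t ht
    simpa using this
  calc _ ≤ 2 ^ i * C * ((i + 1 : ℕ) * (D * bracketPow r t)) := by gcongr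
    _ = _ := by ring

theorem bracketPow_le_one_add_pow {r t : ℝ} (ht : 0 < t) {M : ℕ} (hM : r ≤ M) :
    bracketPow r t ≤ (1 + t) ^ M := by
  calc bracketPow r t ≤ (1 + t ^ 2) ^ ((M : ℝ) / 2) :=
        Real.rpow_le_rpow_of_exponent_le (by nlinarith [sq_nonneg t]) (by linarith)
    _ = √(1 + t ^ 2) ^ M := rpow_half_natCast _ (by positivity) M
    _ ≤ _ := by
      gcongr
      rw [Real.sqrt_le_left (by positivity)]
      nlinarith

/-- The bound t^j serves near 0, where t^j ∂^j is controlled, and the bound 1 serves away from 0,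
where plain derivatives are. -/
theorem pow_mul_bracketPow_neg_le {t : ℝ} (ht : 0 < t) {j l : ℕ} (hj : j ≤ l) :
    t ^ l * bracketPow (-l) t ≤ min 1 (t ^ j) := by
  have h1 : bracketPow (-l) t = (√(1 + t ^ 2) ^ l)⁻¹ := by
    rw [← rpow_half_natCast _ (by positivity), ← Real.rpow_neg (by positivity), bracketPow, neg_div]
  have h2 : 1 ≤ √(1 + t ^ 2) := Real.one_le_sqrt.2 (by nlinarith [sq_nonneg t])
  have h3 : t ≤ √(1 + t ^ 2) := (le_abs_self t).trans (Real.abs_le_sqrt (by linarith))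
  have h4 : 0 < √(1 + t ^ 2) ^ l := by positivity
  have h5 : t ^ l * bracketPow (-l) t ≤ 1 := by
    rw [h1, mul_inv_le_iff₀ h4, one_mul]; gcongr
  refine le_min h5 ?_
  rcases le_total t 1 with h | h
  · calc t ^ l * bracketPow (-l) t ≤ t ^ l * 1 := by
          gcongr
          rw [h1]
          exact inv_le_one_of_one_le₀ (one_le_pow₀ h2)
      _ ≤ t ^ j := by rw [mul_one]; exact pow_le_pow_of_le_one ht.le h hj
  · exact h5.trans (one_le_pow₀ h)

/-! ### Logarithmic change of variables and derivatives -/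

/-- Sequences of functions with the differentiation rule of `e^{-x/2} (t^i ∂_t^i g)(e^{-x})`. -/
structure IsLogSeq (Z : ℕ → ℝ → ℂ) : Prop where
  smooth : ∀ i, ContDiff ℝ ∞ (Z i)
  deriv_eq : ∀ i, deriv (Z i) = fun x => -(1 / 2 + i : ℂ) * Z i x - Z (i + 1) x

namespace IsLogSeq

variable {Z : ℕ → ℝ → ℂ}

theorem iteratedDeriv_succ (hZ : IsLogSeq Z) (i n : ℕ) : iteratedDeriv (i + 1) (Z n) =
    fun x => -(1 / 2 + n : ℂ) * iteratedDeriv i (Z n) x - iteratedDeriv i (Z (n + 1)) x := by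
  rw [_root_.iteratedDeriv_succ', hZ.deriv_eq]
  ext x
  have h : ∀ k, ContDiffAt ℝ i (Z k) x := fun k =>
    ((hZ.smooth k).of_le (mod_cast le_top)).contDiffAt
  have e : (fun x => -(1 / 2 + n : ℂ) * Z n x - Z (n + 1) x) =
      (fun x => -(1 / 2 + n : ℂ) * Z n x) - Z (n + 1) := rfl
  rw [e, iteratedDeriv_sub (contDiffAt_const.mul (h n)) (h (n + 1)), iteratedDeriv_const_mul_field]

theorem aestronglyMeasurable (hZ : IsLogSeq Z) (i n : ℕ) :
    AEStronglyMeasurable (iteratedDeriv i (Z n)) volume :=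
  ((hZ.smooth n).continuous_iteratedDeriv i (mod_cast le_top)).aestronglyMeasurable

end IsLogSeq

theorem eLpNorm_le_of_eq_lincomb {f g h : ℝ → ℂ} {c : ℂ} (hg : AEStronglyMeasurable g volume)
    (hh : AEStronglyMeasurable h volume) (hf : f = fun x => c * g x - h x) :
    eLpNorm f 2 volume ≤ ‖c‖ₑ * eLpNorm g 2 volume + eLpNorm h 2 volume := by
  have : f = c • g - h := hf
  rw [this, ← eLpNorm_const_smul]
  exact eLpNorm_sub_le (hg.const_smul c) hh (by norm_num)

/-- Each x-derivative raises the index of the sequence by at most one. -/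
theorem IsLogSeq.eLpNorm_iteratedDeriv_le (i n : ℕ) : ∃ C : ℝ≥0, ∀ Z, IsLogSeq Z →
    eLpNorm (iteratedDeriv i (Z n)) 2 volume ≤
      C * ∑ j ∈ Finset.range (n + i + 1), eLpNorm (Z j) 2 volume := by
  induction i generalizing n with
  | zero =>
    refine ⟨1, fun Z _ => ?_⟩
    rw [iteratedDeriv_zero, ENNReal.coe_one, one_mul]
    exact Finset.single_le_sum (f := fun j => eLpNorm (Z j) 2 volume) (fun _ _ => zero_le)
      (by simp)
  | succ i ih =>
    obtain ⟨C, hC⟩ := ih n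
    obtain ⟨D, hD⟩ := ih (n + 1)
    refine ⟨‖-(1 / 2 + n : ℂ)‖₊ * C + D, fun Z hZ => ?_⟩
    refine (eLpNorm_le_of_eq_lincomb (hZ.aestronglyMeasurable i n)
      (hZ.aestronglyMeasurable i (n + 1)) (hZ.iteratedDeriv_succ i n)).trans ?_
    have h1 : ∑ j ∈ Finset.range (n + i + 1), eLpNorm (Z j) 2 volume ≤
        ∑ j ∈ Finset.range (n + (i + 1) + 1), eLpNorm (Z j) 2 volume :=
      Finset.sum_le_sum_of_subset (Finset.range_mono (by omega))
    have h2 : n + 1 + i + 1 = n + (i + 1) + 1 := by omega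
    have h3 := hD Z hZ
    rw [h2] at h3
    push_cast
    rw [add_mul, mul_assoc]
    refine add_le_add ?_ h3
    rw [enorm_eq_nnnorm]
    gcongr
    exact (hC Z hZ).trans (by gcongr)

/-- The differentiation rule is solved for the next member of the sequence: raising the index by one
costs one x-derivative. -/
theorem IsLogSeq.eLpNorm_le (i n : ℕ) : ∃ C : ℝ≥0, ∀ Z, IsLogSeq Z →
    eLpNorm (iteratedDeriv i (Z n)) 2 volume ≤
      C * ∑ j ∈ Finset.range (n + i + 1), eLpNorm (iteratedDeriv j (Z 0)) 2 volume := by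
  induction n generalizing i with
  | zero =>
    refine ⟨1, fun Z _ => ?_⟩
    rw [ENNReal.coe_one, one_mul]
    exact Finset.single_le_sum (f := fun j => eLpNorm (iteratedDeriv j (Z 0)) 2 volume)
      (fun _ _ => zero_le) (by simp)
  | succ n ih =>
    obtain ⟨C, hC⟩ := ih i
    obtain ⟨D, hD⟩ := ih (i + 1)
    refine ⟨‖-(1 / 2 + n : ℂ)‖₊ * C + D, fun Z hZ => ?_⟩
    have he : iteratedDeriv i (Z (n + 1)) = fun x =>
        -(1 / 2 + n : ℂ) * iteratedDeriv i (Z n) x - iteratedDeriv (i + 1) (Z n) x := by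
      rw [hZ.iteratedDeriv_succ i n]
      ext x
      ring
    refine (eLpNorm_le_of_eq_lincomb (hZ.aestronglyMeasurable i n)
      (hZ.aestronglyMeasurable (i + 1) n) he).trans ?_
    have h1 : ∑ j ∈ Finset.range (n + i + 1), eLpNorm (iteratedDeriv j (Z 0)) 2 volume ≤
        ∑ j ∈ Finset.range (n + 1 + i + 1), eLpNorm (iteratedDeriv j (Z 0)) 2 volume :=
      Finset.sum_le_sum_of_subset (Finset.range_mono (by omega))
    have h2 : n + (i + 1) + 1 = n + 1 + i + 1 := by omega
    have h3 := hD Z hZ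
    rw [h2] at h3
    push_cast
    rw [add_mul, mul_assoc]
    refine add_le_add ?_ h3
    rw [enorm_eq_nnnorm]
    gcongr
    exact (hC Z hZ).trans (by gcongr)

theorem contDiff_logPull {h : ℝ → ℂ} (hh : ContDiffOn ℝ ∞ h (Ioi 0)) : ContDiff ℝ ∞ (logPull h) := by
  have h1 : ContDiff ℝ ∞ fun x : ℝ => Real.exp (-x) := Real.contDiff_exp.comp contDiff_neg
  have h2 : ContDiff ℝ ∞ fun x : ℝ => (Real.exp (-x / 2) : ℂ) :=
    Complex.ofRealCLM.contDiff.comp (Real.contDiff_exp.comp (contDiff_neg.div_const 2))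
  refine h2.mul ?_
  rw [← contDiffOn_univ]
  exact hh.comp h1.contDiffOn fun x _ => Real.exp_pos _

theorem isLogSeq_logPull {g : ℝ → ℂ} (hg : ContDiffOn ℝ ∞ g (Ioi 0)) :
    IsLogSeq fun i => logPull fun t => (t : ℂ) ^ i * iteratedDeriv i g t := by
  have hgi := fun i => contDiffOn_iteratedDeriv_opens (Ω := halfLine) hg i
  refine ⟨fun i => contDiff_logPull ?_, fun i => funext fun x => ?_⟩
  · exact (Complex.ofRealCLM.contDiff.pow i).contDiffOn.mul (hgi i)
  · have hx : Real.exp (-x) ∈ (halfLine : Set ℝ) := Real.exp_pos _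
    have d1 : HasDerivAt (fun x : ℝ => (Real.exp (-x / 2) : ℂ))
        ((Real.exp (-x / 2) * (-1 / 2) : ℝ) : ℂ) x :=
      (((hasDerivAt_neg x).div_const 2).exp).ofReal_comp
    have d2 : HasDerivAt (iteratedDeriv i g) (iteratedDeriv (i + 1) g (Real.exp (-x)))
        (Real.exp (-x)) := by
      rw [iteratedDeriv_succ]
      exact ((contDiffAt_of_contDiffOn_opens (hgi i) hx).differentiableAt (by simp)).hasDerivAt
    have d3 := d2.scomp x (hasDerivAt_exp_neg x)
    have d4 : HasDerivAt (fun x : ℝ => ((Real.exp (-x) : ℝ) : ℂ)) ((-Real.exp (-x) : ℝ) : ℂ) x :=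
      (hasDerivAt_exp_neg x).ofReal_comp
    have d5 : HasDerivAt (fun x : ℝ => ((Real.exp (-x) : ℝ) : ℂ) ^ i)
        (-(i : ℂ) * ((Real.exp (-x) : ℝ) : ℂ) ^ i) x := by
      refine (d4.pow i).congr_deriv ?_
      rcases i with _ | i
      · simp
      · simp only [Nat.add_sub_cancel]
        push_cast
        ring
    have d6 := d1.mul (d5.mul d3)
    refine (d6.congr_deriv ?_).deriv
    simp only [logPull, Complex.real_smul, Function.comp, Pi.mul_apply]
    push_cast
    ring

theorem logPull_zero_eq (g : ℝ → ℂ) :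
    (logPull fun t => (t : ℂ) ^ 0 * iteratedDeriv 0 g t) = logPull g := by
  simp

theorem eLpNorm_logPull_eq (g : ℝ → ℂ) (i : ℕ) :
    eLpNorm (logPull fun t => (t : ℂ) ^ i * iteratedDeriv i g t) 2 volume = weightNorm i i g := by
  have h := eLpNorm_exp_neg_eq (fun t => (t : ℂ) ^ i * iteratedDeriv i g t)
  rw [weightNorm, ← h]
  rfl

/-- Together with its converse below: in logarithmic coordinates, x-derivatives up to order i are
equivalent in L² to the operators t^j ∂^j with j ≤ i. -/
theorem exists_eLpNorm_iteratedDeriv_logPull_le (i : ℕ) : ∃ C : ℝ≥0, ∀ g : ℝ → ℂ,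
    ContDiffOn ℝ ∞ g (Ioi 0) → eLpNorm (iteratedDeriv i (logPull g)) 2 volume ≤
      C * ∑ j ∈ Finset.range (i + 1), weightNorm j j g := by
  obtain ⟨C, hC⟩ := IsLogSeq.eLpNorm_iteratedDeriv_le i 0
  refine ⟨C, fun g hg => ?_⟩
  have := hC _ (isLogSeq_logPull hg)
  simp only [eLpNorm_logPull_eq, logPull_zero_eq, zero_add] at this
  exact this

theorem exists_weightNorm_le_logPull (i : ℕ) : ∃ C : ℝ≥0, ∀ g : ℝ → ℂ,
    ContDiffOn ℝ ∞ g (Ioi 0) → weightNorm i i g ≤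
      C * ∑ j ∈ Finset.range (i + 1), eLpNorm (iteratedDeriv j (logPull g)) 2 volume := by
  obtain ⟨C, hC⟩ := IsLogSeq.eLpNorm_le 0 i
  refine ⟨C, fun g hg => ?_⟩
  have := hC _ (isLogSeq_logPull hg)
  simp only [iteratedDeriv_zero (f := logPull _), eLpNorm_logPull_eq, logPull_zero_eq,
    add_zero] at this
  exact this

/-! ### Weighted norms of products -/

/-- Leibniz' rule with a common bound b for the derivatives of the multiplier. The set `Q j` of
admissible powers may depend on the number j of derivatives left on w, so the resulting weight can
be matched to that order. -/
theorem weightNorm_ofReal_mul_le {h : ℝ → ℝ} {w : ℝ → ℂ} (hh : ContDiffOn ℝ ∞ h (Ioi 0))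
    (hw : ContDiffOn ℝ ∞ w (Ioi 0)) (l n : ℕ) {b : ℝ → ℝ} {B D : ℝ≥0} {Q : ℕ → Finset ℕ}
    (hB : ∀ i ≤ n, ∀ t > 0, |iteratedDeriv i h t| ≤ B * b t)
    (hQ : ∀ j ≤ n, ∀ t > 0, t ^ l * b t ≤ D * ∑ q ∈ Q j, t ^ q) :
    weightNorm l n (fun t => (h t : ℂ) * w t) ≤ (2 ^ n * B * D : ℝ≥0) *
      ∑ j ∈ Finset.range (n + 1), ∑ q ∈ Q j, weightNorm q j w := by
  rw [Finset.sum_sigma']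
  refine eLpNorm_two_le_mul_sum ((Finset.range (n + 1)).sigma Q)
    (g := fun x t => (t : ℂ) ^ x.2 * iteratedDeriv x.1 w t) (fun x _ => ?_) _ ?_
  · exact (Complex.continuous_ofReal.pow x.2).aestronglyMeasurable.mul
      (aestronglyMeasurable_iteratedDeriv_opens (Ω := halfLine) hw x.1)
  filter_upwards [ae_restrict_mem measurableSet_Ioi] with t ht
  have ht0 : (0 : ℝ) < t := ht
  have h1 := norm_iteratedDeriv_smul_le hh hw ht0 n (fun i hi => hB i hi t ht0)
  simp only [Complex.real_smul] at h1
  rw [Finset.sum_sigma, norm_mul, norm_pow, Complex.norm_real, Real.norm_of_nonneg ht0.le]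
  calc t ^ l * _ ≤ t ^ l * _ := mul_le_mul_of_nonneg_left h1 (by positivity)
    _ = ∑ j ∈ Finset.range (n + 1), 2 ^ n * B * ((t ^ l * b t) * ‖iteratedDeriv j w t‖) := by
      rw [Finset.mul_sum, Finset.mul_sum]
      exact Finset.sum_congr rfl fun j _ => by ring
    _ ≤ ∑ j ∈ Finset.range (n + 1),
        2 ^ n * B * ((D * ∑ q ∈ Q j, t ^ q) * ‖iteratedDeriv j w t‖) := by
      refine Finset.sum_le_sum fun j hj => ?_
      have := hQ j (Finset.mem_range_succ_iff.1 hj) t ht0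
      gcongr
    _ = _ := by
      rw [Finset.mul_sum]
      refine Finset.sum_congr rfl fun j _ => ?_
      simp only [norm_mul, norm_pow, Complex.norm_real, Real.norm_of_nonneg ht0.le]
      rw [← Finset.sum_mul]
      push_cast
      ring

/-- The sum of the norms `‖t^l ∂^{l'} w‖` over all `l' ≤ l ≤ M`. -/
def weightSum (M : ℕ) (w : ℝ → ℂ) : ℝ≥0∞ :=
  ∑ l ∈ Finset.range (M + 1), ∑ l' ∈ Finset.range (l + 1), weightNorm l l' w

theorem weightSum_mono (w : ℝ → ℂ) : Monotone fun M => weightSum M w := fun _ _ h =>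
  Finset.sum_le_sum_of_subset (Finset.range_mono (by omega))

theorem weightNorm_le_weightSum {l l' M : ℕ} (h : l' ≤ l) (hM : l ≤ M) (w : ℝ → ℂ) :
    weightNorm l l' w ≤ weightSum M w :=
  (Finset.single_le_sum (f := fun l' => weightNorm l l' w) (fun _ _ => zero_le)
    (Finset.mem_range_succ_iff.2 h)).trans
    (Finset.single_le_sum (f := fun l => ∑ l' ∈ Finset.range (l + 1), weightNorm l l' w)
      (fun _ _ => zero_le) (Finset.mem_range_succ_iff.2 hM))

theorem weightSum_lt_top {w : ℝ → ℂ} (hw : ∀ l l', l' ≤ l → weightNorm l l' w < ⊤) (M : ℕ) :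
    weightSum M w < ⊤ :=
  ENNReal.sum_lt_top.2 fun l _ => ENNReal.sum_lt_top.2 fun l' hl' =>
    hw l l' (Finset.mem_range_succ_iff.1 hl')

theorem exists_sum_le_of_forall_exists {ι : Type*} {P : ι → Prop} {F G : ℕ → ι → ℝ≥0∞}
    (hG : ∀ w, Monotone fun i => G i w)
    (h : ∀ i, ∃ C : ℝ≥0, ∀ w, P w → F i w ≤ C * G i w) (N : ℕ) :
    ∃ C : ℝ≥0, ∀ w, P w → ∑ i ∈ Finset.range (N + 1), F i w ≤ C * G N w := by
  choose C hC using h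
  refine ⟨∑ i ∈ Finset.range (N + 1), C i, fun w hw => ?_⟩
  push_cast
  rw [Finset.sum_mul]
  refine Finset.sum_le_sum fun i hi => (hC i w hw).trans ?_
  gcongr
  exact hG w (Finset.mem_range_succ_iff.1 hi)

theorem sum_weightNorm_le_weightSum (n M : ℕ) (w : ℝ → ℂ) :
    ∑ j ∈ Finset.range (n + 1), ∑ q ∈ Finset.Icc n M, weightNorm q j w ≤
      (((n + 1) * (M + 1 - n) : ℕ) : ℝ≥0) * weightSum M w := by
  refine (Finset.sum_le_card_nsmul _ _ ((M + 1 - n : ℕ) • weightSum M w) fun j hj => ?_).trans ?_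
  · refine (Finset.sum_le_card_nsmul _ _ (weightSum M w) fun q hq => ?_).trans ?_
    · rw [Finset.mem_Icc] at hq
      exact weightNorm_le_weightSum ((Finset.mem_range_succ_iff.1 hj).trans hq.1) hq.2 w
    · rw [Nat.card_Icc]
  · rw [Finset.card_range, smul_smul, nsmul_eq_mul]
    push_cast
    rfl

/-! ### Multiplication by the cut-off function and by its complement. -/

namespace IsCutoff

variable {χ : ℝ → ℝ}
theorem exists_bound_iteratedDeriv (hχ : IsCutoff χ) (i : ℕ) : ∃ C : ℝ, ∀ t > 0, |iteratedDeriv i χ t| ≤ C * 1 := by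
  obtain ⟨ε, hε, h0⟩ := hχ.eq_one
  obtain ⟨R, hR⟩ := hχ.eq_zero
  exact exists_bound_iteratedDeriv_of_const hχ.smooth hε h0 hR i

theorem contDiffOn_one_sub (hχ : IsCutoff χ) : ContDiffOn ℝ ∞ (fun t => 1 - χ t) (Ioi 0) :=
  contDiffOn_const.sub hχ.smooth

theorem exists_bound_iteratedDeriv_one_sub (hχ : IsCutoff χ) (i : ℕ) :
    ∃ C : ℝ, ∀ t > 0, |iteratedDeriv i (fun t => 1 - χ t) t| ≤ C * 1 := by
  obtain ⟨ε, hε, h0⟩ := hχ.eq_one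
  obtain ⟨R, hR⟩ := hχ.eq_zero
  exact exists_bound_iteratedDeriv_of_const (a := 0) (b := 1) (R := R) hχ.contDiffOn_one_sub hε
    (fun t ht => by simp [h0 t ht]) (fun t ht => by simp [hR t ht]) i

/-- From ⟨t⟩^r ≤ (1 + t)^R, only the powers t^q with n ≤ q ≤ n + R arise, while at most n
derivatives fall on w; all resulting norms N(q,j) satisfy j ≤ q. -/
theorem exists_weightNorm_mul_bracketPow_le (hχ : IsCutoff χ) {r : ℝ} {R : ℕ} (hr : r ≤ R) (n : ℕ) :
    ∃ C : ℝ≥0, ∀ w : ℝ → ℂ, ContDiffOn ℝ ∞ w (Ioi 0) →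
      weightNorm n n (fun t => ((χ t * bracketPow r t : ℝ) : ℂ) * w t) ≤ C * weightSum (n + R) w := by
  obtain ⟨B, hB⟩ := exists_uniform_bound (fun t _ => (bracketPow_pos r t).le)
    (fun i => exists_bound_iteratedDeriv_mul_bracketPow hχ.smooth hχ.exists_bound_iteratedDeriv r i) n
  have hQ : ∀ j ≤ n, ∀ t > 0, t ^ n * bracketPow r t ≤
      ((2 ^ R : ℝ≥0) : ℝ) * ∑ q ∈ Finset.Icc n (n + R), t ^ q := by
    intro _ _ t ht
    have h1 := bracketPow_le_one_add_pow ht hr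
    have h2 : (1 + t) ^ R ≤ 2 ^ R * ∑ q ∈ Finset.range (R + 1), t ^ q := by
      rw [add_comm, add_pow, Finset.mul_sum]
      refine Finset.sum_le_sum fun q _ => ?_
      rw [one_pow, mul_one, mul_comm]
      gcongr
      exact_mod_cast Nat.choose_le_two_pow R q
    have h3 : ∑ q ∈ Finset.Icc n (n + R), t ^ q = t ^ n * ∑ q ∈ Finset.range (R + 1), t ^ q := by
      rw [← Finset.Ico_add_one_right_eq_Icc, Finset.sum_Ico_eq_sum_range, Finset.mul_sum]
      have : n + R + 1 - n = R + 1 := by omega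
      rw [this]
      exact Finset.sum_congr rfl fun q _ => pow_add t n q
    rw [h3]
    push_cast
    calc t ^ n * bracketPow r t ≤ t ^ n * (2 ^ R * ∑ q ∈ Finset.range (R + 1), t ^ q) := by
          gcongr
          exact h1.trans h2
      _ = _ := by ring
  refine ⟨2 ^ n * B * 2 ^ R * ((n + 1) * (n + R + 1 - n) : ℕ), fun w hw => ?_⟩
  refine (weightNorm_ofReal_mul_le (hχ.smooth.mul (contDiffOn_bracketPow r)) hw n n hB hQ).trans ?_
  refine (mul_le_mul' le_rfl (sum_weightNorm_le_weightSum n (n + R) w)).trans_eq ?_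
  rw [← mul_assoc, ← ENNReal.coe_mul]

/-- Although the left side has no power of t, only norms with l' ≤ l are allowed on the right. Since
1 - χ vanishes for t < ε and 1 + t ≤ (1/ε + 1) t for t ≥ ε, enough powers of t can be inserted. -/
theorem exists_weightNorm_one_sub_mul_bracketPow_le (hχ : IsCutoff χ) {r : ℝ} {R : ℕ} (hr : r ≤ R) (n : ℕ) :
    ∃ C : ℝ≥0, ∀ w : ℝ → ℂ, ContDiffOn ℝ ∞ w (Ioi 0) →
      weightNorm 0 n (fun t => (((1 - χ t) * bracketPow r t : ℝ) : ℂ) * w t) ≤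
        C * weightSum (n + R) w := by
  obtain ⟨B, hB⟩ := exists_uniform_bound (fun t _ => (bracketPow_pos r t).le)
    (fun i => exists_bound_iteratedDeriv_mul_bracketPow hχ.contDiffOn_one_sub
      hχ.exists_bound_iteratedDeriv_one_sub r i) n
  obtain ⟨ε, hε, h0⟩ := hχ.eq_one
  -- The dominating function is cut to zero below ε, where the multiplier vanishes identically;
  -- otherwise it could not be bounded by powers of t.
  have hB' : ∀ i ≤ n, ∀ t > 0, |iteratedDeriv i (fun t => (1 - χ t) * bracketPow r t) t| ≤
      B * (if t < ε then 0 else bracketPow r t) := by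
    intro i hi t ht
    split_ifs with h
    · have he : (fun t => (1 - χ t) * bracketPow r t) =ᶠ[𝓝 t] fun _ => 0 := by
        filter_upwards [Ioo_mem_nhds ht h] with y hy
        rw [h0 y hy, sub_self, zero_mul]
      rw [he.iteratedDeriv_eq, iteratedDeriv_const]
      simp
    · exact hB i hi t ht
  have hD : 0 ≤ (1 / ε + 1) ^ (n + R) := by positivity
  have hQ : ∀ j ≤ n, ∀ t > 0, t ^ 0 * (if t < ε then 0 else bracketPow r t) ≤
      ((⟨(1 / ε + 1) ^ (n + R), hD⟩ : ℝ≥0) : ℝ) * ∑ q ∈ Finset.Icc n (n + R), t ^ q := by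
    intro _ _ t ht
    rw [pow_zero, one_mul]
    have hs : t ^ (n + R) ≤ ∑ q ∈ Finset.Icc n (n + R), t ^ q :=
      Finset.single_le_sum (f := fun q => t ^ q) (fun q _ => by positivity)
        (Finset.mem_Icc.2 ⟨by omega, le_rfl⟩)
    split_ifs with h
    · exact mul_nonneg (NNReal.coe_nonneg _) ((by positivity : (0 : ℝ) ≤ t ^ (n + R)).trans hs)
    · push Not at h
      have h1 : 1 + t ≤ (1 / ε + 1) * t := by
        have : 1 ≤ t / ε := (one_le_div hε).2 h
        calc 1 + t ≤ t / ε + t := by linarith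
          _ = _ := by ring
      calc bracketPow r t ≤ (1 + t) ^ (n + R) :=
            bracketPow_le_one_add_pow ht (hr.trans (mod_cast by omega))
        _ ≤ ((1 / ε + 1) * t) ^ (n + R) := by gcongr
        _ = (1 / ε + 1) ^ (n + R) * t ^ (n + R) := mul_pow _ _ _
        _ ≤ _ := mul_le_mul_of_nonneg_left hs hD
  refine ⟨2 ^ n * B * ⟨(1 / ε + 1) ^ (n + R), hD⟩ * ((n + 1) * (n + R + 1 - n) : ℕ),
    fun w hw => ?_⟩
  refine (weightNorm_ofReal_mul_le (hχ.contDiffOn_one_sub.mul (contDiffOn_bracketPow r)) hw 0 n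
    hB' hQ).trans ?_
  refine (mul_le_mul' le_rfl (sum_weightNorm_le_weightSum n (n + R) w)).trans_eq ?_
  rw [← mul_assoc, ← ENNReal.coe_mul]

end IsCutoff

/-! ### Norms in `H^s(ℝ₊)` and `𝓚^{s,0}(ℝ₊)^ρ` of smooth functions -/

theorem weightNorm_zero_left (n : ℕ) (w : ℝ → ℂ) :
    weightNorm 0 n w = eLpNorm (iteratedDeriv n w) 2 (volume.restrict (Ioi 0)) := by
  simp only [weightNorm, pow_zero, one_mul]

theorem exists_halfSobolevEmb_represents (s : ℝ) : ∃ (N : ℕ) (C : ℝ≥0), ∀ w : ℝ → ℂ,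
    ContDiffOn ℝ ∞ w (Ioi 0) → (∀ i, weightNorm 0 i w < ⊤) →
    ∃ e : HalfSobolev s, Represents (halfSobolevEmb s e) w ∧
      ‖e‖ₑ ≤ C * ∑ i ∈ Finset.range (N + 1), weightNorm 0 i w := by
  obtain ⟨N, C, h⟩ := exists_sobolevEmb_represents halfLine ⟨1, show (0 : ℝ) < 1 from one_pos⟩
    (fun a b hab (ha : 0 < a) => ha.trans_le hab) s
  refine ⟨N, C, fun w hw hfin => ?_⟩
  obtain ⟨f, hf, hn⟩ := h w hw fun i =>
    ⟨aestronglyMeasurable_iteratedDeriv_opens (Ω := halfLine) hw i,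
      (weightNorm_zero_left i w).symm.trans_lt (hfin i)⟩
  refine ⟨Submodule.Quotient.mk f, hf, ?_⟩
  have h1 : ‖(Submodule.Quotient.mk f : HalfSobolev s)‖ₑ ≤ ‖f‖ₑ :=
    enorm_le_iff_norm_le.2 (Submodule.Quotient.norm_mk_le _ f)
  refine h1.trans (hn.trans_eq ?_)
  congr 1
  exact Finset.sum_congr rfl fun i _ => (weightNorm_zero_left i w).symm

theorem exists_weightNorm_zero_le_of_represents {i : ℕ} {s : ℝ} (hi : i ≤ s) : ∃ C : ℝ≥0,
    ∀ (e : HalfSobolev s) (w : ℝ → ℂ), ContDiffOn ℝ ∞ w (Ioi 0) →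
      Represents (halfSobolevEmb s e) w → weightNorm 0 i w ≤ C * ‖e‖ₑ := by
  obtain ⟨C, hC⟩ := eLpNorm_iteratedDeriv_le_of_represents halfLine hi
  refine ⟨C * ‖halfSection s‖₊, fun e w hw he => ?_⟩
  rw [halfSobolevEmb_eq] at he
  rw [weightNorm_zero_left, ENNReal.coe_mul, mul_assoc]
  refine (hC _ w hw he).trans ?_
  gcongr
  exact (halfSection s).le_opENorm e

/-- The element is the pair (χ ⟨t⟩^ρ w, (1 - χ) ⟨t⟩^ρ w), the first component handled on the whole
line in the variable x = -ln t, the second on the half-line. Both need only the norms with l' ≤ l.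
-/
theorem exists_weightedConeEmb_represents {χ : ℝ → ℝ} (hχ : IsCutoff χ) (s ρ : ℝ) :
    ∃ (M : ℕ) (C : ℝ≥0), ∀ w : ℝ → ℂ, ContDiffOn ℝ ∞ w (Ioi 0) →
      (∀ l l', l' ≤ l → weightNorm l l' w < ⊤) →
      ∃ e : ConeSobolev hχ s 0, Represents (weightedConeEmb hχ s 0 ρ e) w ∧
        ‖e‖ₑ ≤ C * weightSum M w := by
  have hR : ρ ≤ ⌈ρ⌉₊ := Nat.le_ceil ρ
  set R := ⌈ρ⌉₊
  obtain ⟨N₁, C₁, hf₁⟩ := exists_sobolevEmb_represents ⊤ ⟨0, trivial⟩ (fun _ _ _ _ => trivial) s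
  obtain ⟨N₂, C₂, hf₂⟩ := exists_halfSobolevEmb_represents s
  have hmono : ∀ w, Monotone fun i => weightSum (i + R) w := fun w i j h =>
    weightSum_mono w (by omega)
  have hlog : ∀ i, ∃ C : ℝ≥0, ∀ w : ℝ → ℂ, ContDiffOn ℝ ∞ w (Ioi 0) →
      eLpNorm (iteratedDeriv i (logPull fun t => ((χ t * bracketPow ρ t : ℝ) : ℂ) * w t)) 2 volume ≤
        C * weightSum (i + R) w := by
    intro i
    obtain ⟨C, hC⟩ := exists_eLpNorm_iteratedDeriv_logPull_le i
    obtain ⟨D, hD⟩ := exists_sum_le_of_forall_exists hmono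
      (hχ.exists_weightNorm_mul_bracketPow_le hR) i
    refine ⟨C * D, fun w hw => (hC _ ?_).trans ?_⟩
    · exact (Complex.ofRealCLM.contDiff.comp_contDiffOn
        (hχ.smooth.mul (contDiffOn_bracketPow ρ))).mul hw
    · rw [ENNReal.coe_mul, mul_assoc]
      gcongr
      exact hD w hw
  obtain ⟨D₁, hD₁⟩ := exists_sum_le_of_forall_exists hmono hlog N₁
  obtain ⟨D₂, hD₂⟩ := exists_sum_le_of_forall_exists hmono
    (hχ.exists_weightNorm_one_sub_mul_bracketPow_le hR) N₂
  choose B₁ hB₁ using hlog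
  choose B₂ hB₂ using hχ.exists_weightNorm_one_sub_mul_bracketPow_le hR
  refine ⟨N₁ + N₂ + R, C₁ * D₁ + C₂ * D₂, fun w hw hfin => ?_⟩
  set g₁ : ℝ → ℂ := fun t => ((χ t * bracketPow ρ t : ℝ) : ℂ) * w t with hg₁
  set g₂ : ℝ → ℂ := fun t => (((1 - χ t) * bracketPow ρ t : ℝ) : ℂ) * w t with hg₂
  have hs₁ : ContDiffOn ℝ ∞ g₁ (Ioi 0) := (Complex.ofRealCLM.contDiff.comp_contDiffOn
    (hχ.smooth.mul (contDiffOn_bracketPow ρ))).mul hw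
  have hs₂ : ContDiffOn ℝ ∞ g₂ (Ioi 0) := (Complex.ofRealCLM.contDiff.comp_contDiffOn
    (hχ.contDiffOn_one_sub.mul (contDiffOn_bracketPow ρ))).mul hw
  have hsum := weightSum_lt_top hfin
  obtain ⟨a, ha, hna⟩ := hf₁ (logPull g₁) (contDiff_logPull hs₁).contDiffOn fun i =>
    ⟨aestronglyMeasurable_iteratedDeriv_opens (Ω := ⊤) (contDiff_logPull hs₁).contDiffOn i, by
      rw [Opens.coe_top, Measure.restrict_univ]
      exact (hB₁ i w hw).trans_lt (ENNReal.mul_lt_top ENNReal.coe_lt_top (hsum _))⟩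
  obtain ⟨b, hb, hnb⟩ := hf₂ g₂ hs₂ fun i =>
    (hB₂ i w hw).trans_lt (ENNReal.mul_lt_top ENNReal.coe_lt_top (hsum _))
  have ha' := represents_mellinSobolevEmb ha
  have hu := ha'.add hb hs₁.continuousOn hs₂.continuousOn
  -- The underlying distribution is the sum of the two pieces, with density ⟨t⟩^ρ w; multiplying it
  -- by χ and 1 - χ returns the pieces.
  let e : ConeSobolev hχ s 0 := ⟨WithLp.toLp 1 (a, b), mellinSobolevEmb s 0 a + halfSobolevEmb s b, by
    refine Represents.ext ((hu.mulDist hχ.smooth).congr fun t _ => ?_) ha'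
    simp only [hg₁, hg₂]
    push_cast
    ring, by
    refine Represents.ext ((hu.mulDist hχ.contDiffOn_one_sub).congr fun t _ => ?_) hb
    simp only [hg₁, hg₂]
    push_cast
    ring⟩
  refine ⟨e, (hu.mulDist (contDiffOn_bracketPow (-ρ))).congr fun t _ => ?_, ?_⟩
  · have h1 : bracketPow (-ρ) t * bracketPow ρ t = 1 := by
      simp only [bracketPow]
      rw [← Real.rpow_add (by positivity), neg_div, neg_add_cancel, Real.rpow_zero]
    have h2 : (bracketPow (-ρ) t : ℂ) * (bracketPow ρ t : ℂ) = 1 := by exact_mod_cast h1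
    simp only [hg₁, hg₂]
    push_cast
    linear_combination w t * h2
  · have hne : ‖e‖ = ‖a‖ + ‖b‖ := WithLp.prod_norm_eq_of_L1 (WithLp.toLp 1 (a, b))
    have hne' : ‖e‖ₑ = ‖a‖ₑ + ‖b‖ₑ := by
      rw [← ofReal_norm, hne, ENNReal.ofReal_add (norm_nonneg _) (norm_nonneg _), ofReal_norm,
        ofReal_norm]
    rw [hne', ENNReal.coe_add, ENNReal.coe_mul, ENNReal.coe_mul, add_mul, mul_assoc, mul_assoc]
    rw [Opens.coe_top, Measure.restrict_univ] at hna
    refine add_le_add (hna.trans ?_) (hnb.trans ?_)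
    · gcongr
      refine (hD₁ w hw).trans ?_
      gcongr
      exact weightSum_mono w (by omega)
    · gcongr
      refine (hD₂ w hw).trans ?_
      gcongr
      exact weightSum_mono w (by omega)

theorem weightNorm_le_add {w w₁ w₂ : ℝ → ℂ} (h₁ : ContDiffOn ℝ ∞ w₁ (Ioi 0))
    (h₂ : ContDiffOn ℝ ∞ w₂ (Ioi 0)) (h : EqOn w (fun t => w₁ t + w₂ t) (Ioi 0)) {l l' : ℕ} :
    weightNorm l l' w ≤ weightNorm l l' w₁ + weightNorm l l' w₂ := by
  have hm : ∀ {g : ℝ → ℂ}, ContDiffOn ℝ ∞ g (Ioi 0) →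
      AEStronglyMeasurable (fun t : ℝ => (t : ℂ) ^ l * iteratedDeriv l' g t)
        (volume.restrict (Ioi 0)) := fun hg =>
    (Complex.continuous_ofReal.pow l).aestronglyMeasurable.mul
      (aestronglyMeasurable_iteratedDeriv_opens (Ω := halfLine) hg l')
  refine (eLpNorm_congr_ae ?_).trans_le (eLpNorm_add_le (hm h₁) (hm h₂) (by norm_num))
  filter_upwards [ae_restrict_mem measurableSet_Ioi] with t ht
  have he : w =ᶠ[𝓝 t] fun t => w₁ t + w₂ t := h.eventuallyEq_of_mem (Ioi_mem_nhds ht)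
  have hc : ∀ {g : ℝ → ℂ}, ContDiffOn ℝ ∞ g (Ioi 0) → ContDiffAt ℝ l' g t := fun hg =>
    (hg.contDiffAt (Ioi_mem_nhds ht)).of_le (mod_cast le_top)
  have ha : iteratedDeriv l' (fun t => w₁ t + w₂ t) t = _ := iteratedDeriv_add (hc h₁) (hc h₂)
  rw [he.iteratedDeriv_eq, ha, Pi.add_apply, mul_add]

/-- The order s = l' supplies the derivatives and the weight ρ = l supplies the power: t^l ⟨t⟩^{-l}
is bounded by t^j on the cut-off piece and by 1 on the other, using j ≤ l' ≤ l. -/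
theorem exists_weightNorm_le_of_represents {χ : ℝ → ℝ} (hχ : IsCutoff χ) {l l' : ℕ} (hl : l' ≤ l) :
    ∃ C : ℝ≥0, ∀ (e : ConeSobolev hχ l' 0) (w : ℝ → ℂ), ContDiffOn ℝ ∞ w (Ioi 0) →
      Represents (weightedConeEmb hχ l' 0 l e) w → weightNorm l l' w ≤ C * ‖e‖ₑ := by
  obtain ⟨B, hB⟩ := exists_uniform_bound (fun t _ => (bracketPow_pos (-l) t).le)
    (fun i => exists_bound_iteratedDeriv_bracketPow i (-l)) l'
  have hF : ∀ i, ∃ C : ℝ≥0, i ≤ l' → ∀ (f : L2R) (w : ℝ → ℂ), ContDiff ℝ ∞ w →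
      Represents (restrictTempered ⊤ (sobolevEmb l' f)) w →
      eLpNorm (iteratedDeriv i w) 2 volume ≤ C * ‖f‖ₑ := by
    intro i
    by_cases hi : i ≤ l'
    · obtain ⟨C, hC⟩ := eLpNorm_iteratedDeriv_le_of_represents ⊤ (i := i) (s := l') (by simpa)
      refine ⟨C, fun _ f w hw h => ?_⟩
      have := hC f w hw.contDiffOn h
      rwa [Opens.coe_top, Measure.restrict_univ] at this
    · exact ⟨0, fun h => absurd h hi⟩
  have hM : ∀ j, ∃ C : ℝ≥0, j ≤ l' → ∀ (f : L2R) (g : ℝ → ℂ), ContDiffOn ℝ ∞ g (Ioi 0) →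
      Represents (mellinSobolevEmb l' 0 f) g → weightNorm j j g ≤ C * ‖f‖ₑ := by
    intro j
    choose C hC using hF
    obtain ⟨D, hD⟩ := exists_weightNorm_le_logPull j
    refine ⟨D * ∑ i ∈ Finset.range (j + 1), C i, fun hj f g hg h => (hD g hg).trans ?_⟩
    push_cast
    rw [mul_assoc, Finset.sum_mul]
    gcongr with i hi
    exact hC i ((Finset.mem_range_succ_iff.1 hi).trans hj) f _ (contDiff_logPull hg)
      (represents_logPull h)
  have hH : ∀ j, ∃ C : ℝ≥0, j ≤ l' → ∀ (e : HalfSobolev l') (g : ℝ → ℂ), ContDiffOn ℝ ∞ g (Ioi 0) →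
      Represents (halfSobolevEmb l' e) g → weightNorm 0 j g ≤ C * ‖e‖ₑ := by
    intro j
    by_cases hj : j ≤ l'
    · obtain ⟨C, hC⟩ := exists_weightNorm_zero_le_of_represents (i := j) (s := l') (by simpa)
      exact ⟨C, fun _ => hC⟩
    · exact ⟨0, fun h => absurd h hj⟩
  choose C₁ hC₁ using hM
  choose C₂ hC₂ using hH
  set c₁ : ℝ≥0 := ∑ j ∈ Finset.range (l' + 1), C₁ j
  set c₂ : ℝ≥0 := ∑ j ∈ Finset.range (l' + 1), C₂ j
  refine ⟨2 ^ l' * B * 1 * c₁ + 2 ^ l' * B * 1 * c₂, fun e w hw hrep => ?_⟩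
  set v : ℝ → ℂ := fun t => (bracketPow l t : ℂ) * w t with hv
  have hvs : ContDiffOn ℝ ∞ v (Ioi 0) :=
    (Complex.ofRealCLM.contDiff.comp_contDiffOn (contDiffOn_bracketPow l)).mul hw
  have hbr : ∀ t, bracketPow (-l) t * bracketPow l t = 1 := fun t => by
    simp only [bracketPow]
    rw [← Real.rpow_add (by positivity), neg_div, neg_add_cancel, Real.rpow_zero]
  have hrv : Represents (coneSobolevEmb hχ l' 0 e) v := by
    have := hrep.mulDist (contDiffOn_bracketPow l)
    have h2 := mulDist_mulDist_of_mul_eq_one (contDiffOn_bracketPow (-l)) (contDiffOn_bracketPow l)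
      (fun t _ => hbr t) (coneSobolevEmb hχ l' 0 e)
    exact h2 ▸ this
  obtain ⟨u, hu₁, hu₂⟩ := e.2
  have hu : u = coneSobolevEmb hχ l' 0 e := by
    rw [← mulDist_add_mulDist_one_sub hχ.smooth hχ.contDiffOn_one_sub u]
    exact congrArg₂ (· + ·) hu₁ hu₂
  subst hu
  have hr₁ : Represents (mellinSobolevEmb l' 0 e.1.fst) fun t => (χ t : ℂ) * v t :=
    hu₁ ▸ hrv.mulDist hχ.smooth
  have hr₂ : Represents (halfSobolevEmb l' e.1.snd) fun t => ((1 - χ t : ℝ) : ℂ) * v t :=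
    hu₂ ▸ hrv.mulDist hχ.contDiffOn_one_sub
  set v₁ : ℝ → ℂ := fun t => (χ t : ℂ) * v t with hv₁
  set v₂ : ℝ → ℂ := fun t => ((1 - χ t : ℝ) : ℂ) * v t with hv₂
  have hs₁ : ContDiffOn ℝ ∞ v₁ (Ioi 0) :=
    (Complex.ofRealCLM.contDiff.comp_contDiffOn hχ.smooth).mul hvs
  have hs₂ : ContDiffOn ℝ ∞ v₂ (Ioi 0) :=
    (Complex.ofRealCLM.contDiff.comp_contDiffOn hχ.contDiffOn_one_sub).mul hvs
  -- Near 0 the power t^j is kept for j derivatives, which is the Mellin norm; for the other piece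
  -- no power is kept.
  have hw₁ := weightNorm_ofReal_mul_le (contDiffOn_bracketPow (-l)) hs₁ l l' (D := 1)
    (Q := fun j => {j}) hB fun j hj t ht => by
      simpa using (pow_mul_bracketPow_neg_le ht (hj.trans hl)).trans (min_le_right _ _)
  have hw₂ := weightNorm_ofReal_mul_le (contDiffOn_bracketPow (-l)) hs₂ l l' (D := 1)
    (Q := fun _ => {0}) hB fun j hj t ht => by
      simpa using (pow_mul_bracketPow_neg_le ht (hj.trans hl)).trans (min_le_left _ _)
  simp only [Finset.sum_singleton] at hw₁ hw₂
  have hne : ‖e‖ = ‖e.1.fst‖ + ‖e.1.snd‖ := WithLp.prod_norm_eq_of_L1 e.1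
  have hn₁ : ‖e.1.fst‖ₑ ≤ ‖e‖ₑ := enorm_le_iff_norm_le.2 (by rw [hne]; simp)
  have hn₂ : ‖e.1.snd‖ₑ ≤ ‖e‖ₑ := enorm_le_iff_norm_le.2 (by rw [hne]; simp)
  have hb₁ : ∑ j ∈ Finset.range (l' + 1), weightNorm j j v₁ ≤ c₁ * ‖e‖ₑ := by
    simp only [c₁]
    push_cast
    rw [Finset.sum_mul]
    refine Finset.sum_le_sum fun j hj => ?_
    refine (hC₁ j (Finset.mem_range_succ_iff.1 hj) _ _ hs₁ hr₁).trans ?_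
    gcongr
  have hb₂ : ∑ j ∈ Finset.range (l' + 1), weightNorm 0 j v₂ ≤ c₂ * ‖e‖ₑ := by
    simp only [c₂]
    push_cast
    rw [Finset.sum_mul]
    refine Finset.sum_le_sum fun j hj => ?_
    refine (hC₂ j (Finset.mem_range_succ_iff.1 hj) _ _ hs₂ hr₂).trans ?_
    gcongr
  have hsplit : weightNorm l l' w ≤ weightNorm l l' (fun t => (bracketPow (-l) t : ℂ) * v₁ t) +
      weightNorm l l' (fun t => (bracketPow (-l) t : ℂ) * v₂ t) := by
    have hp : ∀ {g : ℝ → ℂ}, ContDiffOn ℝ ∞ g (Ioi 0) →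
        ContDiffOn ℝ ∞ (fun t => (bracketPow (-l) t : ℂ) * g t) (Ioi 0) := fun hg =>
      (Complex.ofRealCLM.contDiff.comp_contDiffOn (contDiffOn_bracketPow (-l))).mul hg
    refine weightNorm_le_add (hp hs₁) (hp hs₂) fun t _ => ?_
    have h2 : (bracketPow (-l) t : ℂ) * (bracketPow l t : ℂ) = 1 := by exact_mod_cast hbr t
    simp only [hv₁, hv₂, hv]
    push_cast
    linear_combination -(w t) * h2
  refine hsplit.trans ?_
  rw [ENNReal.coe_add, ENNReal.coe_mul _ c₁, ENNReal.coe_mul _ c₂, add_mul, mul_assoc _ (c₁ : ℝ≥0∞),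
    mul_assoc _ (c₂ : ℝ≥0∞)]
  exact add_le_add (hw₁.trans (mul_le_mul' le_rfl hb₁)) (hw₂.trans (mul_le_mul' le_rfl hb₂))

/-! ### Kernel estimates and operator-valued estimates -/

section Estimates

variable {m : ℕ}

/-- The weight `⟨ξ'⟩^{ν-|α|} ⟨ξ', μ⟩^{d-ν-j}` of the operator-valued estimates. -/
def symbolWeight (d ν : ℝ) (α : Fin m → ℕ) (j : ℕ) (p : PhaseSpace m) : ℝ :=
  (japXi p : ℝ) ^ (ν - multiAbs α) * (japXiMu p : ℝ) ^ (d - ν - j)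

/-- The weight in the `L²` estimate of `x_n^l D_{x_n}^{l'} k` for symbol-kernels. -/
def kernelWeight (d ν : ℝ) (α : Fin m → ℕ) (j l l' : ℕ) (p : PhaseSpace m) : ℝ :=
  (japXi p / japXiMu p : ℝ) ^ (ν - max ((l : ℝ) - l') 0 - multiAbs α) *
    (japXiMu p : ℝ) ^ (d - l + l' - multiAbs α - j)

theorem symbolWeight_pos (d ν : ℝ) (α : Fin m → ℕ) (j : ℕ) (p : PhaseSpace m) :
    0 < symbolWeight d ν α j p :=
  mul_pos (Real.rpow_pos_of_pos (japXi p).2 _) (Real.rpow_pos_of_pos (japXiMu p).2 _)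

theorem coe_inv_positive (c : {x : ℝ // 0 < x}) : ((c⁻¹ : {x : ℝ // 0 < x}) : ℝ) = (c : ℝ)⁻¹ := rfl

/-- For l' ≤ l the scaling factor ⟨ξ'⟩^{l-l'} cancels the loss [l-l']₊ of regularity, and the powers
of ⟨ξ',μ⟩ recombine to d - ν - j. -/
theorem japXi_inv_rpow_mul_kernelWeight (d ν : ℝ) (α : Fin m → ℕ) (j : ℕ) {l l' : ℕ} (h : l' ≤ l)
    (p : PhaseSpace m) : (((japXi p)⁻¹ : {x : ℝ // 0 < x}) : ℝ) ^ ((l' : ℝ) - l) *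
      kernelWeight d ν α j l l' p = symbolWeight d ν α j p := by
  have h1 : max ((l : ℝ) - l') 0 = l - l' := max_eq_left (by simpa using h)
  -- As exponentials of logarithms, the weights agree once a polynomial identity between the
  -- exponents holds.
  rw [kernelWeight, symbolWeight, coe_inv_positive, h1, ← Real.exp_log (japXi p).2,
    ← Real.exp_log (japXiMu p).2, ← Real.exp_sub, ← Real.exp_neg]
  simp only [← Real.exp_mul, ← Real.exp_add]
  congr 1
  ring

theorem japXiMu_inv_rpow_mul_kernelWeight (d ν : ℝ) (α : Fin m → ℕ) (j : ℕ) {l l' : ℕ} (h : l ≤ l')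
    (p : PhaseSpace m) : (((japXiMu p)⁻¹ : {x : ℝ // 0 < x}) : ℝ) ^ ((l' : ℝ) - l) *
      kernelWeight d ν α j l l' p = symbolWeight d ν α j p := by
  have h1 : max ((l : ℝ) - l') 0 = 0 := max_eq_right (by simpa using h)
  rw [kernelWeight, symbolWeight, coe_inv_positive, h1, ← Real.exp_log (japXi p).2,
    ← Real.exp_log (japXiMu p).2, ← Real.exp_sub, ← Real.exp_neg]
  simp only [← Real.exp_mul, ← Real.exp_add]
  congr 1
  ring

/-- Uniform bounds for the norms `‖t^l ∂_t^{l'} κ_{lam}⁻¹ ∂_{x'}^β ∂_{ξ'}^α ∂_μ^j k‖_{L²(ℝ₊)}`. -/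
def HasDilatedBound (lam : PhaseSpace m → {x : ℝ // 0 < x}) (d ν : ℝ) (k : PhaseSpace m × ℝ → ℂ)
    (l l' : ℕ) : Prop :=
  ∀ (β α : Fin m → ℕ) (j : ℕ), ∃ C : ℝ, ∀ p ∈ phaseDomain m,
    weightNorm l l' (dilate ((lam p)⁻¹ : {x : ℝ // 0 < x}) (kernelDeriv β α j k p)) ≤
      ENNReal.ofReal (C * symbolWeight d ν α j p)

theorem weightNorm_dilate_le_iff {c : ℝ} (hc : 0 < c) {l l' : ℕ} {w : ℝ → ℂ} {C X Y : ℝ}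
    (h : c ^ ((l' : ℝ) - l) * Y = X) : weightNorm l l' (dilate c w) ≤ ENNReal.ofReal (C * X) ↔
      weightNorm l l' w ≤ ENNReal.ofReal (C * Y) := by
  have h0 : 0 < c ^ ((l' : ℝ) - l) := Real.rpow_pos_of_pos hc _
  rw [weightNorm_dilate hc, ← h, mul_left_comm, ENNReal.ofReal_mul h0.le]
  exact ENNReal.mul_le_mul_iff_right (by simpa using h0) ENNReal.ofReal_ne_top

variable {k : PhaseSpace m × ℝ → ℂ} {d ν : ℝ}

theorem eLpNorm_paramDeriv_eq_weightNorm (hk : ContDiffOn ℝ ∞ k (kernelDomain m))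
    (β α : Fin m → ℕ) (j l l' : ℕ) {p : PhaseSpace m} (hp : p ∈ phaseDomain m) :
    eLpNorm (fun t : ℝ => paramDeriv (LinearMap.inl ℝ (PhaseSpace m) ℝ) (kernelDomain m) β α j
        (fun q => (q.2 : ℂ) ^ l * (dirDeriv (kernelDomain m) (0, 1))^[l'] k q) (p, t))
      2 (volume.restrict (Ioi 0)) = weightNorm l l' (kernelDeriv β α j k p) := by
  refine eLpNorm_congr_ae ?_
  filter_upwards [ae_restrict_mem measurableSet_Ioi] with t ht
  exact paramDeriv_pow_mul_iterate hk β α j l l' hp ht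

theorem IsWeakPoissonKernel.hasDilatedBound_japXi (hk : IsWeakPoissonKernel d ν k) {l l' : ℕ}
    (h : l' ≤ l) : HasDilatedBound japXi d ν k l l' := by
  intro β α j
  obtain ⟨C, hC⟩ := hk.estimate β α j l l'
  refine ⟨C, fun p hp => (weightNorm_dilate_le_iff (japXi p)⁻¹.2
    (japXi_inv_rpow_mul_kernelWeight d ν α j h p)).2 ?_⟩
  exact (eLpNorm_paramDeriv_eq_weightNorm hk.smooth β α j l l' hp).symm.trans_le (hC p hp)

theorem IsWeakPoissonKernel.hasDilatedBound_japXiMu (hk : IsWeakPoissonKernel d ν k) {l l' : ℕ}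
    (h : l ≤ l') : HasDilatedBound japXiMu d ν k l l' := by
  intro β α j
  obtain ⟨C, hC⟩ := hk.estimate β α j l l'
  refine ⟨C, fun p hp => (weightNorm_dilate_le_iff (japXiMu p)⁻¹.2
    (japXiMu_inv_rpow_mul_kernelWeight d ν α j h p)).2 ?_⟩
  exact (eLpNorm_paramDeriv_eq_weightNorm hk.smooth β α j l l' hp).symm.trans_le (hC p hp)

/-- Interpolation of weights: t^l ≤ 1 + t^n for l ≤ n. -/
theorem weightNorm_le_weightNorm_zero_add {w : ℝ → ℂ} (hw : ContDiffOn ℝ ∞ w (Ioi 0)) {l l' n : ℕ}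
    (h : l ≤ n) : weightNorm l l' w ≤ weightNorm 0 l' w + weightNorm n l' w := by
  have h1 := eLpNorm_two_le_mul_sum (μ := volume.restrict (Ioi 0)) ({0, 1} : Finset ℕ)
    (f := fun t : ℝ => (t : ℂ) ^ l * iteratedDeriv l' w t)
    (g := fun i t => (t : ℂ) ^ (i * n) * iteratedDeriv l' w t) (fun i _ =>
      (Complex.continuous_ofReal.pow _).aestronglyMeasurable.mul
        (aestronglyMeasurable_iteratedDeriv_opens (Ω := halfLine) hw l')) 1 ?_
  · simpa [weightNorm] using h1
  filter_upwards [ae_restrict_mem measurableSet_Ioi] with t ht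
  have ht0 : (0 : ℝ) < t := ht
  have h2 : t ^ l ≤ 1 + t ^ n := by
    rcases le_total t 1 with h' | h'
    · exact (pow_le_one₀ ht0.le h').trans (by simp; positivity)
    · exact (pow_le_pow_right₀ h' h).trans (by simp)
  simp only [Finset.sum_pair zero_ne_one, norm_mul, norm_pow, Complex.norm_real,
    Real.norm_of_nonneg ht0.le, NNReal.coe_one, one_mul, zero_mul, pow_zero]
  calc _ ≤ (1 + t ^ n) * ‖iteratedDeriv l' w t‖ := by gcongr
    _ = _ := by ring

theorem isWeakPoissonKernel_of_hasDilatedBound (hk : ContDiffOn ℝ ∞ k (kernelDomain m))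
    (h₁ : ∀ l l', l' ≤ l → HasDilatedBound japXi d ν k l l')
    (h₂ : ∀ l', HasDilatedBound japXiMu d ν k 0 l') : IsWeakPoissonKernel d ν k := by
  refine ⟨hk, fun β α j l l' => ?_⟩
  rcases le_total l' l with h | h
  · obtain ⟨C, hC⟩ := h₁ l l' h β α j
    refine ⟨C, fun p hp => (eLpNorm_paramDeriv_eq_weightNorm hk β α j l l' hp).trans_le ?_⟩
    exact (weightNorm_dilate_le_iff (japXi p)⁻¹.2
      (japXi_inv_rpow_mul_kernelWeight d ν α j h p)).1 (hC p hp)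
  -- For l ≤ l' the bound is interpolated between (0, l'), known at the scale ⟨ξ',μ⟩, and (l', l'),
  -- known at the scale ⟨ξ'⟩.
  · obtain ⟨C, hC⟩ := h₁ l' l' le_rfl β α j
    obtain ⟨D, hD⟩ := h₂ l' β α j
    refine ⟨|D| + |C|, fun p hp => (eLpNorm_paramDeriv_eq_weightNorm hk β α j l l' hp).trans_le ?_⟩
    refine (weightNorm_dilate_le_iff (japXiMu p)⁻¹.2
      (japXiMu_inv_rpow_mul_kernelWeight d ν α j h p)).1 ?_
    -- On the diagonal l = l' both rescalings are equivalent to the same kernel estimate, so the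
    -- bound moves from one scale to the other.
    have hC' := (weightNorm_dilate_le_iff (japXiMu p)⁻¹.2
      (japXiMu_inv_rpow_mul_kernelWeight d ν α j le_rfl p)).2
      ((weightNorm_dilate_le_iff (japXi p)⁻¹.2
        (japXi_inv_rpow_mul_kernelWeight d ν α j le_rfl p)).1 (hC p hp))
    have h0 := (symbolWeight_pos d ν α j p).le
    refine (weightNorm_le_weightNorm_zero_add
      (contDiffOn_dilate (japXiMu p)⁻¹.2 (contDiffOn_kernelDeriv hk β α j hp)) h).trans ?_
    rw [add_mul, ENNReal.ofReal_add (by positivity) (by positivity)]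
    refine add_le_add ((hD p hp).trans ?_) (hC'.trans ?_) <;>
    · gcongr
      exact le_abs_self _

/-! ### Between dilated bounds and operator-valued estimates. -/

theorem weightNorm_const_mul (c : ℂ) (l l' : ℕ) (w : ℝ → ℂ) :
    weightNorm l l' (fun t => c * w t) = ‖c‖ₑ * weightNorm l l' w := by
  rw [weightNorm, weightNorm, ← eLpNorm_const_smul]
  refine congrArg (fun f => eLpNorm f 2 _) (funext fun t => ?_)
  rw [iteratedDeriv_const_mul_field]
  simp only [Pi.smul_apply, smul_eq_mul]
  ring

theorem dilate_const_mul (a : ℝ) (c : ℂ) (w : ℝ → ℂ) :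
    dilate a (fun t => c * w t) = fun t => c * dilate a w t := by
  ext t
  simp only [dilate]
  ring

variable {E : Type*} [NormedAddCommGroup E] [NormedSpace ℂ E]
  {emb : E →ₗ[ℂ] 𝓓'(halfLine, ℂ)} {K : PhaseSpace m → ℂ →ₗ[ℂ] 𝓓'(halfLine, ℂ)}
  {lam : PhaseSpace m → {x : ℝ // 0 < x}}

/-- The relation `G` singles out the pairs (l, l') whose norms govern the target space: l' ≤ l for
the cone spaces and l = 0 for H^s(ℝ₊). The rescaled kernel derivative is realised in `E` by `hE`,
and equality of densities identifies this element with the rescaled derivative of the lift. -/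
theorem isWeakSymbol_of_hasDilatedBound (hk : ContDiffOn ℝ ∞ k (kernelDomain m))
    (hkK : IsKernelOf k K) (hH : SmoothInto (halfSobolevEmb 3) K)
    (hemb : ∀ φ : 𝓓(halfLine, ℝ), Continuous fun e => emb e φ) (hK : SmoothInto emb K)
    {G : ℕ → ℕ → Prop} {ι : Type*} (I : Finset ι) (l l' : ι → ℕ) (hI : ∀ i ∈ I, G (l i) (l' i))
    (D : ℝ≥0) (hE : ∀ w : ℝ → ℂ, ContDiffOn ℝ ∞ w (Ioi 0) →
      (∀ a b, G a b → weightNorm a b w < ⊤) →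
      ∃ e : E, Represents (emb e) w ∧ ‖e‖ₑ ≤ D * ∑ i ∈ I, weightNorm (l i) (l' i) w)
    (hb : ∀ a b, G a b → HasDilatedBound lam d ν k a b) : IsWeakSymbol emb lam d ν K := by
  obtain ⟨A, hA⟩ := hK
  refine ⟨A, hA, fun β α j => ?_⟩
  have hb' : ∀ i, ∃ C : ℝ, i ∈ I → ∀ p ∈ phaseDomain m,
      weightNorm (l i) (l' i) (dilate ((lam p)⁻¹ : {x : ℝ // 0 < x}) (kernelDeriv β α j k p)) ≤
        ENNReal.ofReal (C * symbolWeight d ν α j p) := by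
    intro i
    by_cases hi : i ∈ I
    · obtain ⟨C, hC⟩ := hb _ _ (hI i hi) β α j
      exact ⟨C, fun _ => hC⟩
    · exact ⟨0, fun h => absurd h hi⟩
  choose C hC using hb'
  refine ⟨D * ∑ i ∈ I, |C i|, fun p hp c => ?_⟩
  set u := dilate ((lam p)⁻¹ : {x : ℝ // 0 < x}) (kernelDeriv β α j k p) with hu
  have hus : ContDiffOn ℝ ∞ u (Ioi 0) :=
    contDiffOn_dilate (lam p)⁻¹.2 (contDiffOn_kernelDeriv hk β α j hp)
  obtain ⟨e, he, hne⟩ := hE (fun t => c * u t) (contDiffOn_const.mul hus) fun a b hab => by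
    obtain ⟨B, hB⟩ := hb a b hab β α j
    rw [weightNorm_const_mul]
    exact ENNReal.mul_lt_top enorm_lt_top ((hB p hp).trans_lt ENNReal.ofReal_lt_top)
  have hr := (represents_paramDeriv hk hkK hH hemb hA β α j hp c).kappa (lam p)⁻¹
  rw [dilate_const_mul] at hr
  refine ⟨e, he.ext hr, ?_⟩
  have h0 := (symbolWeight_pos d ν α j p).le
  have h1 : ∑ i ∈ I, weightNorm (l i) (l' i) (fun t => c * u t) ≤
      ENNReal.ofReal ((∑ i ∈ I, |C i|) * symbolWeight d ν α j p * ‖c‖) := by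
    rw [Finset.sum_mul, Finset.sum_mul,
      ENNReal.ofReal_sum_of_nonneg fun i _ => by positivity]
    refine Finset.sum_le_sum fun i hi => ?_
    rw [weightNorm_const_mul, ENNReal.ofReal_mul' (norm_nonneg c), ofReal_norm, mul_comm]
    gcongr
    refine (hC i hi p hp).trans ?_
    gcongr
    exact le_abs_self _
  have h2 : ENNReal.ofReal ‖e‖ ≤ ENNReal.ofReal
      (D * ((∑ i ∈ I, |C i|) * symbolWeight d ν α j p * ‖c‖)) := by
    rw [ofReal_norm, ENNReal.ofReal_mul D.coe_nonneg, ENNReal.ofReal_coe_nnreal]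
    exact hne.trans (mul_le_mul' le_rfl h1)
  have hs : 0 ≤ ∑ i ∈ I, |C i| := Finset.sum_nonneg fun _ _ => abs_nonneg _
  rw [ENNReal.ofReal_le_ofReal_iff (by positivity)] at h2
  refine h2.trans_eq ?_
  rw [symbolWeight]
  ring

/-- The element provided by the symbol estimate for c = 1 has the dilated kernel derivative as its
density, so an estimate of N(l,l') by the norm of `E` suffices. -/
theorem IsWeakSymbol.hasDilatedBound (h : IsWeakSymbol emb lam d ν K)
    (hk : ContDiffOn ℝ ∞ k (kernelDomain m)) (hkK : IsKernelOf k K)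
    (hH : SmoothInto (halfSobolevEmb 3) K)
    (hemb : ∀ φ : 𝓓(halfLine, ℝ), Continuous fun e => emb e φ) {l l' : ℕ} {D : ℝ≥0}
    (hE : ∀ (e : E) (w : ℝ → ℂ), ContDiffOn ℝ ∞ w (Ioi 0) → Represents (emb e) w →
      weightNorm l l' w ≤ D * ‖e‖ₑ) : HasDilatedBound lam d ν k l l' := by
  obtain ⟨A, hA, hest⟩ := h
  intro β α j
  obtain ⟨C, hC⟩ := hest β α j
  refine ⟨D * C, fun p hp => ?_⟩
  obtain ⟨e, he, hne⟩ := hC p hp 1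
  have hr := (represents_paramDeriv hk hkK hH hemb hA β α j hp 1).kappa (lam p)⁻¹
  rw [← he] at hr
  simp only [one_mul] at hr
  refine (hE e _ (contDiffOn_dilate (lam p)⁻¹.2 (contDiffOn_kernelDeriv hk β α j hp)) hr).trans ?_
  rw [mul_assoc, ENNReal.ofReal_mul D.coe_nonneg, ENNReal.ofReal_coe_nnreal, ← ofReal_norm]
  gcongr
  rw [norm_one, mul_one] at hne
  exact hne

end Estimates

end

/-! ### The equivalence of the two descriptions. -/

theorem mainTheorem6 (m : ℕ) (d ν : ℝ) (χ : ℝ → ℝ) (hχ : IsCutoff χ)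
    (K : PhaseSpace m → ℂ →ₗ[ℂ] 𝓓'(halfLine, ℂ))
    (hH : ∀ s δ : ℝ, SmoothInto (weightedSobolevEmb s δ) K)
    (hK : ∀ s ρ : ℝ, SmoothInto (weightedConeEmb hχ s 0 ρ) K) :
    (∃ k : PhaseSpace m × ℝ → ℂ, IsWeakPoissonKernel d ν k ∧ IsKernelOf k K) ↔
      (∀ s ρ : ℝ, IsWeakSymbol (weightedConeEmb hχ s 0 ρ) japXi d ν K) ∧
      (∀ s : ℝ, IsWeakSymbol (halfSobolevEmb s) japXiMu d ν K) := by
  have hH' : ∀ s, SmoothInto (halfSobolevEmb s) K := fun s => smoothInto_halfSobolevEmb (hH s 0)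
  constructor
  · rintro ⟨k, hk, hkK⟩
    refine ⟨fun s ρ => ?_, fun s => ?_⟩
    · obtain ⟨M, C, hC⟩ := exists_weightedConeEmb_represents hχ s ρ
      exact isWeakSymbol_of_hasDilatedBound hk.smooth hkK (hH' 3)
        (continuous_weightedConeEmb_apply hχ s 0 ρ) (hK s ρ) (G := fun l l' => l' ≤ l)
        ((Finset.range (M + 1)).sigma fun l => Finset.range (l + 1)) Sigma.fst Sigma.snd
        (fun x hx => Finset.mem_range_succ_iff.1 (Finset.mem_sigma.1 hx).2) C
        (fun w hw h => by
          rw [Finset.sum_sigma]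
          exact hC w hw h)
        fun l l' h => hk.hasDilatedBound_japXi h
    · obtain ⟨N, C, hC⟩ := exists_halfSobolevEmb_represents s
      exact isWeakSymbol_of_hasDilatedBound hk.smooth hkK (hH' 3)
        (continuous_halfSobolevEmb_apply s) (hH' s) (G := fun l _ => l = 0) _
        (fun _ => 0) (fun i => i) (fun _ _ => rfl) C
        (fun w hw h => hC w hw fun i => h 0 i rfl)
        fun l l' h => hk.hasDilatedBound_japXiMu (h ▸ Nat.zero_le l')
  · rintro ⟨h₁, h₂⟩
    obtain ⟨k, hk, hkK⟩ := exists_smooth_kernel hH'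
    refine ⟨k, isWeakPoissonKernel_of_hasDilatedBound hk (fun l l' h => ?_) (fun l' => ?_), hkK⟩
    -- A single cone space, with s = l' and ρ = l, controls the pair (l, l').
    · obtain ⟨D, hD⟩ := exists_weightNorm_le_of_represents hχ h
      exact (h₁ l' l).hasDilatedBound hk hkK (hH' 3) (continuous_weightedConeEmb_apply hχ l' 0 l) hD
    · obtain ⟨D, hD⟩ := exists_weightNorm_zero_le_of_represents (le_refl (l' : ℝ))
      exact (h₂ l').hasDilatedBound hk hkK (hH' 3) (continuous_halfSobolevEmb_apply l') hD
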